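/- Conventions. For a compact set $K\subset\mathbb R^n$ that is star-shaped with respect to the origin, $\rho_K(\xi)=\max\{a: a\xi\in K\}$ denotes its radial function on $S^{n-1}$. A star body is a compact set with non-empty interior that is star-shaped with respect to the origin and whose radial function (which is non-negative, and may vanish in some directions) is continuous on $S^{n-1}$. For origin-symmetric star bodies $K,L\subset\mathbb R^n$, $K$ is the intersection body of $L$ if $\rho_K(\xi)=\mathrm{Vol}_{n-1}(L\cap\xi^\perp)$ for all $\xi\in S^{n-1}$. The spherical Radon transform is $Rg(\xi)=\int_{S^{n-1}\cap\xi^\perp}g(\theta)\,d\theta$. An origin-symmetric star body $K\subset\mathbb R^n$ is an intersection body if there is an even finite non-negative Borel measure $\mu$ on $S^{n-1}$ such that $\int_{S^{n-1}}\rho_K(\xi)g(\xi)\,d\xi=\int_{S^{n-1}}Rg\,d\mu$ for every continuous $g$ on $S^{n-1}$. Given a function $\rho\ge 0$ on $[0,\pi/2]$, $K_m\subset\mathbb R^m$ denotes the centered body of revolution about the $x_m$-axis whose radial function in a direction that makes the angle $\varphi\in[0,\pi/2]$ with the axis is $\rho(\varphi)$. A set $L\subset\mathbb R^n$ is equator-convex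 if its intersection with every hyperplane $\{x_n=c\}$, $c\in\mathbb R$, is convex. Theorem. Let $n\ge 4$ be even, let $\rho:[0,\pi/2]\to[0,\infty)$, and suppose that $K_n$ is the intersection body of an origin-symmetric star body $L\subset\mathbb R^n$. For $0\le t\le 1$ let $f(t)=\rho_L(\arccos t)$, where $\rho_L(\psi)$ denotes the radial function of $L$ in the direction $\cos\psi\, e_n+\sin\psi\, e_1$, which makes the angle $\psi$ with the $x_n$-axis. (i) If $f\in C^1([0,1])$, then the inverse spherical Radon transform of $\rho_{K_{n+2}}$ on $S^{n+1}$, that is, the unique even continuous function $h$ on $S^{n+1}$ with $Rh=\rho_{K_{n+2}}$, is $$h(\theta)=\frac1{2\pi}f(t)^{n-2}\bigl(f(t)+t f'(t)\bigr),\qquad t=|\theta_{n+2}|.$$ (ii) If $L$ is equator-convex and $f\in C^1([0,1])$, then $K_{n+2}$ is the intersection body of an origin-symmetric star body in $\mathbb R^{n+2}$. (iii) If $L$ is not equator-convex, then $K_{n+2}$ is not an intersection body (in the general sense, with a measure $\mu$). -/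

import Mathlib

open MeasureTheory Metric Set
open scoped RealInnerProductSpace

noncomputable section

namespace StarBodies

/-- The `i`-th (counting from `0`) standard unit vector of `ℝⁿ` (zero if `n ≤ i`). -/
def unitVec (n i : ℕ) : EuclideanSpace ℝ (Fin n) :=
  WithLp.toLp 2 (fun j : Fin n => if (j : ℕ) = i then (1 : ℝ) else 0)

/-- The unit vector spanning the `xₙ`-axis, the axis of revolution. -/
def axis (n : ℕ) : EuclideanSpace ℝ (Fin n) := unitVec n (n - 1)

/-- The last coordinate `xₙ`. -/
def height {n : ℕ} (x : EuclideanSpace ℝ (Fin n)) : ℝ := ⟪axis n, x⟫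

/-- The radial function `ρ_K(ξ) = max {a : a ξ ∈ K}`. -/
def radial {n : ℕ} (K : Set (EuclideanSpace ℝ (Fin n))) (ξ : EuclideanSpace ℝ (Fin n)) : ℝ :=
  sSup {a : ℝ | a • ξ ∈ K}

/-- A star body: a compact set with non-empty interior which is star-shaped with respect to the
origin and whose radial function is continuous on the sphere. -/
structure IsStarBody {n : ℕ} (K : Set (EuclideanSpace ℝ (Fin n))) : Prop where
  isCompact : IsCompact K
  nonempty_interior : (interior K).Nonempty
  starConvex : StarConvex ℝ 0 K
  continuous_radial :
    Continuous (fun θ : sphere (0 : EuclideanSpace ℝ (Fin n)) 1 => radial K (θ : _))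

/-- Symmetry about the origin. -/
def IsOriginSymmetric {n : ℕ} (K : Set (EuclideanSpace ℝ (Fin n))) : Prop :=
  ∀ x ∈ K, -x ∈ K

/-- Lebesgue measure of the hyperplane `ξ^⊥`, as a Euclidean space in its own right
(the cube spanned by an orthonormal basis has measure one). -/
def hyperplaneMeasure {n : ℕ} (ξ : EuclideanSpace ℝ (Fin n)) : Measure (ℝ ∙ ξ)ᗮ :=
  (stdOrthonormalBasis ℝ (ℝ ∙ ξ)ᗮ).toBasis.addHaar

/-- The `(n-1)`-dimensional volume of the central section `L ∩ ξ^⊥`. -/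
def sectionVolume {n : ℕ} (L : Set (EuclideanSpace ℝ (Fin n)))
    (ξ : EuclideanSpace ℝ (Fin n)) : ℝ :=
  (hyperplaneMeasure ξ).real {y : (ℝ ∙ ξ)ᗮ | (y : EuclideanSpace ℝ (Fin n)) ∈ L}

/-- `K` is the intersection body of `L`: both are origin-symmetric star bodies, and the radius
of `K` in each direction `ξ` is the volume of the section of `L` by `ξ^⊥`. -/
structure IsIntersectionBodyOf {n : ℕ} (K L : Set (EuclideanSpace ℝ (Fin n))) : Prop where
  isStarBody : IsStarBody K
  symmetric : IsOriginSymmetric K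
  isStarBody' : IsStarBody L
  symmetric' : IsOriginSymmetric L
  radial_eq : ∀ ξ : sphere (0 : EuclideanSpace ℝ (Fin n)) 1,
    radial K (ξ : _) = sectionVolume L (ξ : _)

/-- The inclusion of the great subsphere `S^{n-1} ∩ ξ^⊥` into `S^{n-1}`. -/
def subsphereIncl {n : ℕ} (ξ : EuclideanSpace ℝ (Fin n)) (u : sphere (0 : (ℝ ∙ ξ)ᗮ) 1) :
    sphere (0 : EuclideanSpace ℝ (Fin n)) 1 :=
  ⟨((u : (ℝ ∙ ξ)ᗮ) : EuclideanSpace ℝ (Fin n)), by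
    have h := u.2
    rw [mem_sphere_zero_iff_norm] at h ⊢
    exact h⟩

/-- The spherical Radon transform `Rg(ξ) = ∫_{S^{n-1} ∩ ξ^⊥} g(θ) dθ`, with respect to the
(unnormalized) surface measure of the great subsphere. -/
def radonTransform {n : ℕ} (g : sphere (0 : EuclideanSpace ℝ (Fin n)) 1 → ℝ)
    (ξ : sphere (0 : EuclideanSpace ℝ (Fin n)) 1) : ℝ :=
  ∫ u, g (subsphereIncl (ξ : EuclideanSpace ℝ (Fin n)) u)
    ∂(hyperplaneMeasure (ξ : EuclideanSpace ℝ (Fin n))).toSphere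

/-- `K` is an intersection body (in the general sense): an origin-symmetric star body whose radial
function is, in the weak sense, the spherical Radon transform of an even non-negative finite
Borel measure on the sphere. -/
def IsIntersectionBody {n : ℕ} (K : Set (EuclideanSpace ℝ (Fin n))) : Prop :=
  IsStarBody K ∧ IsOriginSymmetric K ∧
    ∃ μ : Measure (sphere (0 : EuclideanSpace ℝ (Fin n)) 1),
      IsFiniteMeasure μ ∧ μ.map (fun θ => -θ) = μ ∧
      ∀ g : sphere (0 : EuclideanSpace ℝ (Fin n)) 1 → ℝ, Continuous g →
        ∫ ξ, radial K (ξ : EuclideanSpace ℝ (Fin n)) * g ξ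
            ∂(volume : Measure (EuclideanSpace ℝ (Fin n))).toSphere =
          ∫ ξ, radonTransform g ξ ∂μ

/-- `h` is the inverse spherical Radon transform of `G`: the unique continuous even function
on the sphere with `Rh = G`. -/
def IsInverseRadonTransform {n : ℕ} (G h : sphere (0 : EuclideanSpace ℝ (Fin n)) 1 → ℝ) : Prop :=
  (Continuous h ∧ (∀ θ, h (-θ) = h θ) ∧ ∀ ξ, radonTransform h ξ = G ξ) ∧
    ∀ h' : sphere (0 : EuclideanSpace ℝ (Fin n)) 1 → ℝ,
      Continuous h' → (∀ θ, h' (-θ) = h' θ) → (∀ ξ, radonTransform h' ξ = G ξ) → h' = h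

/-- The centered body of revolution about the `xₙ`-axis in `ℝⁿ` with radial function `ρ(φ)`,
where `φ ∈ [0, π/2]` is the angle between a direction and the axis. -/
def bodyOfRevolution (n : ℕ) (ρ : ℝ → ℝ) : Set (EuclideanSpace ℝ (Fin n)) :=
  {x | ‖x‖ ≤ ρ (Real.arccos (|height x| / ‖x‖))}

/-- Every section of `L` by a hyperplane parallel to the equator `{xₙ = 0}` is convex. -/
def EquatorConvex {n : ℕ} (L : Set (EuclideanSpace ℝ (Fin n))) : Prop :=
  ∀ c : ℝ, Convex ℝ (L ∩ {x | height x = c})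

/-- The direction on a fixed meridian (in the plane of the first and last coordinate axes) that
makes the angle `ψ` with the `xₙ`-axis. -/
def meridian (n : ℕ) (ψ : ℝ) : EuclideanSpace ℝ (Fin n) :=
  Real.cos ψ • axis n + Real.sin ψ • unitVec n 0

/-- `f(t) = ρ_L(arccos t)`, the radial function of `L` (as a function of the angle from the axis)
in the variable `t = cos ψ ∈ [0,1]`. -/
def axialProfile {n : ℕ} (L : Set (EuclideanSpace ℝ (Fin n))) (t : ℝ) : ℝ :=
  radial L (meridian n (Real.arccos t))

/-- The function `(1 / 2π) f(t)^{n-2} (f(t) + t f'(t))`, `0 ≤ t ≤ 1`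
(one-sided derivatives at the endpoints). -/
def inverseProfile (n : ℕ) (f : ℝ → ℝ) (t : ℝ) : ℝ :=
  1 / (2 * Real.pi) * f t ^ (n - 2) * (f t + t * derivWithin f (Icc 0 1) t)

end StarBodies

end

/-!
Everything is reduced to zonal functions, that is, functions of the height over the equator.

In polar coordinates the volume of the central section of a star body by `ξ^⊥` is
`(n - 1)⁻¹ R(ρ_Lⁿ⁻¹)(ξ)` (`IsStarBody.sectionVolume_eq`). The Radon transform commutes with linear
isometries and is injective on even continuous functions (`radonTransform_injective`), so `L`
inherits from `K_n` the invariance under isometries fixing the axis: `L` is itself a body of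
revolution with profile `f` (`IsIntersectionBodyOf.radial_eq_axialProfile`), and `ρ` is, as a
function of the angle, the zonal Radon transform of `fⁿ⁻¹ / (n - 1)` in dimension `n`. Injectivity
is proved without spherical harmonics: the transform is self-adjoint
(`integral_mul_radonTransform_comm`, by averaging over thin slabs), it maps the even zonal
polynomials with a given pole onto themselves (`exists_radonTransform_eq_polynomial`), and hence a
function in its kernel is orthogonal to functions that peak at any prescribed point.

The link between the dimensions `n` and `n + 2` is one integration by parts
(`zonalRadon_add_two`): with `r` the sine of the angle from the axis,
`R_{n+2} [((n - 1) G + t G') / 2π] (r) = R_n [G] (r)`. For `G = fⁿ⁻¹ / (n - 1)` the left-hand side is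
the transform of `fⁿ⁻² (f + t f') / 2π`, which is the formula for the inverse transform.

A body of revolution with profile `f` is equator-convex exactly when `t f(t)` is nondecreasing
(`equatorConvex_of_monotoneOn`, `EquatorConvex.monotoneOn`). Under this condition `f + t f' ≥ 0`,
so the inverse transform is nonnegative and a root of a multiple of it is the radial function of a
star body whose intersection body is `K_{n+2}`.

For the converse `f` is only continuous. Suppose that `K_{n+2}` is an intersection body with measure
`μ`. An even zonal polynomial `Q ≥ 0` is the Radon transform of such a polynomial `P`, and testing
the defining identity with `P` gives `∫ ρ_{K_{n+2}} P = ∫ Q dμ ≥ 0`. Self-adjointness and a further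
integration by parts turn the left-hand side into an integral of `fⁿ⁻¹` against a weight that
involves `Q` and its derivative but no derivative of `f` (`dualWeight`). Approximation allows every
nonnegative `C¹` function instead of `Q`, and a suitable choice makes the integral
`∫ (cos θ f(cos θ))ⁿ⁻¹ η'(θ) dθ` for an arbitrary nonnegative `C¹` bump `η` supported inside
`(0, π / 2)`. If `t f(t)` failed to be nondecreasing, some `η` would make this negative.
-/

noncomputable section

namespace StarBodies

open Filter Topology

/-! ### Polar coordinates -/

section Polar

variable {E : Type*} [NormedAddCommGroup E] [InnerProductSpace ℝ E]

open Classical in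
/-- The extension of a function on the unit sphere to the whole space which is homogeneous of
degree `0` (with value `0` at the origin). -/
def homExt (g : sphere (0 : E) 1 → ℝ) (x : E) : ℝ :=
  if h : x ≠ 0 then g ⟨‖x‖⁻¹ • x, by
    rw [mem_sphere_zero_iff_norm, norm_smul, norm_inv, norm_norm, inv_mul_cancel₀
      (norm_ne_zero_iff.2 h)]⟩ else 0

lemma homExt_smul (g : sphere (0 : E) 1 → ℝ) (u : sphere (0 : E) 1) {r : ℝ} (hr : 0 < r) :
    homExt g (r • (u : E)) = g u := by
  have hu : ‖(u : E)‖ = 1 := mem_sphere_zero_iff_norm.1 u.2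
  have h0 : r • (u : E) ≠ 0 := smul_ne_zero hr.ne' (by rw [← norm_ne_zero_iff, hu]; norm_num)
  rw [homExt, dif_pos h0]
  congr 1
  apply Subtype.ext
  simp [norm_smul, hu, abs_of_pos hr, smul_smul, hr.ne']

variable [FiniteDimensional ℝ E] [MeasurableSpace E] [BorelSpace E]

lemma integral_eq_integral_sphere_prod [Nontrivial E] (G : E → ℝ) :
    ∫ x, G x = ∫ p : sphere (0 : E) 1 × Ioi (0 : ℝ), G ((p.2 : ℝ) • (p.1 : E))
      ∂(volume : Measure E).toSphere.prod (.volumeIoiPow (Module.finrank ℝ E - 1)) := by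
  calc ∫ x, G x = ∫ x : ({(0)}ᶜ : Set E), G x ∂((volume : Measure E).comap (↑)) := by
        rw [integral_subtype_comap (measurableSet_singleton _).compl G, restrict_compl_singleton]
    _ = _ := by
      rw [← (volume : Measure E).measurePreserving_homeomorphUnitSphereProd.integral_comp
        (Homeomorph.measurableEmbedding _)]
      congr 1 with x
      congr 1
      have hx : (x : E) ≠ 0 := x.2
      simp [smul_smul, hx]

lemma integral_volumeIoiPow (n : ℕ) (f : ℝ → ℝ) :
    ∫ x : Ioi (0 : ℝ), f x ∂.volumeIoiPow n = ∫ y in Ioi (0 : ℝ), y ^ n * f y := by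
  simp only [Measure.volumeIoiPow, ENNReal.ofReal]
  rw [integral_withDensity_eq_integral_smul,
    integral_subtype_comap measurableSet_Ioi fun a ↦ Real.toNNReal (a ^ n) • f a,
    setIntegral_congr_fun measurableSet_Ioi fun x hx ↦ ?_]
  · rw [NNReal.smul_def, Real.coe_toNNReal _ (pow_nonneg hx.out.le _), smul_eq_mul]
  · exact (measurable_subtype_coe.pow_const _).real_toNNReal

/-- Separation of variables: this identifies an integral over the sphere, up to a positive radial
factor, with an integral over the whole space. -/
lemma integral_homExt_mul [Nontrivial E] (g : sphere (0 : E) 1 → ℝ) (w : ℝ → ℝ) :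
    ∫ x, homExt g x * w ‖x‖ = (∫ u, g u ∂(volume : Measure E).toSphere) *
      ∫ r in Ioi (0 : ℝ), r ^ (Module.finrank ℝ E - 1) * w r := by
  rw [integral_eq_integral_sphere_prod, ← integral_volumeIoiPow, ← integral_prod_mul]
  congr 1 with p
  have hu : ‖(p.1 : E)‖ = 1 := mem_sphere_zero_iff_norm.1 p.1.2
  rw [homExt_smul g p.1 p.2.2, norm_smul, hu, mul_one, Real.norm_eq_abs, abs_of_pos p.2.2]

/-- The volume of a set given by a radial function is the integral of the `d`-th power of the
radial function over the sphere, divided by the dimension `d`. -/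
lemma measureReal_radial_set [Nontrivial E] {A : Set E} (hA : MeasurableSet A)
    (r : sphere (0 : E) 1 → ℝ) (hr : Continuous r) (hr0 : ∀ u, 0 ≤ r u)
    (h : ∀ (u : sphere (0 : E) 1) (a : ℝ), 0 < a → (a • (u : E) ∈ A ↔ a ≤ r u)) :
    (volume : Measure E).real A = (Module.finrank ℝ E : ℝ)⁻¹ *
      ∫ u, r u ^ Module.finrank ℝ E ∂(volume : Measure E).toSphere := by
  set d := Module.finrank ℝ E with hd
  have hdpos : 0 < d := Module.finrank_pos
  have hinner : ∀ u : sphere (0 : E) 1,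
      (Measure.volumeIoiPow (d - 1)) {a : Ioi (0 : ℝ) | (a : ℝ) • (u : E) ∈ A} =
        ENNReal.ofReal (r u ^ d / d) := by
    intro u
    have hset : {a : Ioi (0 : ℝ) | (a : ℝ) • (u : E) ∈ A} = {a : Ioi (0 : ℝ) | (a : ℝ) ≤ r u} := by
      ext a; exact h u a a.2
    have himg : Subtype.val '' {a : Ioi (0 : ℝ) | (a : ℝ) ≤ r u} = Ioc 0 (r u) := by
      ext x; simp [and_comm]
    rw [hset, Measure.volumeIoiPow, withDensity_apply _ (measurableSet_le (by fun_prop) (by fun_prop)),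
      setLIntegral_subtype measurableSet_Ioi _ fun a : ℝ ↦ .ofReal (a ^ (d - 1)), himg,
      ← ofReal_integral_eq_lintegral_ofReal (intervalIntegral.intervalIntegrable_pow _).1,
      ← intervalIntegral.integral_of_le (hr0 u)]
    · have : d - 1 + 1 = d := by omega
      rw [integral_pow, this]
      congr 1
      have h2 : ((d - 1 : ℕ) : ℝ) + 1 = d := by exact_mod_cast this
      rw [h2, zero_pow hdpos.ne', sub_zero]
    · filter_upwards [ae_restrict_mem measurableSet_Ioc] with y hy
      exact pow_nonneg hy.1.le _
  have hmeas : Measurable (fun p : sphere (0 : E) 1 × Ioi (0 : ℝ) => (p.2 : ℝ) • (p.1 : E)) := by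
    fun_prop
  have hvol : (volume : Measure E) A = ∫⁻ u, ENNReal.ofReal (r u ^ d / d)
      ∂(volume : Measure E).toSphere := by
    have h1 : (volume : Measure E) A = ((volume : Measure E).comap ((↑) : ({0}ᶜ : Set E) → E))
        ((↑) ⁻¹' A) := by
      rw [comap_subtype_coe_apply (measurableSet_singleton _).compl, Subtype.image_preimage_coe]
      rw [inter_comm, ← sdiff_eq, measure_sdiff_null (measure_singleton _)]
    have h2 : ((↑) ⁻¹' A : Set ({0}ᶜ : Set E)) = homeomorphUnitSphereProd E ⁻¹'
        ((fun p : sphere (0 : E) 1 × Ioi (0 : ℝ) => (p.2 : ℝ) • (p.1 : E)) ⁻¹' A) := by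
      ext x
      have hx : (x : E) ≠ 0 := x.2
      simp [smul_smul, hx]
    rw [h1, h2, (volume : Measure E).measurePreserving_homeomorphUnitSphereProd.measure_preimage
      (hmeas hA).nullMeasurableSet, Measure.prod_apply (hmeas hA)]
    exact lintegral_congr fun u => hinner u
  rw [Measure.real, hvol, ← ofReal_integral_eq_lintegral_ofReal, ENNReal.toReal_ofReal,
    ← integral_const_mul]
  · congr 1 with u; rw [div_eq_inv_mul]
  · exact integral_nonneg fun u => div_nonneg (pow_nonneg (hr0 u) _) (Nat.cast_nonneg _)
  · exact ((hr.pow _).div_const _).integrable_of_hasCompactSupport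
      (HasCompactSupport.of_compactSpace _)
  · exact .of_forall fun u => div_nonneg (pow_nonneg (hr0 u) _) (Nat.cast_nonneg _)

/-! ### Slicing by hyperplanes -/

/-- Coordinates along a unit vector `e` and its orthogonal complement. -/
def sliceEquiv (e : E) (he : ‖e‖ = 1) : E ≃ᵐ ℝ × (ℝ ∙ e)ᗮ :=
  ((ℝ ∙ e).orthogonalDecomposition.toHomeomorph.toMeasurableEquiv.trans
    (MeasurableEquiv.toLp 2 _).symm).trans
    ((LinearIsometryEquiv.toSpanUnitSingleton e he).symm.toMeasurableEquiv.prodCongr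
      (MeasurableEquiv.refl _))

lemma sliceEquiv_symm_apply (e : E) (he : ‖e‖ = 1) (p : ℝ × (ℝ ∙ e)ᗮ) :
    (sliceEquiv e he).symm p = p.1 • e + p.2 := by
  change (ℝ ∙ e).orthogonalDecomposition.symm (WithLp.toLp 2
    (LinearIsometryEquiv.toSpanUnitSingleton e he p.1, p.2)) = _
  simp

lemma measurePreserving_sliceEquiv (e : E) (he : ‖e‖ = 1) :
    MeasurePreserving (sliceEquiv e he) := by
  refine ((ℝ ∙ e).orthogonalDecomposition.measurePreserving.trans
    (WithLp.volume_preserving_ofLp _ _)).trans ?_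
  exact (LinearIsometryEquiv.measurePreserving
    (LinearIsometryEquiv.toSpanUnitSingleton e he).symm).prod (MeasurePreserving.id volume)

lemma integral_slice (e : E) (he : ‖e‖ = 1) (G : E → ℝ) :
    ∫ x, G x = ∫ p : ℝ × (ℝ ∙ e)ᗮ, G (p.1 • e + p.2) := by
  rw [← (measurePreserving_sliceEquiv e he).symm.integral_comp' (G)]
  simp_rw [sliceEquiv_symm_apply]

lemma integrable_slice (e : E) (he : ‖e‖ = 1) (G : E → ℝ) :
    Integrable (fun p : ℝ × (ℝ ∙ e)ᗮ => G (p.1 • e + p.2)) ↔ Integrable G := by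
  rw [← (measurePreserving_sliceEquiv e he).symm.integrable_comp_emb
    (MeasurableEquiv.measurableEmbedding _)]
  simp_rw [Function.comp_def, sliceEquiv_symm_apply]

end Polar

/-! ### Zonal integrals -/

/-- The surface area of the unit sphere of `ℝᵏ`. -/
def sphereArea (k : ℕ) : ℝ := k * (√Real.pi ^ k / Real.Gamma (k / 2 + 1))

lemma sphereArea_pos {k : ℕ} (hk : 0 < k) : 0 < sphereArea k := by
  have : 0 < Real.Gamma ((k : ℝ) / 2 + 1) := Real.Gamma_pos_of_pos (by positivity)
  have := Real.pi_pos
  unfold sphereArea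
  positivity

lemma sphereArea_add_two {k : ℕ} (hk : 0 < k) :
    k * sphereArea (k + 2) = 2 * Real.pi * sphereArea k := by
  have hk' : (0 : ℝ) < k := by exact_mod_cast hk
  have h1 : ((k + 2 : ℕ) : ℝ) / 2 + 1 = ((k : ℝ) / 2 + 1) + 1 := by push_cast; ring
  have h2 : 0 < Real.Gamma ((k : ℝ) / 2 + 1) := Real.Gamma_pos_of_pos (by positivity)
  unfold sphereArea
  rw [h1, Real.Gamma_add_one (by positivity), pow_add, Real.sq_sqrt Real.pi_pos.le]
  push_cast
  field_simp

section

variable {E : Type*} [NormedAddCommGroup E] [InnerProductSpace ℝ E] [FiniteDimensional ℝ E]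
  [MeasurableSpace E] [BorelSpace E]

lemma finrank_mul_volume_ball [Nontrivial E] :
    (Module.finrank ℝ E : ℝ) * (volume : Measure E).real (ball 0 1) =
      sphereArea (Module.finrank ℝ E) := by
  have : 0 < Real.Gamma ((Module.finrank ℝ E : ℝ) / 2 + 1) :=
    Real.Gamma_pos_of_pos (by positivity)
  rw [sphereArea, Measure.real, InnerProductSpace.volume_ball, ENNReal.ofReal_one, one_pow, one_mul,
    ENNReal.toReal_ofReal (by positivity)]

lemma integral_norm_eq [Nontrivial E] (f : ℝ → ℝ) :
    ∫ x : E, f ‖x‖ = sphereArea (Module.finrank ℝ E) *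
      ∫ y in Ioi (0 : ℝ), y ^ (Module.finrank ℝ E - 1) * f y := by
  rw [integral_fun_norm_addHaar volume f, ← finrank_mul_volume_ball]
  simp [mul_assoc]

end

lemma integrableOn_pow_mul_gaussian (k : ℕ) :
    IntegrableOn (fun r : ℝ => r ^ k * Real.exp (-r ^ 2)) (Ioi 0) := by
  have := integrableOn_rpow_mul_exp_neg_mul_sq (b := 1) one_pos (s := k)
    (lt_of_lt_of_le (by norm_num) (Nat.cast_nonneg k))
  simpa using this

lemma integral_pow_mul_gaussian_pos (k : ℕ) :
    0 < ∫ r in Ioi (0 : ℝ), r ^ k * Real.exp (-r ^ 2) := by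
  rw [setIntegral_pos_iff_support_of_nonneg_ae _ (integrableOn_pow_mul_gaussian k)]
  · have : Ioi (0 : ℝ) ⊆ Function.support (fun r : ℝ => r ^ k * Real.exp (-r ^ 2)) ∩ Ioi 0 :=
      fun x hx => ⟨(mul_pos (pow_pos hx k) (Real.exp_pos _)).ne', hx⟩
    refine lt_of_lt_of_le ?_ (measure_mono this)
    simp
  · filter_upwards [ae_restrict_mem measurableSet_Ioi] with x hx
    exact mul_nonneg (pow_nonneg (le_of_lt hx) k) (Real.exp_pos _).le

/-- Polar coordinates in the upper half plane, with a Gaussian weight. -/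
lemma integral_halfPlane_gaussian (k : ℕ) {Φ : ℝ → ℝ} (hΦ : Continuous Φ) :
    ∫ s : ℝ, ∫ y in Ioi (0 : ℝ), y ^ k *
        (Φ (s / √(s ^ 2 + y ^ 2)) * Real.exp (-(s ^ 2 + y ^ 2))) =
      (∫ r in Ioi (0 : ℝ), r ^ (k + 1) * Real.exp (-r ^ 2)) *
        ∫ θ in (0 : ℝ)..Real.pi, Φ (Real.cos θ) * Real.sin θ ^ k := by
  set f : ℝ × ℝ → ℝ := fun p => (Ioi (0 : ℝ)).indicator
    (fun y => y ^ k * (Φ (p.1 / √(p.1 ^ 2 + y ^ 2)) * Real.exp (-(p.1 ^ 2 + y ^ 2)))) p.2 with hf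
  -- the argument of `Φ` is a cosine, so `Φ` may be assumed bounded
  obtain ⟨C, hC⟩ := (isCompact_Icc (a := (-1 : ℝ)) (b := 1)).exists_bound_of_continuousOn
    hΦ.continuousOn
  have hcos : ∀ s y : ℝ, s / √(s ^ 2 + y ^ 2) ∈ Icc (-1 : ℝ) 1 := by
    intro s y
    rw [mem_Icc, ← abs_le, abs_div, abs_of_nonneg (Real.sqrt_nonneg _)]
    refine div_le_one_of_le₀ (Real.abs_le_sqrt ?_) (Real.sqrt_nonneg _)
    nlinarith [sq_nonneg y]
  have hfm : Measurable f := by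
    have : f = (Prod.snd ⁻¹' Ioi (0 : ℝ)).indicator (fun p : ℝ × ℝ => p.2 ^ k *
      (Φ (p.1 / √(p.1 ^ 2 + p.2 ^ 2)) * Real.exp (-(p.1 ^ 2 + p.2 ^ 2)))) := by
      ext p; simp [f, indicator]
    rw [this]
    refine Measurable.indicator ?_ (measurable_snd measurableSet_Ioi)
    have := hΦ.measurable
    fun_prop
  have hfint : Integrable f (volume.prod volume) := by
    have hg : Integrable (fun p : ℝ × ℝ => (C * Real.exp (-1 * p.1 ^ 2)) *
        (Ioi (0 : ℝ)).indicator (fun y => y ^ k * Real.exp (-y ^ 2)) p.2)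
        (volume.prod volume) :=
      ((integrable_exp_neg_mul_sq one_pos).const_mul C).mul_prod
        ((integrable_indicator_iff measurableSet_Ioi).2 (integrableOn_pow_mul_gaussian k))
    refine hg.mono' hfm.aestronglyMeasurable (.of_forall fun p => ?_)
    simp only [f, indicator]
    split_ifs with hp
    · have hp' : 0 < p.2 := hp
      have h1 := hC _ (hcos p.1 p.2)
      rw [norm_mul, norm_mul, Real.norm_of_nonneg (Real.exp_pos _).le,
        Real.norm_of_nonneg (pow_nonneg hp'.le k)]
      have h2 : Real.exp (-(p.1 ^ 2 + p.2 ^ 2)) = Real.exp (-1 * p.1 ^ 2) * Real.exp (-p.2 ^ 2) := by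
        rw [← Real.exp_add]; congr 1; ring
      rw [h2]
      calc p.2 ^ k * (‖Φ (p.1 / √(p.1 ^ 2 + p.2 ^ 2))‖ *
            (Real.exp (-1 * p.1 ^ 2) * Real.exp (-p.2 ^ 2)))
          ≤ p.2 ^ k * (C * (Real.exp (-1 * p.1 ^ 2) * Real.exp (-p.2 ^ 2))) := by gcongr
        _ = _ := by ring
    · simp
  have h1 : ∫ s : ℝ, ∫ y in Ioi (0 : ℝ), y ^ k *
      (Φ (s / √(s ^ 2 + y ^ 2)) * Real.exp (-(s ^ 2 + y ^ 2))) = ∫ p, f p := by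
    rw [Measure.volume_eq_prod, integral_prod _ hfint]
    congr 1 with s
    rw [← integral_indicator measurableSet_Ioi]
  rw [h1, ← integral_comp_polarCoord_symm]
  have h2 : ∀ p ∈ polarCoord.target, p.1 • f (polarCoord.symm p) =
      (p.1 ^ (k + 1) * Real.exp (-p.1 ^ 2)) *
        (Ioo 0 Real.pi).indicator (fun θ => Φ (Real.cos θ) * Real.sin θ ^ k) p.2 := by
    rintro ⟨r, θ⟩ ⟨hr, hθ⟩
    have hr : 0 < r := hr
    have hθ1 : -Real.pi < θ := hθ.1
    have hθ2 : θ < Real.pi := hθ.2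
    have hnorm : (r * Real.cos θ) ^ 2 + (r * Real.sin θ) ^ 2 = r ^ 2 := by
      have := Real.sin_sq_add_cos_sq θ
      linear_combination r ^ 2 * this
    simp only [polarCoord_symm_apply, f]
    by_cases h : 0 < θ
    · have hs : 0 < Real.sin θ := Real.sin_pos_of_pos_of_lt_pi h hθ2
      rw [indicator_of_mem (show r * Real.sin θ ∈ Ioi (0 : ℝ) from mul_pos hr hs),
        indicator_of_mem (show θ ∈ Ioo 0 Real.pi from ⟨h, hθ2⟩), hnorm, Real.sqrt_sq hr.le,
        mul_div_cancel_left₀ _ hr.ne', mul_pow, smul_eq_mul]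
      ring
    · have hs : Real.sin θ ≤ 0 := Real.sin_nonpos_of_nonpos_of_neg_pi_le (not_lt.1 h) hθ1.le
      rw [indicator_of_notMem (show r * Real.sin θ ∉ Ioi (0 : ℝ) from
          not_lt.2 (mul_nonpos_of_nonneg_of_nonpos hr.le hs)),
        indicator_of_notMem (show θ ∉ Ioo 0 Real.pi from fun h' => h h'.1)]
      simp
  rw [setIntegral_congr_fun polarCoord.open_target.measurableSet h2, polarCoord_target,
    Measure.volume_eq_prod, ← Measure.prod_restrict,
    integral_prod_mul (fun r : ℝ => r ^ (k + 1) * Real.exp (-r ^ 2))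
      ((Ioo 0 Real.pi).indicator (fun θ => Φ (Real.cos θ) * Real.sin θ ^ k))]
  congr 1
  rw [setIntegral_indicator measurableSet_Ioo,
    intervalIntegral.integral_of_le Real.pi_pos.le, integral_Ioc_eq_integral_Ioo]
  congr 2
  ext θ
  simp only [mem_inter_iff, mem_Ioo]
  constructor
  · exact fun h => h.2
  · exact fun h => ⟨⟨by linarith [h.1, Real.pi_pos], h.2⟩, h⟩

section

variable {E : Type*} [NormedAddCommGroup E] [InnerProductSpace ℝ E]

lemma finrank_orthogonal_unit [FiniteDimensional ℝ E] {e : E} (he : ‖e‖ = 1) :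
    Module.finrank ℝ (ℝ ∙ e)ᗮ = Module.finrank ℝ E - 1 := by
  have h0 : e ≠ 0 := by rw [← norm_ne_zero_iff, he]; norm_num
  have h1 := (ℝ ∙ e).finrank_add_finrank_orthogonal
  rw [finrank_span_singleton h0] at h1
  omega

lemma norm_slice {e : E} (he : ‖e‖ = 1) (s : ℝ) (y : (ℝ ∙ e)ᗮ) :
    ‖s • e + (y : E)‖ = √(s ^ 2 + ‖y‖ ^ 2) := by
  have h : ⟪s • e, (y : E)⟫ = 0 := by
    rw [inner_smul_left, Submodule.mem_orthogonal_singleton_iff_inner_right.1 y.2, mul_zero]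
  rw [eq_comm, Real.sqrt_eq_iff_mul_self_eq (by positivity) (norm_nonneg _),
    norm_add_sq_eq_norm_sq_add_norm_sq_of_inner_eq_zero _ _ h, norm_smul, he]
  simp
  ring

lemma inner_slice {e : E} (he : ‖e‖ = 1) (s : ℝ) (y : (ℝ ∙ e)ᗮ) :
    ⟪e, s • e + (y : E)⟫ = s := by
  rw [inner_add_right, inner_smul_right, Submodule.mem_orthogonal_singleton_iff_inner_right.1 y.2,
    real_inner_self_eq_norm_sq, he]
  simp

end

section

variable {E : Type*} [NormedAddCommGroup E] [InnerProductSpace ℝ E] [FiniteDimensional ℝ E]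
  [MeasurableSpace E] [BorelSpace E]

/-- The integral over the sphere of a function of one coordinate. Both sides, multiplied by the
same Gaussian moment, compute `∫ Φ(⟪e, x⟫ / |x|) e^{-|x|²} dx`: the left one in polar coordinates of
the whole space, the right one in polar coordinates of the hyperplanes orthogonal to `e`. -/
theorem integral_sphere_zonal (hd : 2 ≤ Module.finrank ℝ E) {e : E} (he : ‖e‖ = 1) {Φ : ℝ → ℝ}
    (hΦ : Continuous Φ) :
    ∫ u, Φ ⟪e, (u : E)⟫ ∂(volume : Measure E).toSphere =
      sphereArea (Module.finrank ℝ E - 1) *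
        ∫ θ in (0 : ℝ)..Real.pi, Φ (Real.cos θ) * Real.sin θ ^ (Module.finrank ℝ E - 2) := by
  obtain ⟨k, hk⟩ : ∃ k, Module.finrank ℝ E = k + 2 := ⟨_, (Nat.sub_add_cancel hd).symm⟩
  have : Nontrivial E := Module.nontrivial_of_finrank_pos (R := ℝ) (by omega)
  have hperp : Module.finrank ℝ (ℝ ∙ e)ᗮ = k + 1 := by rw [finrank_orthogonal_unit he, hk]; rfl
  have : Nontrivial (ℝ ∙ e)ᗮ := Module.nontrivial_of_finrank_pos (R := ℝ) (by omega)
  obtain ⟨C, hC⟩ := (isCompact_Icc (a := (-1 : ℝ)) (b := 1)).exists_bound_of_continuousOn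
    hΦ.continuousOn
  set G : E → ℝ := fun x => Φ (⟪e, x⟫ / ‖x‖) * Real.exp (-‖x‖ ^ 2) with hG
  have hexp : Integrable (fun x : E => Real.exp (-‖x‖ ^ 2)) := by
    rw [integrable_fun_norm_addHaar volume (f := fun r : ℝ => Real.exp (-r ^ 2))]
    exact integrableOn_pow_mul_gaussian _
  have hGint : Integrable G := by
    refine (hexp.const_mul C).mono' ?_ (.of_forall fun x => ?_)
    · have := hΦ.measurable
      have h2 : Measurable G := by fun_prop
      exact h2.aestronglyMeasurable
    · rw [norm_mul, Real.norm_of_nonneg (Real.exp_pos _).le]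
      gcongr
      refine hC _ ?_
      rw [mem_Icc, ← abs_le, abs_div, abs_norm]
      refine div_le_one_of_le₀ ?_ (norm_nonneg _)
      simpa [he] using abs_real_inner_le_norm e x
  have h1 : ∫ x, G x = (∫ u, Φ ⟪e, (u : E)⟫ ∂(volume : Measure E).toSphere) *
      ∫ r in Ioi (0 : ℝ), r ^ (k + 1) * Real.exp (-r ^ 2) := by
    rw [integral_eq_integral_sphere_prod, ← integral_volumeIoiPow, ← integral_prod_mul, hk]
    congr 1 with p
    have hu : ‖(p.1 : E)‖ = 1 := mem_sphere_zero_iff_norm.1 p.1.2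
    have hp : (0 : ℝ) < p.2 := p.2.2
    simp only [hG, norm_smul, hu, Real.norm_of_nonneg hp.le, inner_smul_right, mul_one]
    rw [mul_div_cancel_left₀ _ hp.ne']
  have h2 : ∫ x, G x = sphereArea (k + 1) * ((∫ r in Ioi (0 : ℝ), r ^ (k + 1) * Real.exp (-r ^ 2)) *
      ∫ θ in (0 : ℝ)..Real.pi, Φ (Real.cos θ) * Real.sin θ ^ k) := by
    rw [← integral_halfPlane_gaussian k hΦ, integral_slice e he, Measure.volume_eq_prod,
      integral_prod _ ((integrable_slice e he G).2 hGint), ← integral_const_mul]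
    congr 1 with s
    have := integral_norm_eq (E := (ℝ ∙ e)ᗮ)
      (fun y => Φ (s / √(s ^ 2 + y ^ 2)) * Real.exp (-(s ^ 2 + y ^ 2)))
    rw [hperp] at this
    rw [Nat.add_sub_cancel] at this
    rw [← this]
    congr 1 with y
    simp only [hG, inner_slice he, norm_slice he]
    rw [Real.sq_sqrt (by positivity)]
  have hpos := integral_pow_mul_gaussian_pos (k + 1)
  rw [hk]
  change _ = sphereArea (k + 1) * ∫ θ in (0 : ℝ)..Real.pi, Φ (Real.cos θ) * Real.sin θ ^ k
  refine mul_right_cancel₀ hpos.ne' ?_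
  rw [← h1, h2]
  ring

end

/-! ### Self-adjointness of the spherical Radon transform -/

section

variable {E : Type*} [NormedAddCommGroup E] [InnerProductSpace ℝ E]

/-- The function `|x| e^{-|x|²} g(x / |x|)`, a continuous and rapidly decreasing extension of a
function on the sphere. -/
def gaussExt (g : sphere (0 : E) 1 → ℝ) (x : E) : ℝ :=
  homExt g x * (‖x‖ * Real.exp (-‖x‖ ^ 2))

lemma abs_homExt_le {g : sphere (0 : E) 1 → ℝ} {C : ℝ} (hC : 0 ≤ C) (hg : ∀ u, |g u| ≤ C) (x : E) :
    |homExt g x| ≤ C := by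
  unfold homExt
  split_ifs
  · exact hg _
  · simpa using hC

lemma mul_exp_neg_sq_le (r : ℝ) : r * Real.exp (-r ^ 2) ≤ Real.exp (-(1 / 2) * r ^ 2) := by
  have h1 : r ≤ Real.exp (r ^ 2 / 2) := by
    have := Real.add_one_le_exp (r ^ 2 / 2)
    nlinarith [sq_nonneg (r - 1)]
  calc r * Real.exp (-r ^ 2) ≤ Real.exp (r ^ 2 / 2) * Real.exp (-r ^ 2) := by gcongr
    _ = _ := by rw [← Real.exp_add]; congr 1; ring

lemma abs_gaussExt_le {g : sphere (0 : E) 1 → ℝ} {C : ℝ} (hC : 0 ≤ C) (hg : ∀ u, |g u| ≤ C) (x : E) :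
    |gaussExt g x| ≤ C * Real.exp (-(1 / 2) * ‖x‖ ^ 2) := by
  unfold gaussExt
  rw [abs_mul, abs_of_nonneg (by positivity : 0 ≤ ‖x‖ * Real.exp (-‖x‖ ^ 2))]
  exact mul_le_mul (abs_homExt_le hC hg x) (mul_exp_neg_sq_le _) (by positivity) hC

lemma continuousOn_homExt {g : sphere (0 : E) 1 → ℝ} (hg : Continuous g) :
    ContinuousOn (homExt g) {0}ᶜ := by
  rw [continuousOn_iff_continuous_domRestrict]
  have : ({0}ᶜ : Set E).domRestrict (homExt g) = fun x : ({0}ᶜ : Set E) =>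
      g (homeomorphUnitSphereProd E x).1 := by
    ext x
    have hx : (x : E) ≠ 0 := x.2
    rw [domRestrict_apply, homExt, dif_pos hx]
    exact congrArg g (Subtype.ext (by simp))
  rw [this]
  fun_prop

lemma exists_abs_le_of_continuous [FiniteDimensional ℝ E] {g : sphere (0 : E) 1 → ℝ}
    (hg : Continuous g) : ∃ C, 0 ≤ C ∧ ∀ u, |g u| ≤ C := by
  obtain ⟨C, hC⟩ := isCompact_univ.exists_bound_of_continuousOn hg.continuousOn
  exact ⟨max C 0, le_max_right _ _, fun u => (hC u (mem_univ _)).trans (le_max_left _ _)⟩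

lemma continuous_gaussExt [FiniteDimensional ℝ E] {g : sphere (0 : E) 1 → ℝ} (hg : Continuous g) :
    Continuous (gaussExt g) := by
  obtain ⟨C, hC0, hC⟩ := exists_abs_le_of_continuous hg
  rw [continuous_iff_continuousAt]
  intro x
  by_cases hx : x = 0
  · subst hx
    have h0 : gaussExt g 0 = 0 := by simp [gaussExt]
    rw [ContinuousAt, h0]
    refine squeeze_zero_norm (a := fun x : E => C * (‖x‖ * Real.exp (-‖x‖ ^ 2))) (fun x => ?_) ?_
    · rw [gaussExt, norm_mul, Real.norm_eq_abs, Real.norm_of_nonneg (by positivity)]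
      gcongr
      exact abs_homExt_le hC0 hC x
    · have : Continuous (fun x : E => C * (‖x‖ * Real.exp (-‖x‖ ^ 2))) := by fun_prop
      simpa using this.tendsto 0
  · have h1 : ContinuousAt (homExt g) x :=
      (continuousOn_homExt hg).continuousAt (isOpen_compl_singleton.mem_nhds hx)
    exact h1.mul (by fun_prop)

lemma integrable_exp_neg_half_norm_sq [FiniteDimensional ℝ E] [MeasurableSpace E] [BorelSpace E]
    [Nontrivial E] : Integrable (fun x : E => Real.exp (-(1 / 2) * ‖x‖ ^ 2)) := by
  rw [integrable_fun_norm_addHaar volume (f := fun r : ℝ => Real.exp (-(1 / 2) * r ^ 2))]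
  have := integrableOn_rpow_mul_exp_neg_mul_sq (b := 1 / 2) (by norm_num)
    (s := (Module.finrank ℝ E - 1 : ℕ)) (lt_of_lt_of_le (by norm_num) (Nat.cast_nonneg _))
  simpa using this

lemma integrable_gaussExt [FiniteDimensional ℝ E] [MeasurableSpace E] [BorelSpace E]
    [Nontrivial E] {g : sphere (0 : E) 1 → ℝ} (hg : Continuous g) : Integrable (gaussExt g) := by
  obtain ⟨C, hC0, hC⟩ := exists_abs_le_of_continuous hg
  exact (integrable_exp_neg_half_norm_sq.const_mul C).mono'
    (continuous_gaussExt hg).aestronglyMeasurable (.of_forall (abs_gaussExt_le hC0 hC))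

end

section

variable {N : ℕ}

lemma sphere_norm (u : sphere (0 : EuclideanSpace ℝ (Fin N)) 1) :
    ‖(u : EuclideanSpace ℝ (Fin N))‖ = 1 := mem_sphere_zero_iff_norm.1 u.2

lemma exists_eq_norm_smul {x : EuclideanSpace ℝ (Fin N)} (hx : x ≠ 0) :
    ∃ u : sphere (0 : EuclideanSpace ℝ (Fin N)) 1, x = ‖x‖ • (u : EuclideanSpace ℝ (Fin N)) := by
  have hx' : ‖x‖ ≠ 0 := norm_ne_zero_iff.2 hx
  refine ⟨⟨‖x‖⁻¹ • x, ?_⟩, ?_⟩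
  · rw [mem_sphere_zero_iff_norm, norm_smul, norm_inv, norm_norm, inv_mul_cancel₀ hx']
  · rw [smul_smul, mul_inv_cancel₀ hx', one_smul]

lemma finrank_orthogonal_sphere (u : sphere (0 : EuclideanSpace ℝ (Fin N)) 1) :
    Module.finrank ℝ (ℝ ∙ (u : EuclideanSpace ℝ (Fin N)))ᗮ = N - 1 := by
  rw [finrank_orthogonal_unit (sphere_norm u), finrank_euclideanSpace_fin]

lemma nontrivial_orthogonal_sphere (hN : 2 ≤ N) (u : sphere (0 : EuclideanSpace ℝ (Fin N)) 1) :
    Nontrivial (ℝ ∙ (u : EuclideanSpace ℝ (Fin N)))ᗮ :=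
  Module.nontrivial_of_finrank_pos (R := ℝ) (by rw [finrank_orthogonal_sphere]; omega)

lemma nontrivial_euclideanSpace (hN : 2 ≤ N) : Nontrivial (EuclideanSpace ℝ (Fin N)) :=
  Module.nontrivial_of_finrank_pos (R := ℝ) (by rw [finrank_euclideanSpace_fin]; omega)

lemma integral_gaussExt_orthogonal (hN : 2 ≤ N) (g : sphere (0 : EuclideanSpace ℝ (Fin N)) 1 → ℝ)
    (u : sphere (0 : EuclideanSpace ℝ (Fin N)) 1) :
    ∫ y : (ℝ ∙ (u : EuclideanSpace ℝ (Fin N)))ᗮ, gaussExt g y =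
      radonTransform g u * ∫ r in Ioi (0 : ℝ), r ^ (N - 1) * Real.exp (-r ^ 2) := by
  have := nontrivial_orthogonal_sphere hN u
  have h1 : ∀ y : (ℝ ∙ (u : EuclideanSpace ℝ (Fin N)))ᗮ, gaussExt g y =
      homExt (fun v => g (subsphereIncl u v)) y * (‖y‖ * Real.exp (-‖y‖ ^ 2)) := by
    intro y
    unfold gaussExt homExt
    by_cases hy : y = 0
    · simp [hy]
    · have hy' : (y : EuclideanSpace ℝ (Fin N)) ≠ 0 := by simpa using hy
      rw [dif_pos hy', dif_pos hy]
      rfl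
  simp_rw [h1]
  rw [integral_homExt_mul _ (fun r => r * Real.exp (-r ^ 2)), finrank_orthogonal_sphere]
  congr 1
  refine setIntegral_congr_fun measurableSet_Ioi fun r _ => ?_
  obtain ⟨k, rfl⟩ : ∃ k, N = k + 2 := ⟨_, (Nat.sub_add_cancel hN).symm⟩
  change r ^ k * (r * Real.exp (-r ^ 2)) = r ^ (k + 1) * Real.exp (-r ^ 2)
  ring

/-- Averages of `gaussExt g` over slabs around the hyperplane orthogonal to `z = r u`, computed by
slicing. The slab is smoothed to a Gaussian weight of width `1 / (l r)`. -/
lemma integral_slab (hN : 2 ≤ N) {g : sphere (0 : EuclideanSpace ℝ (Fin N)) 1 → ℝ}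
    (hg : Continuous g) (u : sphere (0 : EuclideanSpace ℝ (Fin N)) 1) {r l : ℝ} (hr : 0 < r)
    (hl : 0 < l) :
    ∫ x, gaussExt g x * (l * Real.exp (-(l * ⟪r • (u : EuclideanSpace ℝ (Fin N)), x⟫) ^ 2)) =
      r⁻¹ * ∫ t : ℝ, Real.exp (-t ^ 2) *
        ∫ y : (ℝ ∙ (u : EuclideanSpace ℝ (Fin N)))ᗮ,
          gaussExt g ((t / (l * r)) • (u : EuclideanSpace ℝ (Fin N)) + y) := by
  have := nontrivial_euclideanSpace hN
  have hu := sphere_norm u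
  have hint : Integrable (fun x => gaussExt g x *
      (l * Real.exp (-(l * ⟪r • (u : EuclideanSpace ℝ (Fin N)), x⟫) ^ 2))) := by
    refine (integrable_gaussExt hg).mul_bdd (c := l) ?_ (.of_forall fun x => ?_)
    · fun_prop
    · rw [norm_mul, Real.norm_of_nonneg hl.le, Real.norm_of_nonneg (Real.exp_pos _).le]
      refine mul_le_of_le_one_right hl.le (Real.exp_le_one_iff.2 ?_)
      simp only [Left.neg_nonpos_iff]
      positivity
  rw [integral_slice (u : EuclideanSpace ℝ (Fin N)) hu, Measure.volume_eq_prod,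
    integral_prod _ ((integrable_slice _ hu _).2 hint)]
  have hlr : 0 < l * r := mul_pos hl hr
  have h1 := Measure.integral_comp_mul_left (fun t : ℝ => Real.exp (-t ^ 2) *
        ∫ y : (ℝ ∙ (u : EuclideanSpace ℝ (Fin N)))ᗮ,
          gaussExt g ((t / (l * r)) • (u : EuclideanSpace ℝ (Fin N)) + y)) (l * r)
  rw [abs_of_pos (inv_pos.2 hlr), smul_eq_mul] at h1
  have h2 : ∀ I : ℝ, r⁻¹ * I = l * ((l * r)⁻¹ * I) := by intro I; field_simp
  rw [h2, ← h1, ← integral_const_mul]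
  congr 1 with s
  rw [mul_div_cancel_left₀ _ hlr.ne', ← mul_assoc, ← integral_const_mul]
  congr 1 with y
  rw [inner_smul_left, inner_slice hu]
  simp only [conj_trivial]
  rw [← mul_assoc l r s]
  ring

lemma abs_integral_slice_gaussExt_le (hN : 2 ≤ N)
    {g : sphere (0 : EuclideanSpace ℝ (Fin N)) 1 → ℝ} {C : ℝ} (hC0 : 0 ≤ C) (hC : ∀ u, |g u| ≤ C)
    (u : sphere (0 : EuclideanSpace ℝ (Fin N)) 1) (s : ℝ) :
    |∫ y : (ℝ ∙ (u : EuclideanSpace ℝ (Fin N)))ᗮ,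
        gaussExt g (s • (u : EuclideanSpace ℝ (Fin N)) + y)| ≤
      C * (sphereArea (N - 1) * ∫ r in Ioi (0 : ℝ), r ^ (N - 1 - 1) *
        Real.exp (-(1 / 2) * r ^ 2)) := by
  have := nontrivial_orthogonal_sphere hN u
  have h := integral_norm_eq (E := (ℝ ∙ (u : EuclideanSpace ℝ (Fin N)))ᗮ)
    (fun r => Real.exp (-(1 / 2) * r ^ 2))
  rw [finrank_orthogonal_sphere] at h
  rw [← h, ← integral_const_mul, ← Real.norm_eq_abs]
  refine norm_integral_le_of_norm_le ((integrable_exp_neg_half_norm_sq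
    (E := (ℝ ∙ (u : EuclideanSpace ℝ (Fin N)))ᗮ)).const_mul C) (.of_forall fun y => ?_)
  refine (abs_gaussExt_le hC0 hC _).trans ?_
  gcongr C * Real.exp ?_
  rw [norm_slice (sphere_norm u), Real.sq_sqrt (by positivity)]
  nlinarith [sq_nonneg s]

lemma continuous_integral_slice_gaussExt (hN : 2 ≤ N)
    {g : sphere (0 : EuclideanSpace ℝ (Fin N)) 1 → ℝ} (hg : Continuous g)
    (u : sphere (0 : EuclideanSpace ℝ (Fin N)) 1) :
    Continuous fun s : ℝ => ∫ y : (ℝ ∙ (u : EuclideanSpace ℝ (Fin N)))ᗮ,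
        gaussExt g (s • (u : EuclideanSpace ℝ (Fin N)) + y) := by
  have := nontrivial_orthogonal_sphere hN u
  obtain ⟨C, hC0, hC⟩ := exists_abs_le_of_continuous hg
  have hcont := continuous_gaussExt hg
  refine continuous_of_dominated (bound := fun y => C * Real.exp (-(1 / 2) * ‖y‖ ^ 2))
    (fun s => ?_) (fun s => .of_forall fun y => ?_)
    (integrable_exp_neg_half_norm_sq.const_mul C) (.of_forall fun y => ?_)
  · exact (hcont.comp (by fun_prop)).aestronglyMeasurable
  · refine (abs_gaussExt_le hC0 hC _).trans ?_
    gcongr C * Real.exp ?_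
    rw [norm_slice (sphere_norm u), Real.sq_sqrt (by positivity)]
    nlinarith [sq_nonneg s]
  · exact hcont.comp (by fun_prop)

lemma integrable_gaussExt_mul_gaussExt (hN : 2 ≤ N)
    {k g : sphere (0 : EuclideanSpace ℝ (Fin N)) 1 → ℝ} (hk : Continuous k) (hg : Continuous g)
    {l : ℝ} (hl : 0 < l) :
    Integrable (fun p : EuclideanSpace ℝ (Fin N) × EuclideanSpace ℝ (Fin N) =>
      (gaussExt k p.1 * gaussExt g p.2) * (l * Real.exp (-(l * ⟪p.1, p.2⟫) ^ 2)))
      (volume.prod volume) := by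
  have := nontrivial_euclideanSpace hN
  refine ((integrable_gaussExt hk).mul_prod (integrable_gaussExt hg)).mul_bdd
    (c := l) ?_ (.of_forall fun x => ?_)
  · exact Continuous.aestronglyMeasurable (by fun_prop)
  · rw [norm_mul, Real.norm_of_nonneg hl.le, Real.norm_of_nonneg (Real.exp_pos _).le]
    refine mul_le_of_le_one_right hl.le (Real.exp_le_one_iff.2 ?_)
    simp only [Left.neg_nonpos_iff]
    positivity

/-- Averages over thinner and thinner slabs, weighted by a second function, converge to an integral
of the Radon transform. -/
lemma tendsto_integral_slab (hN : 2 ≤ N) {g k : sphere (0 : EuclideanSpace ℝ (Fin N)) 1 → ℝ}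
    (hg : Continuous g) (hk : Continuous k) :
    Tendsto (fun n : ℕ => ∫ z, gaussExt k z * ∫ x, gaussExt g x *
        (((n : ℝ) + 1) * Real.exp (-(((n : ℝ) + 1) * ⟪z, x⟫) ^ 2))) atTop
      (𝓝 ((∫ t : ℝ, Real.exp (-t ^ 2)) *
        (∫ r in Ioi (0 : ℝ), r ^ (N - 1) * Real.exp (-r ^ 2)) ^ 2 *
        ∫ u, k u * radonTransform g u
          ∂(volume : Measure (EuclideanSpace ℝ (Fin N))).toSphere)) := by
  have := nontrivial_euclideanSpace hN
  obtain ⟨C, hC0, hC⟩ := exists_abs_le_of_continuous hg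
  obtain ⟨D, hD0, hD⟩ := exists_abs_le_of_continuous hk
  set c := ∫ r in Ioi (0 : ℝ), r ^ (N - 1) * Real.exp (-r ^ 2) with hc
  set A := ∫ t : ℝ, Real.exp (-t ^ 2) with hA
  set M := C * (sphereArea (N - 1) * ∫ r in Ioi (0 : ℝ), r ^ (N - 1 - 1) *
        Real.exp (-(1 / 2) * r ^ 2)) with hM
  have hgauss : Integrable (fun t : ℝ => Real.exp (-t ^ 2)) := by
    simpa using integrable_exp_neg_mul_sq (b := 1) one_pos
  have hlim : A * c ^ 2 * ∫ u, k u * radonTransform g u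
        ∂(volume : Measure (EuclideanSpace ℝ (Fin N))).toSphere =
      ∫ z : EuclideanSpace ℝ (Fin N),
        homExt (fun u => k u * radonTransform g u) z * (A * c * Real.exp (-‖z‖ ^ 2)) := by
    rw [integral_homExt_mul _ (fun r => A * c * Real.exp (-r ^ 2)), finrank_euclideanSpace_fin]
    have : ∀ r : ℝ, r ^ (N - 1) * (A * c * Real.exp (-r ^ 2)) =
      (A * c) * (r ^ (N - 1) * Real.exp (-r ^ 2)) := fun r => by ring
    simp_rw [this]
    rw [integral_const_mul, ← hc]
    ring
  rw [hlim]
  have hae : ∀ᵐ z : EuclideanSpace ℝ (Fin N), z ≠ 0 := by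
    simp [ae_iff]
  refine tendsto_integral_of_dominated_convergence
    (fun z => D * (A * M) * Real.exp (-‖z‖ ^ 2)) (fun n => ?_) ?_ (fun n => ?_) ?_
  · have hl : (0 : ℝ) < (n : ℝ) + 1 := by positivity
    have h1 := integrable_gaussExt_mul_gaussExt hN hk hg hl
    convert h1.integral_prod_left.aestronglyMeasurable using 2 with z
    rw [← integral_const_mul]
    simp_rw [mul_assoc]
  · refine Integrable.const_mul ?_ _
    rw [integrable_fun_norm_addHaar volume (f := fun r : ℝ => Real.exp (-r ^ 2))]
    exact integrableOn_pow_mul_gaussian _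
  · have hl : (0 : ℝ) < (n : ℝ) + 1 := by positivity
    filter_upwards [hae] with z hz
    obtain ⟨u, hu⟩ := exists_eq_norm_smul hz
    have hz' : 0 < ‖z‖ := norm_pos_iff.2 hz
    have h2 := integral_slab hN hg u hz' hl
    rw [← hu] at h2
    rw [h2, norm_mul, norm_mul, norm_inv, norm_norm, gaussExt, norm_mul,
      Real.norm_of_nonneg (by positivity : 0 ≤ ‖z‖ * Real.exp (-‖z‖ ^ 2))]
    have h3 : ‖∫ t : ℝ, Real.exp (-t ^ 2) *
        ∫ y : (ℝ ∙ (u : EuclideanSpace ℝ (Fin N)))ᗮ,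
          gaussExt g ((t / (((n : ℝ) + 1) * ‖z‖)) • (u : EuclideanSpace ℝ (Fin N)) + y)‖ ≤ A * M := by
      rw [hA, ← integral_mul_const]
      refine norm_integral_le_of_norm_le (hgauss.mul_const M) (.of_forall fun t => ?_)
      rw [norm_mul, Real.norm_of_nonneg (Real.exp_pos _).le]
      gcongr
      exact abs_integral_slice_gaussExt_le hN hC0 hC u _
    have h4 : ‖homExt k z‖ ≤ D := abs_homExt_le hD0 hD z
    calc ‖homExt k z‖ * (‖z‖ * Real.exp (-‖z‖ ^ 2)) * (‖z‖⁻¹ * _)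
        ≤ D * (‖z‖ * Real.exp (-‖z‖ ^ 2)) * (‖z‖⁻¹ * (A * M)) := by gcongr
      _ = _ := by field_simp
  · filter_upwards [hae] with z hz
    obtain ⟨u, hu⟩ := exists_eq_norm_smul hz
    have hz' : 0 < ‖z‖ := norm_pos_iff.2 hz
    have h2 : ∀ n : ℕ, _ := fun n : ℕ => integral_slab hN hg u hz' (by positivity : (0 : ℝ) < (n : ℝ) + 1)
    rw [← hu] at h2
    simp_rw [h2]
    have h5 : homExt (fun u => k u * radonTransform g u) z = homExt k z * radonTransform g u := by
      rw [hu, homExt_smul _ _ hz', homExt_smul _ _ hz']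
    have h6 : homExt (fun u => k u * radonTransform g u) z * (A * c * Real.exp (-‖z‖ ^ 2)) =
        gaussExt k z * (‖z‖⁻¹ * ∫ t : ℝ, Real.exp (-t ^ 2) *
          ∫ y : (ℝ ∙ (u : EuclideanSpace ℝ (Fin N)))ᗮ,
          gaussExt g ((0 : ℝ) • (u : EuclideanSpace ℝ (Fin N)) + y)) := by
      rw [h5, integral_mul_const, ← hA, gaussExt]
      simp only [zero_smul, zero_add]
      rw [integral_gaussExt_orthogonal hN g u, ← hc]
      field_simp
    rw [h6]
    refine Tendsto.const_mul _ (Tendsto.const_mul _ ?_)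
    refine tendsto_integral_of_dominated_convergence (fun t => Real.exp (-t ^ 2) * M)
      (fun n => ?_) (hgauss.mul_const M) (fun n => .of_forall fun t => ?_) (.of_forall fun t => ?_)
    · exact (Continuous.mul (by fun_prop) ((continuous_integral_slice_gaussExt hN hg u).comp
        (continuous_id.div_const _))).aestronglyMeasurable
    · rw [norm_mul, Real.norm_of_nonneg (Real.exp_pos _).le]
      gcongr
      exact abs_integral_slice_gaussExt_le hN hC0 hC u _
    · refine Tendsto.const_mul _ ?_
      refine ((continuous_integral_slice_gaussExt hN hg u).tendsto 0).comp ?_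
      have h7 : Tendsto (fun n : ℕ => ((n : ℝ) + 1) * ‖z‖) atTop atTop :=
        (tendsto_atTop_add_const_right _ _ tendsto_natCast_atTop_atTop).atTop_mul_const hz'
      exact tendsto_const_nhds.div_atTop h7

/-- The spherical Radon transform is self-adjoint: it is the limit of averages over slabs
`|⟪z, x⟫| ≲ 1 / l`, which are symmetric in `z` and `x`. -/
theorem integral_mul_radonTransform_comm (hN : 2 ≤ N)
    {g k : sphere (0 : EuclideanSpace ℝ (Fin N)) 1 → ℝ} (hg : Continuous g) (hk : Continuous k) :
    ∫ u, k u * radonTransform g u ∂(volume : Measure (EuclideanSpace ℝ (Fin N))).toSphere =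
      ∫ u, g u * radonTransform k u ∂(volume : Measure (EuclideanSpace ℝ (Fin N))).toSphere := by
  have := nontrivial_euclideanSpace hN
  have h1 := tendsto_integral_slab hN hg hk
  have h2 := tendsto_integral_slab hN hk hg
  have hswap : ∀ n : ℕ, (∫ z, gaussExt k z * ∫ x, gaussExt g x *
        (((n : ℝ) + 1) * Real.exp (-(((n : ℝ) + 1) * ⟪z, x⟫) ^ 2))) =
      ∫ z, gaussExt g z * ∫ x, gaussExt k x *
        (((n : ℝ) + 1) * Real.exp (-(((n : ℝ) + 1) * ⟪z, x⟫) ^ 2)) := by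
    intro n
    have hl : (0 : ℝ) < (n : ℝ) + 1 := by positivity
    simp_rw [← integral_const_mul]
    rw [integral_integral_swap]
    · congr 1 with x
      congr 1 with z
      rw [real_inner_comm]
      ring
    · simpa only [mul_assoc, Function.uncurry_def] using integrable_gaussExt_mul_gaussExt hN hk hg hl
  simp_rw [hswap] at h1
  have h3 := tendsto_nhds_unique h1 h2
  refine mul_left_cancel₀ (mul_pos ?_ (pow_pos (integral_pow_mul_gaussian_pos (N - 1)) 2)).ne' h3
  have := integral_gaussian 1
  simp only [neg_mul, one_mul, div_one] at this
  rw [this]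
  exact Real.sqrt_pos.2 Real.pi_pos

end

/-! ### Invariance under linear isometries -/

section

variable {E F : Type*} [NormedAddCommGroup E] [InnerProductSpace ℝ E]
  [NormedAddCommGroup F] [InnerProductSpace ℝ F]

/-- The map between unit spheres induced by a linear isometry. -/
def sphereMap (e : E ≃ₗᵢ[ℝ] F) (u : sphere (0 : E) 1) : sphere (0 : F) 1 :=
  ⟨e u, by rw [mem_sphere_zero_iff_norm, e.norm_map]; exact mem_sphere_zero_iff_norm.1 u.2⟩

@[simp]
lemma coe_sphereMap (e : E ≃ₗᵢ[ℝ] F) (u : sphere (0 : E) 1) : (sphereMap e u : F) = e u := rfl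

lemma continuous_sphereMap (e : E ≃ₗᵢ[ℝ] F) : Continuous (sphereMap e) :=
  (e.continuous.comp continuous_subtype_val).subtype_mk _

variable [FiniteDimensional ℝ E] [MeasurableSpace E] [BorelSpace E]
  [FiniteDimensional ℝ F] [MeasurableSpace F] [BorelSpace F]

/-- The surface measure of the sphere is transported by linear isometries, also between different
spaces; this is read off from the invariance of Lebesgue measure. -/
lemma integral_sphereMap [Nontrivial E] (e : E ≃ₗᵢ[ℝ] F) (g : sphere (0 : F) 1 → ℝ) :
    ∫ u, g (sphereMap e u) ∂(volume : Measure E).toSphere =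
      ∫ u, g u ∂(volume : Measure F).toSphere := by
  have : Nontrivial F := e.symm.toEquiv.nontrivial
  have h1 := integral_homExt_mul (fun u : sphere (0 : E) 1 => g (sphereMap e u))
    (fun r => Real.exp (-r ^ 2))
  have h2 := integral_homExt_mul g (fun r => Real.exp (-r ^ 2))
  have hdim : Module.finrank ℝ E = Module.finrank ℝ F := e.toLinearEquiv.finrank_eq
  rw [hdim] at h1
  refine mul_right_cancel₀ (integral_pow_mul_gaussian_pos (Module.finrank ℝ F - 1)).ne' ?_
  rw [← h1, ← h2, ← e.measurePreserving.integral_comp e.toHomeomorph.measurableEmbedding]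
  congr 1 with x
  rw [e.norm_map]
  congr 1
  unfold homExt
  by_cases hx : x = 0
  · simp [hx]
  · rw [dif_pos hx, dif_pos (by simpa using hx)]
    exact congrArg g (Subtype.ext (by simp))

lemma integral_sphere_neg [Nontrivial E] (g : sphere (0 : E) 1 → ℝ) :
    ∫ u, g (-u) ∂(volume : Measure E).toSphere = ∫ u, g u ∂(volume : Measure E).toSphere :=
  integral_sphereMap (LinearIsometryEquiv.neg ℝ) g

end

section

variable {N : ℕ}

/-- The spherical Radon transform commutes with linear isometries. -/
theorem radonTransform_comp_sphereMap (hN : 2 ≤ N)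
    (O : EuclideanSpace ℝ (Fin N) ≃ₗᵢ[ℝ] EuclideanSpace ℝ (Fin N))
    (g : sphere (0 : EuclideanSpace ℝ (Fin N)) 1 → ℝ)
    (ξ : sphere (0 : EuclideanSpace ℝ (Fin N)) 1) :
    radonTransform (fun u => g (sphereMap O u)) ξ = radonTransform g (sphereMap O ξ) := by
  have := nontrivial_orthogonal_sphere hN ξ
  have hmap : (ℝ ∙ (ξ : EuclideanSpace ℝ (Fin N)))ᗮ.map (O.toLinearEquiv :
      EuclideanSpace ℝ (Fin N) →ₗ[ℝ] EuclideanSpace ℝ (Fin N)) =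
      (ℝ ∙ (sphereMap O ξ : EuclideanSpace ℝ (Fin N)))ᗮ := by
    ext y
    rw [Submodule.mem_orthogonal_singleton_iff_inner_right, Submodule.mem_map]
    constructor
    · rintro ⟨x, hx, rfl⟩
      rw [Submodule.mem_orthogonal_singleton_iff_inner_right] at hx
      rw [← hx]
      exact O.inner_map_map _ _
    · intro hy
      refine ⟨O.symm y, ?_, O.apply_symm_apply y⟩
      rw [Submodule.mem_orthogonal_singleton_iff_inner_right, ← hy, ← O.inner_map_map]
      simp
  let e : (ℝ ∙ (ξ : EuclideanSpace ℝ (Fin N)))ᗮ ≃ₗᵢ[ℝ]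
      (ℝ ∙ (sphereMap O ξ : EuclideanSpace ℝ (Fin N)))ᗮ :=
    ⟨O.toLinearEquiv.ofSubmodules _ _ hmap, fun x => O.norm_map x⟩
  exact integral_sphereMap e (fun v => g (subsphereIncl _ v))

lemma continuous_subsphereIncl (ξ : EuclideanSpace ℝ (Fin N)) : Continuous (subsphereIncl ξ) :=
  (continuous_subtype_val.comp continuous_subtype_val).subtype_mk _

lemma integrable_sphere {E : Type*} [NormedAddCommGroup E] [InnerProductSpace ℝ E]
    [FiniteDimensional ℝ E] [MeasurableSpace E] [BorelSpace E] {g : sphere (0 : E) 1 → ℝ}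
    (hg : Continuous g) : Integrable g (volume : Measure E).toSphere :=
  hg.integrable_of_hasCompactSupport (HasCompactSupport.of_compactSpace _)

lemma radonTransform_add {g k : sphere (0 : EuclideanSpace ℝ (Fin N)) 1 → ℝ} (hg : Continuous g)
    (hk : Continuous k) (ξ : sphere (0 : EuclideanSpace ℝ (Fin N)) 1) :
    radonTransform (fun u => g u + k u) ξ = radonTransform g ξ + radonTransform k ξ :=
  integral_add (integrable_sphere (hg.comp (continuous_subsphereIncl _)))
    (integrable_sphere (hk.comp (continuous_subsphereIncl _)))

lemma radonTransform_const_mul (c : ℝ) (g : sphere (0 : EuclideanSpace ℝ (Fin N)) 1 → ℝ)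
    (ξ : sphere (0 : EuclideanSpace ℝ (Fin N)) 1) :
    radonTransform (fun u => c * g u) ξ = c * radonTransform g ξ :=
  integral_const_mul _ _

/-! ### Zonal functions -/

/-- The spherical Radon transform of a zonal function: on `ξ^⊥` the function depends only on the
coordinate along the projection of the pole, a vector of length `√(1 - ⟪e, ξ⟫²)`. -/
theorem radonTransform_zonal (hN : 3 ≤ N) {e : EuclideanSpace ℝ (Fin N)} (he : ‖e‖ = 1)
    {Φ : ℝ → ℝ} (hΦ : Continuous Φ) (ξ : sphere (0 : EuclideanSpace ℝ (Fin N)) 1) :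
    radonTransform (fun u => Φ ⟪e, (u : EuclideanSpace ℝ (Fin N))⟫) ξ = sphereArea (N - 2) *
      ∫ θ in (0 : ℝ)..Real.pi, Φ (√(1 - ⟪e, (ξ : EuclideanSpace ℝ (Fin N))⟫ ^ 2) * Real.cos θ) *
        Real.sin θ ^ (N - 3) := by
  have := nontrivial_orthogonal_sphere (by omega) ξ
  set a := ⟪e, (ξ : EuclideanSpace ℝ (Fin N))⟫ with ha
  have hξ : ‖(ξ : EuclideanSpace ℝ (Fin N))‖ = 1 := sphere_norm ξ
  have hξξ : ⟪(ξ : EuclideanSpace ℝ (Fin N)), (ξ : EuclideanSpace ℝ (Fin N))⟫ = 1 := by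
    rw [real_inner_self_eq_norm_sq, hξ, one_pow]
  have hee : ⟪e, e⟫ = 1 := by rw [real_inner_self_eq_norm_sq, he, one_pow]
  -- the orthogonal projection of the pole to the hyperplane
  let p : (ℝ ∙ (ξ : EuclideanSpace ℝ (Fin N)))ᗮ := ⟨e - a • (ξ : EuclideanSpace ℝ (Fin N)), by
    rw [Submodule.mem_orthogonal_singleton_iff_inner_right, inner_sub_right, inner_smul_right, hξξ,
      real_inner_comm]
    simp [ha]⟩
  have hp : ‖p‖ = √(1 - a ^ 2) := by
    have h1 : ‖p‖ ^ 2 = 1 - a ^ 2 := by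
      rw [← real_inner_self_eq_norm_sq, Submodule.coe_inner]
      simp only [p, inner_sub_left, inner_sub_right, inner_smul_left, inner_smul_right, hξξ, hee,
        real_inner_comm e, ← ha, conj_trivial]
      ring
    rw [← h1, Real.sqrt_sq (norm_nonneg _)]
  have hinner : ∀ v : (ℝ ∙ (ξ : EuclideanSpace ℝ (Fin N)))ᗮ,
      ⟪e, (v : EuclideanSpace ℝ (Fin N))⟫ = ⟪p, v⟫ := by
    intro v
    have hv := Submodule.mem_orthogonal_singleton_iff_inner_right.1 v.2
    rw [Submodule.coe_inner, inner_sub_left, inner_smul_left, hv]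
    simp
  obtain ⟨w, hw, hpw⟩ : ∃ w : (ℝ ∙ (ξ : EuclideanSpace ℝ (Fin N)))ᗮ, ‖w‖ = 1 ∧ p = ‖p‖ • w := by
    by_cases h0 : p = 0
    · obtain ⟨w, hw⟩ := exists_norm_eq (ℝ ∙ (ξ : EuclideanSpace ℝ (Fin N)))ᗮ zero_le_one
      exact ⟨w, hw, by simp [h0]⟩
    · have h0' : ‖p‖ ≠ 0 := norm_ne_zero_iff.2 h0
      refine ⟨‖p‖⁻¹ • p, ?_, ?_⟩
      · rw [norm_smul, norm_inv, norm_norm, inv_mul_cancel₀ h0']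
      · rw [smul_smul, mul_inv_cancel₀ h0', one_smul]
  have key := integral_sphere_zonal (E := (ℝ ∙ (ξ : EuclideanSpace ℝ (Fin N)))ᗮ)
    (by rw [finrank_orthogonal_sphere]; omega) hw (Φ := fun t => Φ (√(1 - a ^ 2) * t)) (by fun_prop)
  rw [finrank_orthogonal_sphere, ← hp] at key
  have e1 : N - 1 - 1 = N - 2 := by omega
  have e2 : N - 1 - 2 = N - 3 := by omega
  rw [e1, e2] at key
  rw [← hp, ← key]
  refine integral_congr_ae (.of_forall fun v => ?_)
  change Φ ⟪e, ((v : (ℝ ∙ (ξ : EuclideanSpace ℝ (Fin N)))ᗮ) : EuclideanSpace ℝ (Fin N))⟫ = _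
  rw [hinner, hpw, inner_smul_left]
  simp [norm_smul, hw]

lemma integral_cos_pow_mul_sin_pow_pos (j k : ℕ) :
    0 < ∫ θ in (0 : ℝ)..Real.pi, Real.cos θ ^ (2 * j) * Real.sin θ ^ k := by
  refine intervalIntegral.integral_pos Real.pi_pos (by fun_prop) (fun θ hθ => ?_) ?_
  · have := Real.sin_nonneg_of_nonneg_of_le_pi hθ.1.le hθ.2
    rw [pow_mul]
    positivity
  · refine ⟨Real.pi / 4, ⟨by linarith [Real.pi_pos], by linarith [Real.pi_pos]⟩, ?_⟩
    rw [Real.cos_pi_div_four, Real.sin_pi_div_four]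
    positivity

lemma inner_sphere_sq_le {e : EuclideanSpace ℝ (Fin N)} (he : ‖e‖ = 1)
    (u : sphere (0 : EuclideanSpace ℝ (Fin N)) 1) :
    ⟪e, (u : EuclideanSpace ℝ (Fin N))⟫ ^ 2 ≤ 1 := by
  rw [sq_le_one_iff_abs_le_one]
  simpa [he] using abs_real_inner_le_norm e u

/-- Every even zonal polynomial is the Radon transform of an even zonal polynomial, with
coefficients that do not depend on the pole. -/
theorem exists_radonTransform_eq_polynomial (hN : 3 ≤ N) (Q : Polynomial ℝ) :
    ∃ P : Polynomial ℝ, ∀ e : EuclideanSpace ℝ (Fin N), ‖e‖ = 1 →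
      ∀ ξ : sphere (0 : EuclideanSpace ℝ (Fin N)) 1,
        radonTransform (fun u => P.eval (⟪e, (u : EuclideanSpace ℝ (Fin N))⟫ ^ 2)) ξ =
          Q.eval (⟪e, (ξ : EuclideanSpace ℝ (Fin N))⟫ ^ 2) := by
  -- in the basis `(1 - x) ^ j` the transform is diagonal
  have main : ∀ Q : Polynomial ℝ, ∃ P : Polynomial ℝ, ∀ e : EuclideanSpace ℝ (Fin N), ‖e‖ = 1 →
      ∀ ξ : sphere (0 : EuclideanSpace ℝ (Fin N)) 1,
        radonTransform (fun u => P.eval (⟪e, (u : EuclideanSpace ℝ (Fin N))⟫ ^ 2)) ξ =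
          Q.eval (1 - ⟪e, (ξ : EuclideanSpace ℝ (Fin N))⟫ ^ 2) := by
    intro Q
    induction Q using Polynomial.induction_on' with
    | add Q₁ Q₂ h₁ h₂ =>
      obtain ⟨P₁, hP₁⟩ := h₁
      obtain ⟨P₂, hP₂⟩ := h₂
      refine ⟨P₁ + P₂, fun e he ξ => ?_⟩
      simp_rw [Polynomial.eval_add]
      rw [radonTransform_add (by fun_prop) (by fun_prop), hP₁ e he, hP₂ e he]
    | monomial j a =>
      set c := sphereArea (N - 2) *
        ∫ θ in (0 : ℝ)..Real.pi, Real.cos θ ^ (2 * j) * Real.sin θ ^ (N - 3) with hc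
      have hcpos : 0 < c :=
        mul_pos (sphereArea_pos (by omega)) (integral_cos_pow_mul_sin_pow_pos _ _)
      refine ⟨Polynomial.monomial j (a / c), fun e he ξ => ?_⟩
      have h := radonTransform_zonal hN he (Φ := fun t => t ^ (2 * j)) (by fun_prop) ξ
      simp_rw [Polynomial.eval_monomial, ← pow_mul]
      rw [radonTransform_const_mul, h]
      have h1 : 0 ≤ 1 - ⟪e, (ξ : EuclideanSpace ℝ (Fin N))⟫ ^ 2 := by
        linarith [inner_sphere_sq_le he ξ]
      simp_rw [mul_pow, mul_assoc]
      rw [intervalIntegral.integral_const_mul, pow_mul, Real.sq_sqrt h1]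
      have : ∀ x y : ℝ, a / c * (sphereArea (N - 2) * (x * y)) =
        a / c * (sphereArea (N - 2) * y) * x := fun x y => by ring
      rw [this, ← hc, div_mul_cancel₀ _ hcpos.ne']
  obtain ⟨P, hP⟩ := main (Q.comp (1 - Polynomial.X))
  refine ⟨P, fun e he ξ => ?_⟩
  rw [hP e he, Polynomial.eval_comp]
  simp

/-! ### Injectivity of the spherical Radon transform -/

lemma exists_even_odd_one_add_pow (m : ℕ) :
    ∃ A B : Polynomial ℝ, ∀ t : ℝ, (1 + t) ^ m = A.eval (t ^ 2) + t * B.eval (t ^ 2) := by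
  induction m with
  | zero => exact ⟨1, 0, fun t => by simp⟩
  | succ m ih =>
    obtain ⟨A, B, h⟩ := ih
    refine ⟨A + Polynomial.X * B, A + B, fun t => ?_⟩
    rw [pow_succ, h]
    simp only [Polynomial.eval_add, Polynomial.eval_mul, Polynomial.eval_X]
    ring

/-- An even continuous function on the sphere with vanishing Radon transform vanishes: it is
orthogonal to all even zonal polynomials with a given pole, hence to the peak functions
`(1 + ⟪e, u⟫) ^ m`. -/
theorem eq_zero_of_radonTransform_eq_zero (hN : 3 ≤ N)
    {h : sphere (0 : EuclideanSpace ℝ (Fin N)) 1 → ℝ} (hc : Continuous h)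
    (heven : ∀ u, h (-u) = h u) (hR : ∀ ξ, radonTransform h ξ = 0) (e) : h e = 0 := by
  have := nontrivial_euclideanSpace (N := N) (by omega)
  set σ := (volume : Measure (EuclideanSpace ℝ (Fin N))).toSphere with hσ
  have he := sphere_norm e
  have h1 : ∀ Q : Polynomial ℝ, ∫ u, h u * Q.eval (⟪(e : EuclideanSpace ℝ (Fin N)), u⟫ ^ 2) ∂σ = 0 := by
    intro Q
    obtain ⟨P, hP⟩ := exists_radonTransform_eq_polynomial hN Q
    simp_rw [← hP e he]
    rw [← integral_mul_radonTransform_comm (by omega) hc (by fun_prop)]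
    simp [hR]
  have h2 : ∀ m : ℕ, ∫ u, (1 + ⟪(e : EuclideanSpace ℝ (Fin N)), u⟫) ^ m • h u ∂σ = 0 := by
    intro m
    obtain ⟨A, B, hAB⟩ := exists_even_odd_one_add_pow m
    have h3 : ∫ u, h u * (⟪(e : EuclideanSpace ℝ (Fin N)), u⟫ *
        B.eval (⟪(e : EuclideanSpace ℝ (Fin N)), u⟫ ^ 2)) ∂σ = 0 := by
      have h4 := integral_sphere_neg (fun u => h u * (⟪(e : EuclideanSpace ℝ (Fin N)), u⟫ *
        B.eval (⟪(e : EuclideanSpace ℝ (Fin N)), u⟫ ^ 2)))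
      have h5 : ∀ u : sphere (0 : EuclideanSpace ℝ (Fin N)) 1,
          ⟪(e : EuclideanSpace ℝ (Fin N)), ((-u : sphere (0 : EuclideanSpace ℝ (Fin N)) 1) :
            EuclideanSpace ℝ (Fin N))⟫ = -⟪(e : EuclideanSpace ℝ (Fin N)), u⟫ := by
        intro u
        rw [← inner_neg_right]; rfl
      simp only [heven, h5, neg_sq, neg_mul, mul_neg, integral_neg] at h4
      linarith
    simp_rw [hAB, smul_eq_mul, mul_comm _ (h _), mul_add]
    rw [integral_add (integrable_sphere (by fun_prop)) (integrable_sphere (by fun_prop)), h1, h3,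
      add_zero]
  have hee : ⟪(e : EuclideanSpace ℝ (Fin N)), (e : EuclideanSpace ℝ (Fin N))⟫ = 1 := by
    rw [real_inner_self_eq_norm_sq, he, one_pow]
  -- the normalized functions `(1 + ⟪e, u⟫) ^ m` concentrate at `e`
  have h6 := tendsto_setIntegral_pow_smul_of_unique_maximum_of_isCompact_of_continuousOn (μ := σ)
    (s := univ) (x₀ := e) (g := h) (c := fun u => 1 + ⟪(e : EuclideanSpace ℝ (Fin N)), u⟫)
    isCompact_univ (by fun_prop) (fun y _ hy => ?_) (fun x _ => ?_) ?_ (by simp) hc.continuousOn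
  · simp only [Measure.restrict_univ, h2, smul_zero] at h6
    exact (tendsto_nhds_unique h6 tendsto_const_nhds)
  · have h7 : ⟪(e : EuclideanSpace ℝ (Fin N)), (y : EuclideanSpace ℝ (Fin N))⟫ < 1 :=
      inner_lt_one_iff_real_of_norm_eq_one he (sphere_norm y) |>.2
        (fun h8 => hy (Subtype.ext h8.symm))
    linarith
  · have := neg_le_of_abs_le (abs_real_inner_le_norm (e : EuclideanSpace ℝ (Fin N)) x)
    rw [he, sphere_norm x] at this
    linarith
  · rw [hee]; norm_num

/-- An even continuous function on the sphere is determined by its Radon transform. -/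
theorem radonTransform_injective (hN : 3 ≤ N)
    {g k : sphere (0 : EuclideanSpace ℝ (Fin N)) 1 → ℝ} (hg : Continuous g) (hk : Continuous k)
    (hg' : ∀ u, g (-u) = g u) (hk' : ∀ u, k (-u) = k u)
    (h : ∀ ξ, radonTransform g ξ = radonTransform k ξ) : g = k := by
  funext u
  have h0 := eq_zero_of_radonTransform_eq_zero hN (h := fun u => g u + (-1) * k u) (by fun_prop)
    (fun u => by rw [hg', hk']) (fun ξ => ?_) u
  · linarith
  · rw [radonTransform_add hg (by fun_prop), radonTransform_const_mul, h]
    ring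

end

/-! ### Heights and meridians -/

section

variable {n : ℕ}

lemma norm_unitVec {i : ℕ} (hi : i < n) : ‖unitVec n i‖ = 1 := by
  have : unitVec n i = EuclideanSpace.single (⟨i, hi⟩ : Fin n) (1 : ℝ) := by
    ext j
    simp [unitVec, Fin.ext_iff]
  rw [this]
  simp

lemma norm_axis (hn : 1 ≤ n) : ‖axis n‖ = 1 := norm_unitVec (by omega)

lemma inner_axis_unitVec_zero (hn : 2 ≤ n) : ⟪axis n, unitVec n 0⟫ = 0 := by
  simp only [axis, unitVec, PiLp.inner_apply]
  refine Finset.sum_eq_zero fun j _ => ?_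
  simp only [RCLike.inner_apply, conj_trivial]
  split_ifs with h1 h2
  · omega
  all_goals simp

lemma height_meridian (hn : 2 ≤ n) (ψ : ℝ) : height (meridian n ψ) = Real.cos ψ := by
  rw [height, meridian, inner_add_right, inner_smul_right, inner_smul_right,
    inner_axis_unitVec_zero hn, real_inner_self_eq_norm_sq, norm_axis (by omega)]
  simp

lemma norm_meridian (hn : 2 ≤ n) (ψ : ℝ) : ‖meridian n ψ‖ = 1 := by
  have h : ⟪Real.cos ψ • axis n, Real.sin ψ • unitVec n 0⟫ = 0 := by
    rw [inner_smul_left, inner_smul_right, inner_axis_unitVec_zero hn]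
    simp
  have h1 := norm_add_sq_eq_norm_sq_add_norm_sq_of_inner_eq_zero _ _ h
  rw [norm_smul, norm_smul, norm_axis (by omega), norm_unitVec (by omega)] at h1
  have h2 : ‖meridian n ψ‖ ^ 2 = 1 := by
    rw [meridian, sq, h1]
    simp only [mul_one, Real.norm_eq_abs, abs_mul_abs_self]
    linarith [Real.sin_sq_add_cos_sq ψ]
  nlinarith [norm_nonneg (meridian n ψ)]

/-- The points of the meridian, as points of the sphere. -/
def meridianPt (hn : 2 ≤ n) (ψ : ℝ) : sphere (0 : EuclideanSpace ℝ (Fin n)) 1 :=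
  ⟨meridian n ψ, mem_sphere_zero_iff_norm.2 (norm_meridian hn ψ)⟩

lemma continuous_meridianPt (hn : 2 ≤ n) : Continuous (meridianPt hn) := by
  unfold meridianPt meridian
  fun_prop

lemma abs_height_le (hn : 1 ≤ n) (x : EuclideanSpace ℝ (Fin n)) : |height x| ≤ ‖x‖ := by
  unfold height
  simpa [norm_axis hn] using abs_real_inner_le_norm (axis n) x

@[fun_prop]
lemma continuous_height : Continuous (height : EuclideanSpace ℝ (Fin n) → ℝ) := by
  unfold height
  fun_prop

lemma height_smul (a : ℝ) (x : EuclideanSpace ℝ (Fin n)) : height (a • x) = a * height x :=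
  inner_smul_right _ _ _

lemma height_neg (x : EuclideanSpace ℝ (Fin n)) : height (-x) = -height x :=
  inner_neg_right _ _

lemma height_add (x y : EuclideanSpace ℝ (Fin n)) : height (x + y) = height x + height y :=
  inner_add_right _ _ _

/-- Two unit vectors of the same height are exchanged by a reflection fixing the axis. -/
lemma exists_isometry_of_height_eq {v w : EuclideanSpace ℝ (Fin n)} (hvw : ‖v‖ = ‖w‖)
    (h : height v = height w) :
    ∃ O : EuclideanSpace ℝ (Fin n) ≃ₗᵢ[ℝ] EuclideanSpace ℝ (Fin n),
      O v = w ∧ ∀ x, height (O x) = height x := by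
  refine ⟨(ℝ ∙ (v - w))ᗮ.reflection, Submodule.reflection_sub hvw, fun x => ?_⟩
  have hax : (ℝ ∙ (v - w))ᗮ.reflection (axis n) = axis n := by
    apply Submodule.reflection_mem_subspace_eq_self
    rw [Submodule.mem_orthogonal_singleton_iff_inner_left, inner_sub_right]
    exact sub_eq_zero.2 h
  unfold height
  conv_lhs => rw [← hax]
  exact LinearIsometryEquiv.inner_map_map _ _ _

end

/-! ### Radial functions -/

section

variable {n : ℕ} {K : Set (EuclideanSpace ℝ (Fin n))}

lemma IsStarBody.zero_mem (hK : IsStarBody K) : (0 : EuclideanSpace ℝ (Fin n)) ∈ K :=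
  hK.starConvex.mem (hK.nonempty_interior.mono interior_subset)

lemma IsStarBody.bddAbove (hK : IsStarBody K) (u : sphere (0 : EuclideanSpace ℝ (Fin n)) 1) :
    BddAbove {a : ℝ | a • (u : EuclideanSpace ℝ (Fin n)) ∈ K} := by
  obtain ⟨R, hR⟩ := hK.isCompact.isBounded.exists_norm_le
  refine ⟨R, fun a ha => ?_⟩
  have := hR _ ha
  rw [norm_smul, sphere_norm u, mul_one] at this
  exact (le_abs_self a).trans this

lemma IsStarBody.radial_nonneg (hK : IsStarBody K)
    (u : sphere (0 : EuclideanSpace ℝ (Fin n)) 1) : 0 ≤ radial K u :=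
  le_csSup (hK.bddAbove u) (by simpa using hK.zero_mem)

lemma IsStarBody.smul_mem_iff (hK : IsStarBody K) (u : sphere (0 : EuclideanSpace ℝ (Fin n)) 1)
    {a : ℝ} (ha : 0 ≤ a) : a • (u : EuclideanSpace ℝ (Fin n)) ∈ K ↔ a ≤ radial K u := by
  constructor
  · exact fun h => le_csSup (hK.bddAbove u) h
  · intro h
    have hmem : radial K u • (u : EuclideanSpace ℝ (Fin n)) ∈ K := by
      refine IsClosed.csSup_mem (s := {a : ℝ | a • (u : EuclideanSpace ℝ (Fin n)) ∈ K}) ?_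
        ⟨0, by simpa using hK.zero_mem⟩ (hK.bddAbove u)
      exact hK.isCompact.isClosed.preimage (by fun_prop)
    rcases ha.eq_or_lt with rfl | ha'
    · simpa using hK.zero_mem
    · have hr : 0 < radial K u := ha'.trans_le h
      have := starConvex_zero_iff.1 hK.starConvex hmem (div_nonneg ha hr.le) (div_le_one_of_le₀ h hr.le)
      rwa [smul_smul, div_mul_cancel₀ _ hr.ne'] at this

lemma radial_neg (hK : IsOriginSymmetric K) (x : EuclideanSpace ℝ (Fin n)) :
    radial K (-x) = radial K x := by
  unfold radial
  congr 1
  ext a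
  simp only [mem_ofPred_eq, smul_neg]
  exact ⟨fun h => by simpa using hK _ h, fun h => hK _ h⟩

/-- The volume of a central section is a spherical Radon transform. -/
theorem IsStarBody.sectionVolume_eq (hn : 2 ≤ n) (hK : IsStarBody K)
    (ξ : sphere (0 : EuclideanSpace ℝ (Fin n)) 1) :
    sectionVolume K ξ = ((n : ℝ) - 1)⁻¹ * radonTransform (fun u => radial K u ^ (n - 1)) ξ := by
  have := nontrivial_orthogonal_sphere hn ξ
  have h := measureReal_radial_set (E := (ℝ ∙ (ξ : EuclideanSpace ℝ (Fin n)))ᗮ)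
    (A := {y | (y : EuclideanSpace ℝ (Fin n)) ∈ K})
    (hK.isCompact.isClosed.measurableSet.preimage measurable_subtype_coe)
    (fun v => radial K (subsphereIncl (ξ : EuclideanSpace ℝ (Fin n)) v))
    (hK.continuous_radial.comp (continuous_subsphereIncl _)) (fun v => hK.radial_nonneg _)
    (fun v a ha => hK.smul_mem_iff (subsphereIncl (ξ : EuclideanSpace ℝ (Fin n)) v) ha.le)
  rw [finrank_orthogonal_sphere] at h
  rw [show ((n : ℝ) - 1) = ((n - 1 : ℕ) : ℝ) by rw [Nat.cast_sub (by omega)]; simp]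
  exact h

end

/-! ### Bodies of revolution -/

section

variable {n : ℕ}

lemma arccos_abs_div_mem (x : EuclideanSpace ℝ (Fin n)) :
    Real.arccos (|height x| / ‖x‖) ∈ Icc (0 : ℝ) (Real.pi / 2) :=
  ⟨Real.arccos_nonneg _, Real.arccos_le_pi_div_two.2 (by positivity)⟩

/-- At the origin membership reads `0 ≤ ρ (arccos 0)`, since `0 / 0 = 0`; this is where the
nonnegativity of `ρ` enters. -/
lemma smul_mem_bodyOfRevolution {ρ : ℝ → ℝ} (hρ : ∀ φ ∈ Icc (0 : ℝ) (Real.pi / 2), 0 ≤ ρ φ)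
    (u : sphere (0 : EuclideanSpace ℝ (Fin n)) 1) (a : ℝ) :
    a • (u : EuclideanSpace ℝ (Fin n)) ∈ bodyOfRevolution n ρ ↔
      |a| ≤ ρ (Real.arccos |height (u : EuclideanSpace ℝ (Fin n))|) := by
  rw [bodyOfRevolution, mem_ofPred_eq, norm_smul, sphere_norm u, mul_one, height_smul, abs_mul,
    Real.norm_eq_abs]
  rcases eq_or_ne a 0 with rfl | ha
  · have h := hρ _ (arccos_abs_div_mem (u : EuclideanSpace ℝ (Fin n)))
    have h' := hρ _ (arccos_abs_div_mem (0 : EuclideanSpace ℝ (Fin n)))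
    rw [sphere_norm u, div_one] at h
    simp only [height, inner_zero_right] at h'
    simp only [abs_zero, zero_mul]
    refine ⟨fun _ => h, fun _ => ?_⟩
    simpa using h'
  · rw [mul_div_cancel_left₀ _ (abs_ne_zero.2 ha)]

lemma radial_bodyOfRevolution {ρ : ℝ → ℝ} (hρ : ∀ φ ∈ Icc (0 : ℝ) (Real.pi / 2), 0 ≤ ρ φ)
    (u : sphere (0 : EuclideanSpace ℝ (Fin n)) 1) :
    radial (bodyOfRevolution n ρ) u = ρ (Real.arccos |height (u : EuclideanSpace ℝ (Fin n))|) := by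
  have h := hρ _ (arccos_abs_div_mem (u : EuclideanSpace ℝ (Fin n)))
  rw [sphere_norm u, div_one] at h
  have hset : {a : ℝ | a • (u : EuclideanSpace ℝ (Fin n)) ∈ bodyOfRevolution n ρ} =
      Icc (-ρ (Real.arccos |height (u : EuclideanSpace ℝ (Fin n))|))
        (ρ (Real.arccos |height (u : EuclideanSpace ℝ (Fin n))|)) := by
    ext a
    rw [mem_ofPred_eq, smul_mem_bodyOfRevolution hρ, abs_le, mem_Icc]
  rw [radial, hset, csSup_Icc (by linarith)]

lemma isOriginSymmetric_bodyOfRevolution (ρ : ℝ → ℝ) :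
    IsOriginSymmetric (bodyOfRevolution n ρ) := by
  intro x hx
  rw [bodyOfRevolution, mem_ofPred_eq] at *
  rwa [norm_neg, height_neg, abs_neg]

lemma continuous_axialProfile (hn : 2 ≤ n) {L : Set (EuclideanSpace ℝ (Fin n))}
    (hL : IsStarBody L) : Continuous (axialProfile L) :=
  hL.continuous_radial.comp ((continuous_meridianPt hn).comp Real.continuous_arccos)

lemma axialProfile_nonneg (hn : 2 ≤ n) {L : Set (EuclideanSpace ℝ (Fin n))}
    (hL : IsStarBody L) (t : ℝ) : 0 ≤ axialProfile L t :=
  hL.radial_nonneg (meridianPt hn (Real.arccos t))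

/-- If the intersection body of `L` is a body of revolution, then so is `L`, because the Radon
transform is injective and commutes with the isometries fixing the axis. -/
theorem IsIntersectionBodyOf.radial_eq_axialProfile (hn : 3 ≤ n) {ρ : ℝ → ℝ}
    (hρ : ∀ φ ∈ Icc (0 : ℝ) (Real.pi / 2), 0 ≤ ρ φ) {L : Set (EuclideanSpace ℝ (Fin n))}
    (hKL : IsIntersectionBodyOf (bodyOfRevolution n ρ) L)
    (u : sphere (0 : EuclideanSpace ℝ (Fin n)) 1) :
    radial L u = axialProfile L |height (u : EuclideanSpace ℝ (Fin n))| := by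
  have hL := hKL.isStarBody'
  -- the radial function of `L` is invariant under every isometry fixing the axis
  have hinv : ∀ O : EuclideanSpace ℝ (Fin n) ≃ₗᵢ[ℝ] EuclideanSpace ℝ (Fin n),
      (∀ x, height (O x) = height x) → ∀ v : sphere (0 : EuclideanSpace ℝ (Fin n)) 1,
        radial L (sphereMap O v : EuclideanSpace ℝ (Fin n)) = radial L v := by
    intro O hO v
    have hc : Continuous fun v : sphere (0 : EuclideanSpace ℝ (Fin n)) 1 => radial L v ^ (n - 1) :=
      hL.continuous_radial.pow (n - 1)
    have heven : ∀ v : sphere (0 : EuclideanSpace ℝ (Fin n)) 1,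
        radial L (-v : sphere (0 : EuclideanSpace ℝ (Fin n)) 1) ^ (n - 1) =
          radial L v ^ (n - 1) := fun v => congrArg (· ^ (n - 1)) (radial_neg hKL.symmetric' v)
    have hsymm : ∀ v : sphere (0 : EuclideanSpace ℝ (Fin n)) 1,
        sphereMap O (-v) = -sphereMap O v := fun v =>
      Subtype.ext (map_neg O (v : EuclideanSpace ℝ (Fin n)))
    have h1 := radonTransform_injective hn (hc.comp (continuous_sphereMap O)) hc
      (fun v => by simp only [Function.comp_def, hsymm, heven]) heven (fun ξ => ?_)
    · exact (pow_left_inj₀ (hL.radial_nonneg _) (hL.radial_nonneg _) (by omega)).1 (congrFun h1 v)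
    · have hn1 : ((n : ℝ) - 1)⁻¹ ≠ 0 := by
        have : (3 : ℝ) ≤ n := by exact_mod_cast hn
        exact inv_ne_zero (by linarith)
      refine mul_left_cancel₀ hn1 ?_
      simp only [Function.comp_def]
      rw [radonTransform_comp_sphereMap (by omega) O
          (fun v : sphere (0 : EuclideanSpace ℝ (Fin n)) 1 => radial L v ^ (n - 1)),
        ← hL.sectionVolume_eq (by omega), ← hL.sectionVolume_eq (by omega), ← hKL.radial_eq,
        ← hKL.radial_eq, radial_bodyOfRevolution hρ, radial_bodyOfRevolution hρ, coe_sphereMap, hO]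
  have hpos : ∀ v : sphere (0 : EuclideanSpace ℝ (Fin n)) 1,
      0 ≤ height (v : EuclideanSpace ℝ (Fin n)) →
      radial L v = axialProfile L (height (v : EuclideanSpace ℝ (Fin n))) := by
    intro v hv
    have hle := abs_height_le (n := n) (by omega) v
    rw [sphere_norm v, abs_le] at hle
    have hm : height (meridian n (Real.arccos (height (v : EuclideanSpace ℝ (Fin n))))) =
        height (v : EuclideanSpace ℝ (Fin n)) := by
      rw [height_meridian (by omega), Real.cos_arccos hle.1 hle.2]
    obtain ⟨O, hO1, hO2⟩ := exists_isometry_of_height_eq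
      (v := (v : EuclideanSpace ℝ (Fin n))) (by rw [sphere_norm v, norm_meridian (by omega)]) hm.symm
    rw [← hinv O hO2 v, coe_sphereMap, hO1]
    rfl
  rcases le_total 0 (height (u : EuclideanSpace ℝ (Fin n))) with h | h
  · rw [abs_of_nonneg h]
    exact hpos u h
  · rw [abs_of_nonpos h, ← radial_neg hKL.symmetric', ← height_neg]
    refine hpos (-u) ?_
    change 0 ≤ height (-(u : EuclideanSpace ℝ (Fin n)))
    rw [height_neg]
    linarith

/-- The spherical Radon transform of a zonal function on the sphere of `ℝᴺ`, as a function of the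
sine `r` of the angle from the axis. -/
def zonalRadon (N : ℕ) (Φ : ℝ → ℝ) (r : ℝ) : ℝ :=
  sphereArea (N - 2) * ∫ θ in (0 : ℝ)..Real.pi, Φ (r * Real.cos θ) * Real.sin θ ^ (N - 3)

lemma radonTransform_height (hn : 3 ≤ n) {Φ : ℝ → ℝ} (hΦ : ContinuousOn Φ (Icc (-1) 1))
    (ξ : sphere (0 : EuclideanSpace ℝ (Fin n)) 1) :
    radonTransform (fun u => Φ (height (u : EuclideanSpace ℝ (Fin n)))) ξ =
      zonalRadon n Φ (√(1 - height (ξ : EuclideanSpace ℝ (Fin n)) ^ 2)) := by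
  -- `Φ` may be replaced by a continuous function on the line which agrees with it on `[-1, 1]`
  have hproj : ∀ t ∈ Icc (-1 : ℝ) 1, IccExtend (by norm_num) ((Icc (-1 : ℝ) 1).domRestrict Φ) t = Φ t :=
    fun t ht => by rw [IccExtend_of_mem _ _ ht]; rfl
  have h := radonTransform_zonal hn (norm_axis (by omega)) (Φ := IccExtend (by norm_num)
    ((Icc (-1 : ℝ) 1).domRestrict Φ)) hΦ.domRestrict.Icc_extend' ξ
  have h1 : ∀ u : sphere (0 : EuclideanSpace ℝ (Fin n)) 1,
      height (u : EuclideanSpace ℝ (Fin n)) ∈ Icc (-1 : ℝ) 1 := by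
    intro u
    rw [mem_Icc, ← abs_le]
    simpa [sphere_norm u] using abs_height_le (n := n) (by omega) u
  have h2 : ∀ r ∈ Icc (0 : ℝ) 1, ∀ θ, r * Real.cos θ ∈ Icc (-1 : ℝ) 1 := by
    intro r hr θ
    rw [mem_Icc, ← abs_le, abs_mul, abs_of_nonneg hr.1]
    exact mul_le_one₀ hr.2 (abs_nonneg _) (Real.abs_cos_le_one θ)
  have h3 : √(1 - height (ξ : EuclideanSpace ℝ (Fin n)) ^ 2) ∈ Icc (0 : ℝ) 1 :=
    ⟨Real.sqrt_nonneg _, Real.sqrt_le_one.2 (by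
      linarith [sq_nonneg (height (ξ : EuclideanSpace ℝ (Fin n)))])⟩
  change radonTransform (fun u => IccExtend _ _ (height (u : EuclideanSpace ℝ (Fin n)))) ξ =
    sphereArea (n - 2) * ∫ θ in (0 : ℝ)..Real.pi, IccExtend _ _
      (√(1 - height (ξ : EuclideanSpace ℝ (Fin n)) ^ 2) * Real.cos θ) * _ at h
  simp_rw [hproj _ (h1 _), hproj _ (h2 _ h3 _)] at h
  exact h

/-- The radial function of a body of revolution which is the intersection body of `L`, in terms
of the profile of `L`. -/
theorem IsIntersectionBodyOf.profile_eq (hn : 3 ≤ n) {ρ : ℝ → ℝ}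
    (hρ : ∀ φ ∈ Icc (0 : ℝ) (Real.pi / 2), 0 ≤ ρ φ) {L : Set (EuclideanSpace ℝ (Fin n))}
    (hKL : IsIntersectionBodyOf (bodyOfRevolution n ρ) L) {t : ℝ} (ht : t ∈ Icc (-1 : ℝ) 1) :
    ρ (Real.arccos |t|) =
      ((n : ℝ) - 1)⁻¹ * zonalRadon n (fun s => axialProfile L |s| ^ (n - 1)) (√(1 - t ^ 2)) := by
  have hL := hKL.isStarBody'
  have h1 := radial_bodyOfRevolution hρ (meridianPt (n := n) (by omega) (Real.arccos t))
  have h2 : height (meridianPt (n := n) (by omega) (Real.arccos t) : EuclideanSpace ℝ (Fin n)) = t := by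
    change height (meridian n (Real.arccos t)) = t
    rw [height_meridian (by omega), Real.cos_arccos ht.1 ht.2]
  rw [h2] at h1
  have hf := continuous_axialProfile (by omega) hL
  rw [← h1, hKL.radial_eq, hL.sectionVolume_eq (by omega)]
  simp_rw [hKL.radial_eq_axialProfile hn hρ]
  rw [radonTransform_height hn (Φ := fun s => axialProfile L |s| ^ (n - 1)) (by fun_prop),
    h2]

end

/-! ### The shift of the dimension by two -/

lemma integral_abs_cos_mul_sin_pow {g : ℝ → ℝ} (hg : ContinuousOn g (Icc 0 1)) (k : ℕ) :
    ∫ θ in (0 : ℝ)..Real.pi, g |Real.cos θ| * Real.sin θ ^ k =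
      2 * ∫ θ in (0 : ℝ)..(Real.pi / 2), g (Real.cos θ) * Real.sin θ ^ k := by
  have hc : Continuous fun θ : ℝ => g |Real.cos θ| * Real.sin θ ^ k := by
    refine Continuous.mul ?_ (by fun_prop)
    exact hg.comp_continuous (by fun_prop) fun θ => ⟨abs_nonneg _, Real.abs_cos_le_one θ⟩
  rw [← intervalIntegral.integral_add_adjacent_intervals (hc.intervalIntegrable 0 (Real.pi / 2))
    (hc.intervalIntegrable _ _)]
  have h1 : ∫ θ in (Real.pi / 2)..Real.pi, g |Real.cos θ| * Real.sin θ ^ k =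
      ∫ θ in (0 : ℝ)..(Real.pi / 2), g |Real.cos θ| * Real.sin θ ^ k := by
    have := intervalIntegral.integral_comp_sub_left
      (fun θ => g |Real.cos θ| * Real.sin θ ^ k) Real.pi (a := 0) (b := Real.pi / 2)
    rw [show Real.pi - Real.pi / 2 = Real.pi / 2 by ring, sub_zero] at this
    rw [← this]
    simp only [Real.cos_pi_sub, Real.sin_pi_sub, abs_neg]
  rw [h1, ← two_mul]
  congr 1
  refine intervalIntegral.integral_congr fun θ hθ => ?_
  rw [uIcc_of_le (by positivity)] at hθ
  have : 0 ≤ Real.cos θ := Real.cos_nonneg_of_mem_Icc ⟨by linarith [hθ.1, Real.pi_pos], hθ.2⟩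
  simp only [abs_of_nonneg this]

/-- Integration by parts in the angle variable. -/
lemma integral_deriv_comp_cos {G G' v v' : ℝ → ℝ} (hG : ContinuousOn G (Icc 0 1))
    (hG' : ContinuousOn G' (Icc 0 1)) (hd : ∀ t ∈ Ioo (0 : ℝ) 1, HasDerivAt G (G' t) t)
    (hv : ∀ θ, HasDerivAt v (v' θ) θ) (hv' : Continuous v') (h0 : v 0 = 0)
    (h1 : v (Real.pi / 2) = 0) {r : ℝ} (hr : r ∈ Icc (0 : ℝ) 1) :
    ∫ θ in (0 : ℝ)..(Real.pi / 2), r * G' (r * Real.cos θ) * (Real.sin θ * v θ) =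
      ∫ θ in (0 : ℝ)..(Real.pi / 2), G (r * Real.cos θ) * v' θ := by
  have hpi : (0 : ℝ) ≤ Real.pi / 2 := by positivity
  have hvc : Continuous v := continuous_iff_continuousAt.2 fun θ => (hv θ).continuousAt
  have hmaps : MapsTo (fun θ => r * Real.cos θ) (Icc 0 (Real.pi / 2)) (Icc 0 1) := by
    intro θ hθ
    have h : 0 ≤ Real.cos θ := Real.cos_nonneg_of_mem_Icc ⟨by linarith [hθ.1], hθ.2⟩
    exact ⟨mul_nonneg hr.1 h, mul_le_one₀ hr.2 h (Real.cos_le_one θ)⟩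
  have hcG : ContinuousOn (fun θ => G (r * Real.cos θ)) (Icc 0 (Real.pi / 2)) :=
    hG.comp (by fun_prop) hmaps
  have hcG' : ContinuousOn (fun θ => G' (r * Real.cos θ)) (Icc 0 (Real.pi / 2)) :=
    hG'.comp (by fun_prop) hmaps
  have hi1 : IntervalIntegrable (fun θ => G (r * Real.cos θ) * v' θ) volume 0 (Real.pi / 2) :=
    (hcG.mul hv'.continuousOn).intervalIntegrable_of_Icc hpi
  have hi2 : IntervalIntegrable (fun θ => r * G' (r * Real.cos θ) * (Real.sin θ * v θ)) volume 0
      (Real.pi / 2) :=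
    ((continuousOn_const.mul hcG').mul
      (Real.continuous_sin.mul hvc).continuousOn).intervalIntegrable_of_Icc hpi
  have hftc := intervalIntegral.integral_eq_sub_of_hasDerivAt_of_le hpi
    (f := fun θ => G (r * Real.cos θ) * v θ)
    (f' := fun θ => G (r * Real.cos θ) * v' θ - r * G' (r * Real.cos θ) * (Real.sin θ * v θ))
    (hcG.mul hvc.continuousOn) (fun θ hθ => ?_) (hi1.sub hi2)
  · rw [intervalIntegral.integral_sub hi1 hi2, h0, h1] at hftc
    linarith
  · have hd1 : HasDerivAt (fun θ => G (r * Real.cos θ))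
        (-(r * G' (r * Real.cos θ) * Real.sin θ)) θ := by
      rcases hr.1.eq_or_lt with h | h
      · simp only [← h, zero_mul, neg_zero]
        exact hasDerivAt_const _ _
      · have hcos : 0 < Real.cos θ := Real.cos_pos_of_mem_Ioo ⟨by linarith [hθ.1], hθ.2⟩
        have hcos1 : Real.cos θ < 1 := by
          rw [← Real.cos_zero]
          exact Real.cos_lt_cos_of_nonneg_of_le_pi_div_two le_rfl hθ.2.le hθ.1
        have := (hd (r * Real.cos θ) ⟨mul_pos h hcos,
          mul_lt_one_of_nonneg_of_lt_one_right hr.2 hcos.le hcos1⟩).comp θ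
          ((Real.hasDerivAt_cos θ).const_mul r)
        refine this.congr_deriv ?_
        ring
    refine (hd1.fun_mul (hv θ)).congr_deriv ?_
    ring

/-- The dimension shift: the function `((n - 1) G + t G') / 2π` on the sphere of `ℝⁿ⁺²` has the
same Radon transform as the function `G` on the sphere of `ℝⁿ`. -/
theorem zonalRadon_add_two {n : ℕ} (hn : 3 ≤ n) {G G' : ℝ → ℝ} (hG : ContinuousOn G (Icc 0 1))
    (hG' : ContinuousOn G' (Icc 0 1)) (hd : ∀ t ∈ Ioo (0 : ℝ) 1, HasDerivAt G (G' t) t)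
    {r : ℝ} (hr : r ∈ Icc (0 : ℝ) 1) :
    zonalRadon (n + 2)
      (fun t => (2 * Real.pi)⁻¹ * (((n : ℝ) - 1) * G |t| + |t| * G' |t|)) r =
      zonalRadon n (fun t => G |t|) r := by
  obtain ⟨k, rfl⟩ : ∃ k, n = k + 3 := ⟨_, (Nat.sub_add_cancel hn).symm⟩
  have hpi : (0 : ℝ) ≤ Real.pi / 2 := by positivity
  have hmaps1 : MapsTo (fun t : ℝ => r * t) (Icc 0 1) (Icc 0 1) := fun t ht =>
    ⟨mul_nonneg hr.1 ht.1, mul_le_one₀ hr.2 ht.1 ht.2⟩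
  have hmaps : MapsTo Real.cos (Icc 0 (Real.pi / 2)) (Icc 0 1) := fun θ hθ =>
    ⟨Real.cos_nonneg_of_mem_Icc ⟨by linarith [hθ.1], hθ.2⟩, Real.cos_le_one θ⟩
  have hGr : ContinuousOn (fun t => G (r * t)) (Icc 0 1) := hG.comp (by fun_prop) hmaps1
  have hGr' : ContinuousOn (fun t => G' (r * t)) (Icc 0 1) := hG'.comp (by fun_prop) hmaps1
  have hcG : ContinuousOn (fun θ => G (r * Real.cos θ)) (Icc 0 (Real.pi / 2)) :=
    hGr.comp (by fun_prop) hmaps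
  have hcG' : ContinuousOn (fun θ => G' (r * Real.cos θ)) (Icc 0 (Real.pi / 2)) :=
    hGr'.comp (by fun_prop) hmaps
  have habs : ∀ θ, |r * Real.cos θ| = r * |Real.cos θ| := fun θ => by
    rw [abs_mul, abs_of_nonneg hr.1]
  have hL := integral_abs_cos_mul_sin_pow (g := fun t => (2 * Real.pi)⁻¹ *
    (((k : ℝ) + 2) * G (r * t) + (r * t) * G' (r * t))) (by fun_prop) (k + 2)
  have hRt := integral_abs_cos_mul_sin_pow (g := fun t => G (r * t)) hGr k
  have hparts := integral_deriv_comp_cos hG hG' hd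
    (v := fun θ => Real.cos θ * Real.sin θ ^ (k + 1))
    (v' := fun θ => -Real.sin θ * Real.sin θ ^ (k + 1) +
      Real.cos θ * (((k : ℝ) + 1) * Real.sin θ ^ k * Real.cos θ)) (fun θ => by
        have := (Real.hasDerivAt_cos θ).fun_mul ((Real.hasDerivAt_sin θ).fun_pow (k + 1))
        simpa using this) (by fun_prop) (by simp) (by simp) hr
  have hS : sphereArea (k + 3) = (2 * Real.pi) * sphereArea (k + 1) / ((k : ℝ) + 1) := by
    have := sphereArea_add_two (k := k + 1) (by omega)
    push_cast at this
    rw [eq_div_iff (by positivity), ← this]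
    ring
  have hi : ∀ w : ℝ → ℝ, Continuous w → IntervalIntegrable (fun θ => G (r * Real.cos θ) * w θ)
      volume 0 (Real.pi / 2) := fun w hw =>
    (hcG.mul hw.continuousOn).intervalIntegrable_of_Icc hpi
  have hi' : ∀ w : ℝ → ℝ, Continuous w → IntervalIntegrable
      (fun θ => r * G' (r * Real.cos θ) * w θ) volume 0 (Real.pi / 2) := fun w hw =>
    ((continuousOn_const.mul hcG').mul hw.continuousOn).intervalIntegrable_of_Icc hpi
  have hsplit : ∫ θ in (0 : ℝ)..(Real.pi / 2), (2 * Real.pi)⁻¹ * (((k : ℝ) + 2) *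
      G (r * Real.cos θ) + (r * Real.cos θ) * G' (r * Real.cos θ)) * Real.sin θ ^ (k + 2) =
      (2 * Real.pi)⁻¹ * (((k : ℝ) + 1) *
        ∫ θ in (0 : ℝ)..(Real.pi / 2), G (r * Real.cos θ) * Real.sin θ ^ k) := by
    have h1 : ∀ θ, (2 * Real.pi)⁻¹ * (((k : ℝ) + 2) *
      G (r * Real.cos θ) + (r * Real.cos θ) * G' (r * Real.cos θ)) * Real.sin θ ^ (k + 2) =
      (2 * Real.pi)⁻¹ * (G (r * Real.cos θ) * (((k : ℝ) + 2) * Real.sin θ ^ (k + 2)) +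
        r * G' (r * Real.cos θ) * (Real.sin θ * (Real.cos θ * Real.sin θ ^ (k + 1)))) := by
      intro θ; ring
    simp_rw [h1]
    rw [intervalIntegral.integral_const_mul, intervalIntegral.integral_add
      (hi _ (by fun_prop)) (hi' _ (by fun_prop)), hparts, ← intervalIntegral.integral_add
      (hi _ (by fun_prop)) (hi _ (by fun_prop))]
    congr 1
    rw [← intervalIntegral.integral_const_mul]
    refine intervalIntegral.integral_congr fun θ _ => ?_
    have := Real.sin_sq_add_cos_sq θ
    have h2 : Real.cos θ ^ 2 = 1 - Real.sin θ ^ 2 := by linarith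
    ring_nf
    rw [h2]
    ring
  unfold zonalRadon
  simp only [habs, Nat.add_sub_cancel, show k + 3 + 2 - 3 = k + 2 by omega,
    show k + 3 - 2 = k + 1 by omega]
  have hcast : ((k + 3 : ℕ) : ℝ) - 1 = (k : ℝ) + 2 := by push_cast; ring
  rw [hcast, hL, hRt, hsplit, hS]
  field_simp

/-! ### Bodies of revolution as star bodies -/

section

variable {n : ℕ}

lemma abs_height_sphere_mem (hn : 1 ≤ n) (u : sphere (0 : EuclideanSpace ℝ (Fin n)) 1) :
    |height (u : EuclideanSpace ℝ (Fin n))| ∈ Icc (0 : ℝ) 1 :=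
  ⟨abs_nonneg _, by simpa [sphere_norm u] using abs_height_le hn u⟩

/-- A continuous profile that is not identically zero defines a star body. It may vanish in some
directions, so interior points have to be found in a direction where it is positive. -/
theorem isStarBody_bodyOfRevolution (hn : 2 ≤ n) {ρ : ℝ → ℝ}
    (hρ : ∀ φ ∈ Icc (0 : ℝ) (Real.pi / 2), 0 ≤ ρ φ)
    (hc : ContinuousOn ρ (Icc 0 (Real.pi / 2))) (hpos : ∃ φ ∈ Icc (0 : ℝ) (Real.pi / 2), 0 < ρ φ) :
    IsStarBody (bodyOfRevolution n ρ) := by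
  set R : sphere (0 : EuclideanSpace ℝ (Fin n)) 1 → ℝ := fun u =>
    ρ (Real.arccos |height (u : EuclideanSpace ℝ (Fin n))|) with hR
  have hR0 : ∀ u, 0 ≤ R u := fun u =>
    hρ _ ⟨Real.arccos_nonneg _, Real.arccos_le_pi_div_two.2 (abs_nonneg _)⟩
  have hRc : Continuous R := hc.comp_continuous (Real.continuous_arccos.comp
    (continuous_abs.comp (continuous_height.comp continuous_subtype_val))) fun u =>
      ⟨Real.arccos_nonneg _, Real.arccos_le_pi_div_two.2 (abs_nonneg _)⟩
  have hmem : ∀ (u : sphere (0 : EuclideanSpace ℝ (Fin n)) 1) (a : ℝ),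
      a • (u : EuclideanSpace ℝ (Fin n)) ∈ bodyOfRevolution n ρ ↔ |a| ≤ R u :=
    smul_mem_bodyOfRevolution hρ
  have u₀ : sphere (0 : EuclideanSpace ℝ (Fin n)) 1 := meridianPt hn 0
  have hzero : (0 : EuclideanSpace ℝ (Fin n)) ∈ bodyOfRevolution n ρ := by
    have := (hmem u₀ 0).2 (by simpa using hR0 u₀)
    rwa [zero_smul] at this
  refine ⟨?_, ?_, ?_, ?_⟩
  · -- the body is the continuous image of a product of the sphere with a segment
    have himg : bodyOfRevolution n ρ = (fun p : sphere (0 : EuclideanSpace ℝ (Fin n)) 1 × ℝ =>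
        (p.2 * R p.1) • (p.1 : EuclideanSpace ℝ (Fin n))) '' (univ ×ˢ Icc 0 1) := by
      ext x
      constructor
      · intro hx
        by_cases h0 : x = 0
        · exact ⟨(u₀, 0), ⟨mem_univ _, by simp⟩, by simp [h0]⟩
        · obtain ⟨u, hu⟩ := exists_eq_norm_smul h0
          have hxp : 0 < ‖x‖ := norm_pos_iff.2 h0
          have h1 : ‖x‖ ≤ R u := by
            rw [hu] at hx
            simpa using (hmem u _).1 hx
          have h2 : 0 < R u := hxp.trans_le h1
          refine ⟨(u, ‖x‖ / R u), ⟨mem_univ _, by positivity, div_le_one_of_le₀ h1 h2.le⟩, ?_⟩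
          simp only
          rw [div_mul_cancel₀ _ h2.ne', ← hu]
      · rintro ⟨⟨u, s⟩, ⟨-, hs⟩, rfl⟩
        refine (hmem u _).2 ?_
        rw [abs_of_nonneg (mul_nonneg hs.1 (hR0 u))]
        exact mul_le_of_le_one_left (hR0 u) hs.2
    rw [himg]
    exact (isCompact_univ.prod isCompact_Icc).image (by fun_prop)
  · obtain ⟨φ, hφ, hφpos⟩ := hpos
    have hcont : ContinuousOn (fun x : EuclideanSpace ℝ (Fin n) =>
        ρ (Real.arccos (|height x| / ‖x‖)) - ‖x‖) {0}ᶜ := by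
      refine ContinuousOn.sub (hc.comp ?_ fun x _ => arccos_abs_div_mem x) (by fun_prop)
      refine Real.continuous_arccos.comp_continuousOn ?_
      exact ContinuousOn.div (by fun_prop) (by fun_prop) fun x hx => norm_ne_zero_iff.2 hx
    have hopen := hcont.isOpen_inter_preimage isOpen_compl_singleton (isOpen_Ioi (a := (0 : ℝ)))
    refine ⟨(ρ φ / 2) • meridian n φ, mem_interior.2 ⟨_, fun x hx => ?_, hopen, ?_, ?_⟩⟩
    · have : 0 < ρ (Real.arccos (|height x| / ‖x‖)) - ‖x‖ := hx.2
      exact (sub_pos.1 this).le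
    · rw [mem_compl_iff, mem_singleton_iff, ← norm_eq_zero, norm_smul, norm_meridian hn]
      simp [hφpos.ne']
    · have h1 : ‖(ρ φ / 2) • meridian n φ‖ = ρ φ / 2 := by
        rw [norm_smul, norm_meridian hn, mul_one, Real.norm_of_nonneg (by positivity)]
      have h2 : |height ((ρ φ / 2) • meridian n φ)| / ‖(ρ φ / 2) • meridian n φ‖ = Real.cos φ := by
        rw [h1, height_smul, height_meridian hn, abs_mul, abs_of_pos (by positivity : 0 < ρ φ / 2),
          mul_div_cancel_left₀ _ (by positivity : ρ φ / 2 ≠ 0), abs_of_nonneg]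
        exact Real.cos_nonneg_of_mem_Icc ⟨by linarith [hφ.1, Real.pi_pos], hφ.2⟩
      rw [mem_preimage, h2, h1, Real.arccos_cos hφ.1 (by linarith [hφ.2, Real.pi_pos]), mem_Ioi]
      linarith
  · rw [starConvex_zero_iff]
    intro x hx a ha0 ha1
    rcases ha0.eq_or_lt with rfl | ha
    · rwa [zero_smul]
    · rw [bodyOfRevolution, mem_ofPred_eq] at *
      rw [height_smul, norm_smul, abs_mul, Real.norm_eq_abs,
        mul_div_mul_left _ _ (abs_ne_zero.2 ha.ne'), abs_of_pos ha]
      exact (mul_le_of_le_one_left (norm_nonneg _) ha1).trans hx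
  · simp_rw [radial_bodyOfRevolution hρ]
    exact hRc

lemma IsStarBody.exists_radial_pos (hn : 1 ≤ n) {K : Set (EuclideanSpace ℝ (Fin n))}
    (hK : IsStarBody K) : ∃ u : sphere (0 : EuclideanSpace ℝ (Fin n)) 1, 0 < radial K u := by
  have : Nontrivial (EuclideanSpace ℝ (Fin n)) :=
    Module.nontrivial_of_finrank_pos (R := ℝ) (by rw [finrank_euclideanSpace_fin]; omega)
  by_contra! h
  have hsub : K ⊆ {0} := by
    intro x hx
    by_contra h0
    obtain ⟨u, hu⟩ := exists_eq_norm_smul h0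
    rw [hu, hK.smul_mem_iff u (norm_nonneg _)] at hx
    exact h0 (norm_le_zero_iff.1 (hx.trans (h u)))
  have := hK.nonempty_interior.mono (interior_mono hsub)
  rw [interior_singleton] at this
  exact not_nonempty_empty this

/-- Whether a body of revolution is a star body does not depend on the dimension. -/
theorem IsStarBody.bodyOfRevolution_change_dim (hn : 2 ≤ n) {ρ : ℝ → ℝ}
    (hρ : ∀ φ ∈ Icc (0 : ℝ) (Real.pi / 2), 0 ≤ ρ φ) (hK : IsStarBody (bodyOfRevolution n ρ))
    {m : ℕ} (hm : 2 ≤ m) : IsStarBody (bodyOfRevolution m ρ) := by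
  refine isStarBody_bodyOfRevolution hm hρ ?_ ?_
  · have h : Continuous fun φ => radial (bodyOfRevolution n ρ) (meridianPt hn φ) :=
      hK.continuous_radial.comp (continuous_meridianPt hn)
    refine h.continuousOn.congr fun φ hφ => ?_
    have h1 : height (meridianPt hn φ : EuclideanSpace ℝ (Fin n)) = Real.cos φ :=
      height_meridian hn φ
    change ρ φ = radial (bodyOfRevolution n ρ) (meridianPt hn φ)
    rw [radial_bodyOfRevolution hρ, h1, abs_of_nonneg, Real.arccos_cos hφ.1
      (by linarith [hφ.2, Real.pi_pos])]
    exact Real.cos_nonneg_of_mem_Icc ⟨by linarith [hφ.1, Real.pi_pos], hφ.2⟩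
  · obtain ⟨u, hu⟩ := hK.exists_radial_pos (by omega)
    rw [radial_bodyOfRevolution hρ] at hu
    exact ⟨_, ⟨Real.arccos_nonneg _, Real.arccos_le_pi_div_two.2 (abs_nonneg _)⟩, hu⟩

/-! ### Equator-convexity -/

section

variable {L : Set (EuclideanSpace ℝ (Fin n))} {f : ℝ → ℝ}

lemma IsStarBody.mem_iff_of_revolution (hL : IsStarBody L)
    (hf : ∀ u : sphere (0 : EuclideanSpace ℝ (Fin n)) 1,
      radial L u = f |height (u : EuclideanSpace ℝ (Fin n))|)
    {x : EuclideanSpace ℝ (Fin n)} (hx : x ≠ 0) : x ∈ L ↔ ‖x‖ ≤ f (|height x| / ‖x‖) := by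
  obtain ⟨u, hu⟩ := exists_eq_norm_smul hx
  have hx' : ‖x‖ ≠ 0 := norm_ne_zero_iff.2 hx
  have h1 : |height x| / ‖x‖ = |height (u : EuclideanSpace ℝ (Fin n))| := by
    conv_lhs => rw [hu]
    rw [height_smul, abs_mul, norm_smul, sphere_norm u, mul_one, norm_norm, abs_norm,
      mul_div_cancel_left₀ _ hx']
  rw [h1, ← hf u, ← hL.smul_mem_iff u (norm_nonneg x), ← hu]

/-- If `t f(t)` is nondecreasing, then a body of revolution with profile `f` is
equator-convex: every nonempty horizontal section is a closed ball centred on the axis. -/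
theorem equatorConvex_of_monotoneOn (hn : 1 ≤ n) (hL : IsStarBody L)
    (hf : ∀ u : sphere (0 : EuclideanSpace ℝ (Fin n)) 1,
      radial L u = f |height (u : EuclideanSpace ℝ (Fin n))|)
    (hmono : MonotoneOn (fun t => t * f t) (Icc 0 1)) : EquatorConvex L := by
  -- on a fixed level `|height| = c`, the parameter `t = c / ‖z‖` grows as `z` approaches the axis,
  -- and membership in `L` means `c ≤ t f(t)`
  have key : ∀ x z : EuclideanSpace ℝ (Fin n), x ∈ L → height x = height z → ‖z‖ ≤ ‖x‖ →
      z ∈ L := by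
    intro x z hx hxz hle
    by_cases hz0 : z = 0
    · rw [hz0]; exact hL.zero_mem
    have hzpos : 0 < ‖z‖ := norm_pos_iff.2 hz0
    have hxpos : 0 < ‖x‖ := hzpos.trans_le hle
    rw [hL.mem_iff_of_revolution hf hz0]
    rw [hL.mem_iff_of_revolution hf (norm_pos_iff.1 hxpos), hxz] at hx
    rcases (abs_nonneg (height z)).eq_or_lt with hc | hc
    · rw [← hc, zero_div] at hx ⊢
      exact hle.trans hx
    · have hz1 : |height z| / ‖z‖ ≤ 1 := div_le_one_of_le₀ (abs_height_le hn z) hzpos.le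
      have h12 : |height z| / ‖x‖ ≤ |height z| / ‖z‖ := by gcongr
      have h := hmono ⟨by positivity, h12.trans hz1⟩ ⟨by positivity, hz1⟩ h12
      have h1 : |height z| ≤ |height z| / ‖x‖ * f (|height z| / ‖x‖) := by
        calc |height z| = |height z| / ‖x‖ * ‖x‖ := by field_simp
          _ ≤ _ := by gcongr
      have h2 : |height z| ≤ |height z| / ‖z‖ * f (|height z| / ‖z‖) := h1.trans h
      rw [div_mul_eq_mul_div, le_div_iff₀ hzpos] at h2
      exact le_of_mul_le_mul_left h2 hc
  intro c x hx y hy a b ha hb hab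
  have hx2 : height x = c := hx.2
  have hy2 : height y = c := hy.2
  have hz : height (a • x + b • y) = c := by
    rw [height_add, height_smul, height_smul, hx2, hy2, ← add_mul, hab, one_mul]
  refine ⟨?_, hz⟩
  rcases le_total ‖x‖ ‖y‖ with h | h
  · refine key y _ hy.1 (by rw [hz, hy2]) ?_
    calc ‖a • x + b • y‖ ≤ a * ‖x‖ + b * ‖y‖ := by
          refine (norm_add_le _ _).trans_eq ?_
          rw [norm_smul, norm_smul, Real.norm_of_nonneg ha, Real.norm_of_nonneg hb]
      _ ≤ a * ‖y‖ + b * ‖y‖ := by gcongr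
      _ = ‖y‖ := by rw [← add_mul, hab, one_mul]
  · refine key x _ hx.1 (by rw [hz, hx2]) ?_
    calc ‖a • x + b • y‖ ≤ a * ‖x‖ + b * ‖y‖ := by
          refine (norm_add_le _ _).trans_eq ?_
          rw [norm_smul, norm_smul, Real.norm_of_nonneg ha, Real.norm_of_nonneg hb]
      _ ≤ a * ‖x‖ + b * ‖x‖ := by gcongr
      _ = ‖x‖ := by rw [← add_mul, hab, one_mul]

/-- The profile `f` of an equator-convex body of revolution makes `t f(t)` nondecreasing: the
boundary points in the directions of parameter `s`, and the segment between them, lie at height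
`s f(s)`, and for `t > s` this segment meets the ray of parameter `t`. -/
theorem EquatorConvex.monotoneOn (hn : 2 ≤ n) (hL : IsStarBody L)
    (hf : ∀ u : sphere (0 : EuclideanSpace ℝ (Fin n)) 1,
      radial L u = f |height (u : EuclideanSpace ℝ (Fin n))|)
    (hconv : EquatorConvex L) : MonotoneOn (fun t => t * f t) (Icc 0 1) := by
  have hfm : ∀ ψ, radial L (meridianPt hn ψ) = f |Real.cos ψ| := fun ψ => by
    rw [hf]; exact congrArg (fun s => f |s|) (height_meridian hn ψ)
  have hfm' : ∀ t ∈ Icc (0 : ℝ) 1, radial L (meridianPt hn (Real.arccos t)) = f t := by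
    intro t ht
    rw [hfm, Real.cos_arccos (by linarith [ht.1]) ht.2, abs_of_nonneg ht.1]
  have hf0 : ∀ t ∈ Icc (0 : ℝ) 1, 0 ≤ f t := fun t ht => by
    rw [← hfm' t ht]; exact hL.radial_nonneg _
  intro s hs t ht hst
  simp only
  rcases hst.eq_or_lt with rfl | hst
  · exact le_rfl
  rcases hs.1.eq_or_lt with rfl | hs0
  · rw [zero_mul]; exact mul_nonneg ht.1 (hf0 t ht)
  rcases (hf0 s hs).eq_or_lt with h0 | hfs
  · rw [← h0, mul_zero]; exact mul_nonneg ht.1 (hf0 t ht)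
  have ht0 : 0 < t := hs0.trans hst
  set c := s * f s with hc
  have hcpos : 0 < c := mul_pos hs0 hfs
  -- the two boundary points in the plane of the meridian at height `c` with parameter `s`
  have hx : f s • meridian n (Real.arccos s) ∈ L := by
    have := (hL.smul_mem_iff (meridianPt hn (Real.arccos s)) hfs.le).2 (hfm' s hs).ge
    exact this
  have hx' : f s • meridian n (-Real.arccos s) ∈ L := by
    refine (hL.smul_mem_iff (meridianPt hn (-Real.arccos s)) hfs.le).2 ?_
    rw [hfm, Real.cos_neg, ← hfm, hfm' s hs]
  have hcoss : Real.cos (Real.arccos s) = s := Real.cos_arccos (by linarith) hs.2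
  have hcost : Real.cos (Real.arccos t) = t := Real.cos_arccos (by linarith) ht.2
  have hxc : height (f s • meridian n (Real.arccos s)) = c := by
    rw [height_smul, height_meridian hn, hcoss, hc, mul_comm]
  have hxc' : height (f s • meridian n (-Real.arccos s)) = c := by
    rw [height_smul, height_meridian hn, Real.cos_neg, hcoss, hc, mul_comm]
  -- the distances from the axis, at height `c`, of these points and of the ray of parameter `t`
  set A := f s * √(1 - s ^ 2) with hA
  set B := c / t * √(1 - t ^ 2) with hB
  have hs1 : 0 < 1 - s ^ 2 := by nlinarith [ht.2]
  have hApos : 0 < A := mul_pos hfs (Real.sqrt_pos.2 hs1)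
  have hB0 : 0 ≤ B := by positivity
  have hBA : B ≤ A := by
    have h1 : √(1 - t ^ 2) ≤ √(1 - s ^ 2) := Real.sqrt_le_sqrt (by nlinarith)
    have h2 : c / t ≤ f s := by
      rw [div_le_iff₀ ht0, hc, mul_comm]
      gcongr
    exact mul_le_mul h2 h1 (Real.sqrt_nonneg _) hfs.le
  have hBA1 : B / A ≤ 1 := div_le_one_of_le₀ hBA hApos.le
  have hBA0 : 0 ≤ B / A := by positivity
  have hz := (hconv c ⟨hx, hxc⟩ ⟨hx', hxc'⟩ (a := (1 + B / A) / 2) (b := (1 - B / A) / 2)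
    (by linarith) (by linarith) (by ring)).1
  have hz' : ((1 + B / A) / 2) • f s • meridian n (Real.arccos s) +
      ((1 - B / A) / 2) • f s • meridian n (-Real.arccos s) =
      (c / t) • meridian n (Real.arccos t) := by
    simp only [meridian, Real.cos_neg, Real.sin_neg, hcoss, hcost, Real.sin_arccos, smul_add,
      smul_smul, neg_smul, smul_neg]
    have e1 : (1 + B / A) / 2 * (f s * s) + (1 - B / A) / 2 * (f s * s) = c / t * t := by
      rw [div_mul_cancel₀ _ ht0.ne', hc]; ring
    have e2 : (1 + B / A) / 2 * (f s * √(1 - s ^ 2)) - (1 - B / A) / 2 * (f s * √(1 - s ^ 2)) =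
        c / t * √(1 - t ^ 2) := by
      rw [← hA, ← hB]; field_simp; ring
    rw [← e1, ← e2, add_smul, sub_smul]
    abel
  rw [hz'] at hz
  have hfin := (hL.smul_mem_iff (meridianPt hn (Real.arccos t)) (by positivity)).1 hz
  rw [hfm' t ht, div_le_iff₀ ht0] at hfin
  linarith

end

end

/-! ### The inverse Radon transform in dimension `n + 2` -/

lemma zonalRadon_const_mul (N : ℕ) (c : ℝ) (Φ : ℝ → ℝ) (r : ℝ) :
    zonalRadon N (fun t => c * Φ t) r = c * zonalRadon N Φ r := by
  simp only [zonalRadon, mul_assoc, intervalIntegral.integral_const_mul]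
  ring

lemma sqrt_one_sub_sq_mem (t : ℝ) : √(1 - t ^ 2) ∈ Icc (0 : ℝ) 1 :=
  ⟨Real.sqrt_nonneg _, Real.sqrt_le_one.2 (by linarith [sq_nonneg t])⟩

lemma continuousOn_inverseProfile {n : ℕ} {f : ℝ → ℝ} (hf : ContDiffOn ℝ 1 f (Icc 0 1)) :
    ContinuousOn (inverseProfile n f) (Icc 0 1) := by
  have h1 := hf.continuousOn
  have h2 := hf.continuousOn_derivWithin (uniqueDiffOn_Icc zero_lt_one) le_rfl
  unfold inverseProfile
  fun_prop

section

variable {n : ℕ} {ρ : ℝ → ℝ} {L : Set (EuclideanSpace ℝ (Fin n))}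

/-- The radial function of the body of revolution in `ℝⁿ⁺²`, in terms of the profile of `L`. -/
lemma IsIntersectionBodyOf.radial_add_two (hn : 3 ≤ n)
    (hρ : ∀ φ ∈ Icc (0 : ℝ) (Real.pi / 2), 0 ≤ ρ φ)
    (hKL : IsIntersectionBodyOf (bodyOfRevolution n ρ) L)
    (ξ : sphere (0 : EuclideanSpace ℝ (Fin (n + 2))) 1) :
    radial (bodyOfRevolution (n + 2) ρ) ξ = ((n : ℝ) - 1)⁻¹ *
      zonalRadon n (fun s => axialProfile L |s| ^ (n - 1))
        (√(1 - height (ξ : EuclideanSpace ℝ (Fin (n + 2))) ^ 2)) := by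
  rw [radial_bodyOfRevolution hρ, hKL.profile_eq hn hρ]
  rw [mem_Icc, ← abs_le]
  exact (abs_height_sphere_mem (by omega) ξ).2

theorem IsIntersectionBodyOf.radonTransform_inverseProfile (hn : 3 ≤ n)
    (hρ : ∀ φ ∈ Icc (0 : ℝ) (Real.pi / 2), 0 ≤ ρ φ)
    (hKL : IsIntersectionBodyOf (bodyOfRevolution n ρ) L)
    (hf : ContDiffOn ℝ 1 (axialProfile L) (Icc 0 1))
    (ξ : sphere (0 : EuclideanSpace ℝ (Fin (n + 2))) 1) :
    radonTransform (fun θ : sphere (0 : EuclideanSpace ℝ (Fin (n + 2))) 1 =>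
      inverseProfile n (axialProfile L) |height (θ : EuclideanSpace ℝ (Fin (n + 2)))|) ξ =
      radial (bodyOfRevolution (n + 2) ρ) ξ := by
  set f := axialProfile L with hfdef
  set f' := derivWithin f (Icc 0 1) with hf'
  have hc := hf.continuousOn
  have hc' : ContinuousOn f' (Icc 0 1) :=
    hf.continuousOn_derivWithin (uniqueDiffOn_Icc zero_lt_one) le_rfl
  have hd : ∀ t ∈ Ioo (0 : ℝ) 1, HasDerivAt (fun t => f t ^ (n - 1))
      (((n : ℝ) - 1) * f t ^ (n - 2) * f' t) t := by
    intro t ht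
    have h1 : HasDerivAt f (f' t) t :=
      ((hf.differentiableOn one_ne_zero t (Ioo_subset_Icc_self ht)).hasDerivWithinAt).hasDerivAt
        (Icc_mem_nhds ht.1 ht.2)
    have h2 := h1.fun_pow (n - 1)
    rwa [Nat.cast_sub (by omega), Nat.cast_one, show n - 1 - 1 = n - 2 by omega] at h2
  have hn1 : ((n : ℝ) - 1) ≠ 0 := by
    have : (3 : ℝ) ≤ n := by exact_mod_cast hn
    linarith
  rw [radonTransform_height (by omega) (Φ := fun t => inverseProfile n f |t|), hKL.radial_add_two hn hρ,
    ← zonalRadon_add_two hn (G := fun t => f t ^ (n - 1))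
      (G' := fun t => ((n : ℝ) - 1) * f t ^ (n - 2) * f' t) (by fun_prop) (by fun_prop) hd
      (sqrt_one_sub_sq_mem _), ← zonalRadon_const_mul]
  · congr 1
    funext t
    have : f |t| ^ (n - 1) = f |t| ^ (n - 2) * f |t| := by rw [← pow_succ]; congr 1; omega
    rw [inverseProfile, this, ← hf']
    field_simp
  · refine (continuousOn_inverseProfile hf).comp (by fun_prop) fun t ht => ?_
    exact ⟨abs_nonneg t, abs_le.2 ht⟩

theorem IsIntersectionBodyOf.isInverseRadonTransform (hn : 3 ≤ n)
    (hρ : ∀ φ ∈ Icc (0 : ℝ) (Real.pi / 2), 0 ≤ ρ φ)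
    (hKL : IsIntersectionBodyOf (bodyOfRevolution n ρ) L)
    (hf : ContDiffOn ℝ 1 (axialProfile L) (Icc 0 1)) :
    IsInverseRadonTransform
      (fun ξ : sphere (0 : EuclideanSpace ℝ (Fin (n + 2))) 1 =>
        radial (bodyOfRevolution (n + 2) ρ) (ξ : EuclideanSpace ℝ (Fin (n + 2))))
      (fun θ => inverseProfile n (axialProfile L)
        |height (θ : EuclideanSpace ℝ (Fin (n + 2)))|) := by
  have hcont : Continuous fun θ : sphere (0 : EuclideanSpace ℝ (Fin (n + 2))) 1 =>
      inverseProfile n (axialProfile L) |height (θ : EuclideanSpace ℝ (Fin (n + 2)))| :=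
    (continuousOn_inverseProfile hf).comp_continuous (by fun_prop)
      fun u => abs_height_sphere_mem (by omega) u
  have heven : ∀ θ : sphere (0 : EuclideanSpace ℝ (Fin (n + 2))) 1,
      inverseProfile n (axialProfile L)
        |height ((-θ : sphere (0 : EuclideanSpace ℝ (Fin (n + 2))) 1) :
          EuclideanSpace ℝ (Fin (n + 2)))| =
      inverseProfile n (axialProfile L) |height (θ : EuclideanSpace ℝ (Fin (n + 2)))| := by
    intro θ
    have : height ((-θ : sphere (0 : EuclideanSpace ℝ (Fin (n + 2))) 1) :
        EuclideanSpace ℝ (Fin (n + 2))) = -height (θ : EuclideanSpace ℝ (Fin (n + 2))) :=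
      height_neg _
    rw [this, abs_neg]
  refine ⟨⟨hcont, heven, hKL.radonTransform_inverseProfile hn hρ hf⟩, fun h' hc' he' hR' => ?_⟩
  refine radonTransform_injective (by omega) hc' hcont he' heven fun ξ => ?_
  rw [hR', hKL.radonTransform_inverseProfile hn hρ hf]

lemma inverseProfile_nonneg {f : ℝ → ℝ} (hf : ContDiffOn ℝ 1 f (Icc 0 1))
    (hf0 : ∀ t, 0 ≤ f t) (hmono : MonotoneOn (fun t => t * f t) (Icc 0 1)) {t : ℝ}
    (ht : t ∈ Icc (0 : ℝ) 1) : 0 ≤ inverseProfile n f t := by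
  have h1 : HasDerivWithinAt (fun t => t * f t) (1 * f t + t * derivWithin f (Icc 0 1) t)
      (Icc 0 1) t :=
    (hasDerivWithinAt_id t _).fun_mul
      (hf.differentiableOn one_ne_zero t ht).hasDerivWithinAt
  have h2 : 0 ≤ 1 * f t + t * derivWithin f (Icc 0 1) t := by
    rw [← h1.derivWithin (uniqueDiffOn_Icc zero_lt_one t ht)]
    exact hmono.derivWithin_nonneg
  rw [one_mul] at h2
  have := Real.pi_pos
  have := hf0 t
  unfold inverseProfile
  positivity

/-- If `L` is equator-convex, then the inverse Radon transform of the radial function is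
nonnegative, so that the `(n + 1)`-st root of `n + 1` times it is the radial function of a body of
revolution, whose intersection body is the given one. -/
theorem IsIntersectionBodyOf.exists_isIntersectionBodyOf (hn : 3 ≤ n)
    (hρ : ∀ φ ∈ Icc (0 : ℝ) (Real.pi / 2), 0 ≤ ρ φ)
    (hKL : IsIntersectionBodyOf (bodyOfRevolution n ρ) L) (hconv : EquatorConvex L)
    (hf : ContDiffOn ℝ 1 (axialProfile L) (Icc 0 1)) :
    ∃ M : Set (EuclideanSpace ℝ (Fin (n + 2))),
      IsIntersectionBodyOf (bodyOfRevolution (n + 2) ρ) M := by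
  have hL := hKL.isStarBody'
  have hmono := EquatorConvex.monotoneOn (by omega) hL (hKL.radial_eq_axialProfile hn hρ) hconv
  have hnonneg : ∀ t ∈ Icc (0 : ℝ) 1, 0 ≤ inverseProfile n (axialProfile L) t := fun t ht =>
    inverseProfile_nonneg hf (axialProfile_nonneg (by omega) hL) hmono ht
  have hn1 : (0 : ℝ) < (n : ℝ) + 1 := by positivity
  have hcos : ∀ φ ∈ Icc (0 : ℝ) (Real.pi / 2), Real.cos φ ∈ Icc (0 : ℝ) 1 := fun φ hφ =>
    ⟨Real.cos_nonneg_of_mem_Icc ⟨by linarith [hφ.1, Real.pi_pos], hφ.2⟩, Real.cos_le_one φ⟩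
  set τ : ℝ → ℝ := fun φ =>
    (((n : ℝ) + 1) * inverseProfile n (axialProfile L) (Real.cos φ)) ^ ((n + 1 : ℕ) : ℝ)⁻¹ with hτ
  have hτ0 : ∀ φ ∈ Icc (0 : ℝ) (Real.pi / 2), 0 ≤ τ φ := fun φ hφ =>
    Real.rpow_nonneg (mul_nonneg hn1.le (hnonneg _ (hcos φ hφ))) _
  have hτc : ContinuousOn τ (Icc 0 (Real.pi / 2)) := by
    refine ContinuousOn.rpow_const (continuousOn_const.mul
      ((continuousOn_inverseProfile hf).comp Real.continuous_cos.continuousOn hcos)) fun φ _ => ?_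
    exact Or.inr (by positivity)
  have hτrad : ∀ u : sphere (0 : EuclideanSpace ℝ (Fin (n + 2))) 1,
      radial (bodyOfRevolution (n + 2) τ) u ^ (n + 1) = ((n : ℝ) + 1) *
        inverseProfile n (axialProfile L) |height (u : EuclideanSpace ℝ (Fin (n + 2)))| := by
    intro u
    have hu := abs_height_sphere_mem (by omega) u
    rw [radial_bodyOfRevolution hτ0, hτ]
    simp only
    rw [Real.cos_arccos (by linarith [hu.1]) hu.2,
      Real.rpow_inv_natCast_pow (mul_nonneg hn1.le (hnonneg _ hu)) (by omega)]
  have hRK := hKL.radonTransform_inverseProfile hn hρ hf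
  have hK2 := hKL.isStarBody.bodyOfRevolution_change_dim (by omega) hρ (m := n + 2) (by omega)
  -- the new body has interior points, since otherwise the radial function of `K` would vanish
  have hτpos : ∃ φ ∈ Icc (0 : ℝ) (Real.pi / 2), 0 < τ φ := by
    by_contra! hneg
    obtain ⟨ξ, hξ⟩ := hK2.exists_radial_pos (by omega)
    have hz : ∀ u : sphere (0 : EuclideanSpace ℝ (Fin (n + 2))) 1,
        inverseProfile n (axialProfile L) |height (u : EuclideanSpace ℝ (Fin (n + 2)))| = 0 := by
      intro u
      have h1 := hτrad u
      have hmem : Real.arccos |height (u : EuclideanSpace ℝ (Fin (n + 2)))| ∈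
          Icc (0 : ℝ) (Real.pi / 2) :=
        ⟨Real.arccos_nonneg _, Real.arccos_le_pi_div_two.2 (abs_nonneg _)⟩
      rw [radial_bodyOfRevolution hτ0, le_antisymm (hneg _ hmem) (hτ0 _ hmem),
        zero_pow (by omega)] at h1
      exact (mul_eq_zero.1 h1.symm).resolve_left hn1.ne'
    have h2 := hRK ξ
    simp_rw [hz] at h2
    rw [← h2] at hξ
    simp [radonTransform] at hξ
  have hM := isStarBody_bodyOfRevolution (n := n + 2) (by omega) hτ0 hτc hτpos
  refine ⟨bodyOfRevolution (n + 2) τ, hK2, isOriginSymmetric_bodyOfRevolution _, hM,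
    isOriginSymmetric_bodyOfRevolution _, fun ξ => ?_⟩
  rw [hM.sectionVolume_eq (by omega), ← hRK ξ]
  have h3 : n + 2 - 1 = n + 1 := by omega
  simp_rw [h3, hτrad]
  rw [radonTransform_const_mul]
  push_cast
  rw [show (n : ℝ) + 2 - 1 = n + 1 by ring, inv_mul_cancel_left₀ hn1.ne']

end

/-! ### Testing the measure of an intersection body against polynomials -/

lemma nonpos_of_forall_le_mul {x C : ℝ} (h : ∀ ε, 0 < ε → x ≤ C * ε) : x ≤ 0 := by
  have h1 : Tendsto (fun ε : ℝ => C * ε) (𝓝[>] 0) (𝓝 (C * 0)) :=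
    (Continuous.tendsto (by fun_prop) 0).mono_left nhdsWithin_le_nhds
  rw [mul_zero] at h1
  exact ge_of_tendsto h1 (eventually_nhdsWithin_of_forall fun ε hε => h ε hε)

/-- The weight `w` for which `∫ G(cos θ) w(θ) dθ` is, up to a constant, the integral over the sphere
of `ℝᵏ⁺⁵` of the function `(k + 2) G + t G'` times `q(t²)`; here `q'` stands for the derivative of
`q`. Integration by parts has moved the derivative from `G` to `q`. -/
def dualWeight (k : ℕ) (q q' : ℝ → ℝ) (θ : ℝ) : ℝ :=
  ((k : ℝ) + 2) * q (Real.cos θ ^ 2) * Real.sin θ ^ (k + 3) +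
    (-Real.sin θ * (q (Real.cos θ ^ 2) * Real.sin θ ^ (k + 2)) +
      Real.cos θ * (q' (Real.cos θ ^ 2) * (2 * Real.cos θ * -Real.sin θ) * Real.sin θ ^ (k + 2) +
        q (Real.cos θ ^ 2) * (((k : ℝ) + 2) * Real.sin θ ^ (k + 1) * Real.cos θ)))

lemma continuous_dualWeight (k : ℕ) {q q' : ℝ → ℝ} (hq : Continuous q) (hq' : Continuous q') :
    Continuous (dualWeight k q q') := by
  unfold dualWeight
  fun_prop

lemma hasDerivAt_cos_mul_comp_cos_sq (k : ℕ) {q q' : ℝ → ℝ} (hq : ∀ x, HasDerivAt q (q' x) x)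
    (θ : ℝ) :
    HasDerivAt (fun θ => Real.cos θ * (q (Real.cos θ ^ 2) * Real.sin θ ^ (k + 2)))
      (-Real.sin θ * (q (Real.cos θ ^ 2) * Real.sin θ ^ (k + 2)) +
      Real.cos θ * (q' (Real.cos θ ^ 2) * (2 * Real.cos θ * -Real.sin θ) * Real.sin θ ^ (k + 2) +
        q (Real.cos θ ^ 2) * (((k : ℝ) + 2) * Real.sin θ ^ (k + 1) * Real.cos θ))) θ := by
  have h1 : HasDerivAt (fun θ => Real.cos θ ^ 2) (2 * Real.cos θ * -Real.sin θ) θ := by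
    simpa using (Real.hasDerivAt_cos θ).fun_pow 2
  have h2 : HasDerivAt (fun θ => Real.sin θ ^ (k + 2))
      (((k : ℝ) + 2) * Real.sin θ ^ (k + 1) * Real.cos θ) θ := by
    simpa using (Real.hasDerivAt_sin θ).fun_pow (k + 2)
  exact (Real.hasDerivAt_cos θ).fun_mul (((hq (Real.cos θ ^ 2)).comp θ h1).fun_mul h2)

lemma continuous_zonalRadon (N : ℕ) {Φ : ℝ → ℝ} (hΦ : Continuous Φ) :
    Continuous (zonalRadon N Φ) :=
  continuous_const.mul (intervalIntegral.continuous_parametric_intervalIntegral_of_continuous'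
    (by unfold Function.uncurry; fun_prop) _ _)

lemma abs_zonalRadon_sub_le (N : ℕ) (hN : 3 ≤ N) {Φ Ψ : ℝ → ℝ} (hΦ : Continuous Φ)
    (hΨ : Continuous Ψ) {ε : ℝ} (h : ∀ t ∈ Icc (-1 : ℝ) 1, |Φ t - Ψ t| ≤ ε) {r : ℝ}
    (hr : r ∈ Icc (0 : ℝ) 1) :
    |zonalRadon N Φ r - zonalRadon N Ψ r| ≤ sphereArea (N - 2) * (ε * Real.pi) := by
  have hi : ∀ Θ : ℝ → ℝ, Continuous Θ → IntervalIntegrable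
      (fun θ => Θ (r * Real.cos θ) * Real.sin θ ^ (N - 3)) volume 0 Real.pi := fun Θ hΘ =>
    Continuous.intervalIntegrable (by fun_prop) _ _
  have hpos := sphereArea_pos (k := N - 2) (by omega)
  rw [zonalRadon, zonalRadon, ← mul_sub, abs_mul, abs_of_pos hpos,
    ← intervalIntegral.integral_sub (hi Φ hΦ) (hi Ψ hΨ)]
  gcongr
  have := intervalIntegral.norm_integral_le_of_norm_le_const (a := 0) (b := Real.pi) (C := ε)
    (f := fun θ => Φ (r * Real.cos θ) * Real.sin θ ^ (N - 3) -
      Ψ (r * Real.cos θ) * Real.sin θ ^ (N - 3)) fun θ _ => ?_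
  · rwa [sub_zero, abs_of_pos Real.pi_pos] at this
  · rw [← sub_mul, norm_mul, norm_pow]
    have h1 : |r * Real.cos θ| ≤ 1 := by
      rw [abs_mul, abs_of_nonneg hr.1]
      exact mul_le_one₀ hr.2 (abs_nonneg _) (Real.abs_cos_le_one θ)
    have h2 := h _ (abs_le.1 h1)
    have h3 : ‖Real.sin θ‖ ^ (N - 3) ≤ 1 := pow_le_one₀ (norm_nonneg _) (Real.abs_sin_le_one θ)
    exact (mul_le_of_le_one_right (abs_nonneg _) h3).trans h2

/-- For a polynomial `A` in `t²` the dimension shift and the self-adjointness of the Radon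
transform turn an integral against an even zonal polynomial `P` into an integral against its Radon
transform `Q`. -/
lemma integral_zonalRadon_polynomial (k : ℕ) {P Q A : Polynomial ℝ}
    (hPQ : ∀ ξ : sphere (0 : EuclideanSpace ℝ (Fin (k + 3 + 2))) 1,
      radonTransform (fun u => P.eval (height (u : EuclideanSpace ℝ (Fin (k + 3 + 2))) ^ 2)) ξ =
        Q.eval (height (ξ : EuclideanSpace ℝ (Fin (k + 3 + 2))) ^ 2)) :
    ∫ u : sphere (0 : EuclideanSpace ℝ (Fin (k + 3 + 2))) 1,
        P.eval (height (u : EuclideanSpace ℝ (Fin (k + 3 + 2))) ^ 2) *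
        zonalRadon (k + 3) (fun t => A.eval (|t| ^ 2))
          (√(1 - height (u : EuclideanSpace ℝ (Fin (k + 3 + 2))) ^ 2))
        ∂(volume : Measure (EuclideanSpace ℝ (Fin (k + 3 + 2)))).toSphere =
      (2 * Real.pi)⁻¹ * (sphereArea (k + 4) * (2 * ∫ θ in (0 : ℝ)..(Real.pi / 2),
        A.eval (Real.cos θ ^ 2) *
          dualWeight k (fun x => Q.eval x) (fun x => Q.derivative.eval x) θ)) := by
  set G : ℝ → ℝ := fun t => A.eval (t ^ 2) with hG
  set G' : ℝ → ℝ := fun t => A.derivative.eval (t ^ 2) * (2 * t) with hG'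
  have hd : ∀ t, HasDerivAt G (G' t) t := fun t => by
    have := (A.hasDerivAt (t ^ 2)).comp t (hasDerivAt_pow 2 t)
    exact this.congr_deriv (by simp [hG'])
  set H : ℝ → ℝ := fun t => (2 * Real.pi)⁻¹ * (((k : ℝ) + 2) * G t + t * G' t) with hH
  have hHc : Continuous H := by fun_prop
  have hcast : ((k + 3 : ℕ) : ℝ) - 1 = (k : ℝ) + 2 := by push_cast; ring
  have hshift : ∀ u : sphere (0 : EuclideanSpace ℝ (Fin (k + 3 + 2))) 1,
      zonalRadon (k + 3) (fun t => A.eval (|t| ^ 2))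
        (√(1 - height (u : EuclideanSpace ℝ (Fin (k + 3 + 2))) ^ 2)) =
      radonTransform (fun u => H |height (u : EuclideanSpace ℝ (Fin (k + 3 + 2)))|) u := by
    intro u
    rw [radonTransform_height (by omega) (Φ := fun t => H |t|) (by fun_prop)]
    have := zonalRadon_add_two (n := k + 3) (by omega) (G := G) (G' := G') (by fun_prop)
      (by fun_prop) (fun t _ => hd t)
      (sqrt_one_sub_sq_mem (height (u : EuclideanSpace ℝ (Fin (k + 3 + 2)))))
    rw [hcast] at this
    exact this.symm
  simp_rw [hshift]
  rw [integral_mul_radonTransform_comm (by omega) (by fun_prop) (by fun_prop)]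
  simp_rw [hPQ]
  have hz := integral_sphere_zonal (E := EuclideanSpace ℝ (Fin (k + 3 + 2)))
    (by rw [finrank_euclideanSpace_fin]; omega) (norm_axis (by omega))
    (Φ := fun t => H |t| * Q.eval (t ^ 2)) (by fun_prop)
  rw [finrank_euclideanSpace_fin, show k + 3 + 2 - 1 = k + 4 by omega,
    show k + 3 + 2 - 2 = k + 3 by omega] at hz
  have h2 := integral_abs_cos_mul_sin_pow (g := fun t => H t * Q.eval (t ^ 2)) (by fun_prop) (k + 3)
  simp only [sq_abs] at h2
  change ∫ u : sphere (0 : EuclideanSpace ℝ (Fin (k + 3 + 2))) 1,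
    H |⟪axis (k + 3 + 2), (u : EuclideanSpace ℝ (Fin (k + 3 + 2)))⟫| *
      Q.eval (⟪axis (k + 3 + 2), (u : EuclideanSpace ℝ (Fin (k + 3 + 2)))⟫ ^ 2) ∂_ = _
  rw [hz, h2, mul_left_comm (2 * Real.pi)⁻¹, mul_left_comm (2 * Real.pi)⁻¹]
  congr 2
  have hparts := integral_deriv_comp_cos (G := G) (G' := G') (by fun_prop) (by fun_prop)
    (fun t _ => hd t) (hasDerivAt_cos_mul_comp_cos_sq k (fun x => Q.hasDerivAt x)) (by fun_prop)
    (by simp) (by simp) (right_mem_Icc.2 zero_le_one)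
  simp only [one_mul] at hparts
  have e1 : ∀ θ, H (Real.cos θ) * Q.eval (Real.cos θ ^ 2) * Real.sin θ ^ (k + 3) =
      (2 * Real.pi)⁻¹ * (G (Real.cos θ) * (((k : ℝ) + 2) * Q.eval (Real.cos θ ^ 2) *
        Real.sin θ ^ (k + 3)) + G' (Real.cos θ) * (Real.sin θ * (Real.cos θ *
          (Q.eval (Real.cos θ ^ 2) * Real.sin θ ^ (k + 2))))) := by
    intro θ; simp only [hH]; ring
  simp_rw [e1]
  rw [intervalIntegral.integral_const_mul, intervalIntegral.integral_add
    (Continuous.intervalIntegrable (by fun_prop) _ _)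
    (Continuous.intervalIntegrable (by fun_prop) _ _), hparts, ← intervalIntegral.integral_add
    (Continuous.intervalIntegrable (by fun_prop) _ _)
    (Continuous.intervalIntegrable (by fun_prop) _ _)]
  congr 1
  refine intervalIntegral.integral_congr fun θ _ => ?_
  simp only [hG, dualWeight]
  ring

/-- The same for a general continuous profile, by Weierstrass approximation. -/
lemma integral_zonalRadon_continuous (k : ℕ) {P Q : Polynomial ℝ} {G : ℝ → ℝ} (hGc : Continuous G)
    (hPQ : ∀ ξ : sphere (0 : EuclideanSpace ℝ (Fin (k + 3 + 2))) 1,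
      radonTransform (fun u => P.eval (height (u : EuclideanSpace ℝ (Fin (k + 3 + 2))) ^ 2)) ξ =
        Q.eval (height (ξ : EuclideanSpace ℝ (Fin (k + 3 + 2))) ^ 2)) :
    ∫ u : sphere (0 : EuclideanSpace ℝ (Fin (k + 3 + 2))) 1,
        P.eval (height (u : EuclideanSpace ℝ (Fin (k + 3 + 2))) ^ 2) *
        zonalRadon (k + 3) (fun t => G |t|)
          (√(1 - height (u : EuclideanSpace ℝ (Fin (k + 3 + 2))) ^ 2))
        ∂(volume : Measure (EuclideanSpace ℝ (Fin (k + 3 + 2)))).toSphere =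
      (2 * Real.pi)⁻¹ * (sphereArea (k + 4) * (2 * ∫ θ in (0 : ℝ)..(Real.pi / 2),
        G (Real.cos θ) *
          dualWeight k (fun x => Q.eval x) (fun x => Q.derivative.eval x) θ)) := by
  set σ := (volume : Measure (EuclideanSpace ℝ (Fin (k + 3 + 2)))).toSphere with hσ
  set w := dualWeight k (fun x => Q.eval x) (fun x => Q.derivative.eval x) with hw
  have hwc : Continuous w := continuous_dualWeight k (by fun_prop) (by fun_prop)
  obtain ⟨W, hW⟩ := (isCompact_Icc (a := (0 : ℝ)) (b := Real.pi / 2)).exists_bound_of_continuousOn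
    hwc.continuousOn
  have hPc : Continuous fun u : sphere (0 : EuclideanSpace ℝ (Fin (k + 3 + 2))) 1 =>
    P.eval (height (u : EuclideanSpace ℝ (Fin (k + 3 + 2))) ^ 2) := by fun_prop
  obtain ⟨D, hD0, hD⟩ := exists_abs_le_of_continuous hPc
  set c := (2 * Real.pi)⁻¹ with hc
  have hcpos : 0 < c := by rw [hc]; have := Real.pi_pos; positivity
  have hS := sphereArea_pos (k := k + 4) (by omega)
  have hS1 := sphereArea_pos (k := k + 3 - 2) (by omega)
  rw [← sub_eq_zero, ← abs_nonpos_iff]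
  refine nonpos_of_forall_le_mul (C := D * (sphereArea (k + 3 - 2) * Real.pi) * σ.real univ +
    c * (sphereArea (k + 4) * (2 * (W * (Real.pi / 2))))) fun ε hε => ?_
  obtain ⟨A, hA⟩ := exists_polynomial_near_of_continuousOn 0 1 (fun x => G √x)
    (by fun_prop) ε hε
  have hA' : ∀ t ∈ Icc (-1 : ℝ) 1, |G |t| - A.eval (|t| ^ 2)| ≤ ε := by
    intro t ht
    have h1 := hA (|t| ^ 2) ⟨by positivity, pow_le_one₀ (abs_nonneg t) (abs_le.2 ht)⟩
    rw [Real.sqrt_sq (abs_nonneg t), abs_sub_comm] at h1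
    exact h1.le
  have hpoly := integral_zonalRadon_polynomial k (A := A) hPQ
  rw [← hσ, ← hw] at hpoly
  have hcz : ∀ Φ : ℝ → ℝ, Continuous Φ → Integrable
      (fun u : sphere (0 : EuclideanSpace ℝ (Fin (k + 3 + 2))) 1 =>
        P.eval (height (u : EuclideanSpace ℝ (Fin (k + 3 + 2))) ^ 2) *
        zonalRadon (k + 3) Φ (√(1 - height (u : EuclideanSpace ℝ (Fin (k + 3 + 2))) ^ 2))) σ := by
    intro Φ hΦ
    have := continuous_zonalRadon (k + 3) hΦ
    exact integrable_sphere (by fun_prop)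
  have h1 : |(∫ u : sphere (0 : EuclideanSpace ℝ (Fin (k + 3 + 2))) 1,
        P.eval (height (u : EuclideanSpace ℝ (Fin (k + 3 + 2))) ^ 2) *
        zonalRadon (k + 3) (fun t => G |t|)
          (√(1 - height (u : EuclideanSpace ℝ (Fin (k + 3 + 2))) ^ 2)) ∂σ) -
      ∫ u : sphere (0 : EuclideanSpace ℝ (Fin (k + 3 + 2))) 1,
        P.eval (height (u : EuclideanSpace ℝ (Fin (k + 3 + 2))) ^ 2) *
        zonalRadon (k + 3) (fun t => A.eval (|t| ^ 2))
          (√(1 - height (u : EuclideanSpace ℝ (Fin (k + 3 + 2))) ^ 2)) ∂σ| ≤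
      D * (sphereArea (k + 3 - 2) * (ε * Real.pi)) * σ.real univ := by
    rw [← integral_sub (hcz _ (by fun_prop)) (hcz _ (by fun_prop)), ← Real.norm_eq_abs]
    refine norm_integral_le_of_norm_le_const (.of_forall fun u => ?_)
    rw [← mul_sub, norm_mul]
    exact mul_le_mul (hD u) (abs_zonalRadon_sub_le (k + 3) (by omega) (by fun_prop) (by fun_prop) hA'
      (sqrt_one_sub_sq_mem _)) (norm_nonneg _) hD0
  have h2 : |(∫ θ in (0 : ℝ)..(Real.pi / 2), A.eval (Real.cos θ ^ 2) * w θ) -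
      ∫ θ in (0 : ℝ)..(Real.pi / 2), G (Real.cos θ) * w θ| ≤ ε * W * (Real.pi / 2) := by
    rw [← intervalIntegral.integral_sub (Continuous.intervalIntegrable (by fun_prop) _ _)
      (Continuous.intervalIntegrable (by fun_prop) _ _), ← Real.norm_eq_abs]
    have h3 := intervalIntegral.norm_integral_le_of_norm_le_const (a := 0) (b := Real.pi / 2)
      (C := ε * W) (f := fun θ => A.eval (Real.cos θ ^ 2) * w θ - G (Real.cos θ) * w θ) fun θ hθ => ?_
    · rwa [sub_zero, abs_of_nonneg (by positivity)] at h3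
    · rw [uIoc_of_le (by positivity)] at hθ
      have hcos : 0 ≤ Real.cos θ :=
        Real.cos_nonneg_of_mem_Icc ⟨by linarith [hθ.1, Real.pi_pos], hθ.2⟩
      have h4 := hA' (Real.cos θ) ⟨by linarith, Real.cos_le_one θ⟩
      rw [abs_of_nonneg hcos, abs_sub_comm] at h4
      rw [← sub_mul, norm_mul]
      exact mul_le_mul h4 (hW θ (Ioc_subset_Icc_self hθ)) (norm_nonneg _) hε.le
  rw [hpoly] at h1
  have h3 : |c * (sphereArea (k + 4) * (2 * ∫ θ in (0 : ℝ)..(Real.pi / 2),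
        A.eval (Real.cos θ ^ 2) * w θ)) - c * (sphereArea (k + 4) *
        (2 * ∫ θ in (0 : ℝ)..(Real.pi / 2), G (Real.cos θ) * w θ))| ≤
      c * (sphereArea (k + 4) * (2 * (ε * W * (Real.pi / 2)))) := by
    rw [← mul_sub, ← mul_sub, ← mul_sub, abs_mul, abs_mul, abs_mul, abs_of_pos hcpos,
      abs_of_pos hS, abs_two]
    gcongr
  refine (abs_sub_le _ _ _).trans ((add_le_add h1 h3).trans_eq ?_)
  ring

/-- If `K_{n+2}` is an intersection body, then the integral of `fⁿ⁻¹` against the weight of a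
nonnegative polynomial `Q` is nonnegative: it is a positive multiple of the integral of `Q` with
respect to the measure of the intersection body. -/
theorem IsIntersectionBodyOf.integral_dualWeight_polynomial_nonneg {k : ℕ} {ρ : ℝ → ℝ}
    {L : Set (EuclideanSpace ℝ (Fin (k + 3)))}
    (hρ : ∀ φ ∈ Icc (0 : ℝ) (Real.pi / 2), 0 ≤ ρ φ)
    (hKL : IsIntersectionBodyOf (bodyOfRevolution (k + 3) ρ) L)
    (hK : IsIntersectionBody (bodyOfRevolution (k + 3 + 2) ρ)) (Q : Polynomial ℝ)
    (hQ : ∀ x ∈ Icc (0 : ℝ) 1, 0 ≤ Q.eval x) :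
    0 ≤ ∫ θ in (0 : ℝ)..(Real.pi / 2), axialProfile L (Real.cos θ) ^ (k + 2) *
      dualWeight k (fun x => Q.eval x) (fun x => Q.derivative.eval x) θ := by
  obtain ⟨-, -, μ, -, -, hμ⟩ := hK
  obtain ⟨P, hP⟩ := exists_radonTransform_eq_polynomial (N := k + 3 + 2) (by omega) Q
  have hPQ := hP (axis (k + 3 + 2)) (norm_axis (by omega))
  have hfc := continuous_axialProfile (by omega) hKL.isStarBody'
  have h1 := hμ (fun u => P.eval (height (u : EuclideanSpace ℝ (Fin (k + 3 + 2))) ^ 2))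
    (by fun_prop)
  have h2 := integral_zonalRadon_continuous k (G := fun t => axialProfile L t ^ (k + 2))
    (by fun_prop) hPQ
  have h3 : ∀ u : sphere (0 : EuclideanSpace ℝ (Fin (k + 3 + 2))) 1,
      radial (bodyOfRevolution (k + 3 + 2) ρ) u *
        P.eval (height (u : EuclideanSpace ℝ (Fin (k + 3 + 2))) ^ 2) =
      (((k + 3 : ℕ) : ℝ) - 1)⁻¹ *
        (P.eval (height (u : EuclideanSpace ℝ (Fin (k + 3 + 2))) ^ 2) *
          zonalRadon (k + 3) (fun t => axialProfile L |t| ^ (k + 2))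
            (√(1 - height (u : EuclideanSpace ℝ (Fin (k + 3 + 2))) ^ 2))) := by
    intro u
    rw [hKL.radial_add_two (by omega) hρ, show k + 3 - 1 = k + 2 by omega]
    ring
  have h4 : ∀ ξ : sphere (0 : EuclideanSpace ℝ (Fin (k + 3 + 2))) 1,
      0 ≤ radonTransform
        (fun u => P.eval (height (u : EuclideanSpace ℝ (Fin (k + 3 + 2))) ^ 2)) ξ := by
    intro ξ
    have h5 := hPQ ξ
    change radonTransform
      (fun u => P.eval (height (u : EuclideanSpace ℝ (Fin (k + 3 + 2))) ^ 2)) ξ = _ at h5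
    rw [h5]
    exact hQ _ ⟨sq_nonneg _, inner_sphere_sq_le (norm_axis (by omega)) ξ⟩
  have h6 : 0 ≤ ∫ ξ, radonTransform
      (fun u => P.eval (height (u : EuclideanSpace ℝ (Fin (k + 3 + 2))) ^ 2)) ξ ∂μ :=
    integral_nonneg fun ξ => h4 ξ
  simp_rw [h3] at h1
  rw [← h1, integral_const_mul, h2] at h6
  have hc : (0 : ℝ) < ((k + 3 : ℕ) : ℝ) - 1 := by push_cast; linarith [(Nat.cast_nonneg k : (0 : ℝ) ≤ k)]
  have hS := sphereArea_pos (k := k + 4) (by omega)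
  have hpi : (0 : ℝ) < (2 * Real.pi)⁻¹ := by have := Real.pi_pos; positivity
  have h7 := (mul_nonneg_iff_of_pos_left (inv_pos.2 hc)).1 h6
  have h8 := (mul_nonneg_iff_of_pos_left hS).1 ((mul_nonneg_iff_of_pos_left hpi).1 h7)
  linarith

lemma exists_polynomial_derivative_eq (P : Polynomial ℝ) :
    ∃ B : Polynomial ℝ, Polynomial.derivative B = P := by
  induction P using Polynomial.induction_on' with
  | add P₁ P₂ h₁ h₂ =>
    obtain ⟨B₁, rfl⟩ := h₁
    obtain ⟨B₂, rfl⟩ := h₂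
    exact ⟨B₁ + B₂, by simp⟩
  | monomial j a =>
    refine ⟨Polynomial.monomial (j + 1) (a / (j + 1)), ?_⟩
    rw [Polynomial.derivative_monomial]
    congr 1
    push_cast
    exact div_mul_cancel₀ _ (by positivity)

/-- Nonnegativity against polynomial weights extends to continuously differentiable weights, by
polynomial approximation of the derivative. -/
lemma integral_dualWeight_nonneg {k : ℕ} {g q q' : ℝ → ℝ} (hg : Continuous g)
    (hpoly : ∀ Q : Polynomial ℝ, (∀ x ∈ Icc (0 : ℝ) 1, 0 ≤ Q.eval x) →
      0 ≤ ∫ θ in (0 : ℝ)..(Real.pi / 2), g θ *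
        dualWeight k (fun x => Q.eval x) (fun x => Q.derivative.eval x) θ)
    (hq : ∀ x, HasDerivAt q (q' x) x) (hq' : Continuous q') (hq0 : ∀ x ∈ Icc (0 : ℝ) 1, 0 ≤ q x) :
    0 ≤ ∫ θ in (0 : ℝ)..(Real.pi / 2), g θ * dualWeight k q q' θ := by
  have hqc : Continuous q := continuous_iff_continuousAt.2 fun x => (hq x).continuousAt
  -- the weight is linear in `q` and `q'`
  set U := dualWeight k (fun _ => 1) (fun _ => 0) with hU
  set V := dualWeight k (fun _ => 0) (fun _ => 1) with hV
  have hlin : ∀ (a a' : ℝ → ℝ) (θ : ℝ),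
      dualWeight k a a' θ = a (Real.cos θ ^ 2) * U θ + a' (Real.cos θ ^ 2) * V θ := by
    intro a a' θ
    simp only [hU, hV, dualWeight]
    ring
  have hUc : Continuous U := continuous_dualWeight k continuous_const continuous_const
  have hVc : Continuous V := continuous_dualWeight k continuous_const continuous_const
  obtain ⟨M, hM⟩ := (isCompact_Icc (a := (0 : ℝ)) (b := Real.pi / 2)).exists_bound_of_continuousOn
    (f := fun θ => |g θ| * (2 * |U θ| + |V θ|)) (Continuous.continuousOn (by fun_prop))
  rw [← neg_nonpos]
  refine nonpos_of_forall_le_mul (C := M * (Real.pi / 2)) fun ε hε => ?_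
  obtain ⟨P, hP⟩ := exists_polynomial_near_of_continuousOn 0 1 q' hq'.continuousOn ε hε
  obtain ⟨B, hB⟩ := exists_polynomial_derivative_eq P
  -- the constant lifts `Q` above `q` by `ε` at `0`, so that `Q` stays nonnegative on `[0, 1]`
  set Q : Polynomial ℝ := B + Polynomial.C (q 0 + ε - B.eval 0) with hQ
  have hQ' : Polynomial.derivative Q = P := by simp [hQ, hB]
  have hQ0 : Q.eval 0 - q 0 = ε := by simp [hQ]
  have hdist : ∀ x ∈ Icc (0 : ℝ) 1, |(Q.eval x - q x) - ε| ≤ ε := by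
    intro x hx
    have h1 := (convex_Icc (0 : ℝ) 1).norm_image_sub_le_of_norm_hasDerivWithin_le
      (f := fun x => Q.eval x - q x) (f' := fun x => P.eval x - q' x) (C := ε) (x := 0) (y := x)
      (fun y _ => by
        have := (Q.hasDerivAt y).sub (hq y)
        rw [hQ'] at this
        exact this.hasDerivWithinAt) (fun y hy => (hP y hy).le) (by simp) hx
    rw [hQ0, sub_zero, Real.norm_eq_abs, Real.norm_eq_abs, abs_of_nonneg hx.1] at h1
    exact h1.trans (mul_le_of_le_one_right hε.le hx.2)
  have hQnonneg : ∀ x ∈ Icc (0 : ℝ) 1, 0 ≤ Q.eval x := fun x hx => by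
    have := (abs_le.1 (hdist x hx)).1
    linarith [hq0 x hx]
  have h2 := hpoly Q hQnonneg
  rw [hQ'] at h2
  have hwq : Continuous (dualWeight k q q') := continuous_dualWeight k hqc hq'
  have hwQ : Continuous (dualWeight k (fun x => Q.eval x) (fun x => P.eval x)) :=
    continuous_dualWeight k (by fun_prop) (by fun_prop)
  have h3 : |(∫ θ in (0 : ℝ)..(Real.pi / 2), g θ *
        dualWeight k (fun x => Q.eval x) (fun x => P.eval x) θ) -
      ∫ θ in (0 : ℝ)..(Real.pi / 2), g θ * dualWeight k q q' θ| ≤ ε * M * (Real.pi / 2) := by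
    rw [← intervalIntegral.integral_sub (Continuous.intervalIntegrable (by fun_prop) _ _)
      (Continuous.intervalIntegrable (by fun_prop) _ _), ← Real.norm_eq_abs]
    have h4 := intervalIntegral.norm_integral_le_of_norm_le_const (a := 0) (b := Real.pi / 2)
      (C := ε * M) (f := fun θ => g θ * dualWeight k (fun x => Q.eval x) (fun x => P.eval x) θ -
        g θ * dualWeight k q q' θ) fun θ hθ => ?_
    · rwa [sub_zero, abs_of_nonneg (by positivity)] at h4
    · rw [uIoc_of_le (by positivity)] at hθ
      have hx : Real.cos θ ^ 2 ∈ Icc (0 : ℝ) 1 := ⟨sq_nonneg _, Real.cos_sq_le_one θ⟩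
      have h5 : |Q.eval (Real.cos θ ^ 2) - q (Real.cos θ ^ 2)| ≤ 2 * ε := by
        have := abs_le.1 (hdist _ hx)
        exact abs_le.2 ⟨by linarith [this.1], by linarith [this.2]⟩
      have h6 : |P.eval (Real.cos θ ^ 2) - q' (Real.cos θ ^ 2)| ≤ ε := (hP _ hx).le
      have h7 := hM θ (Ioc_subset_Icc_self hθ)
      rw [Real.norm_of_nonneg (by positivity)] at h7
      rw [← mul_sub, hlin, hlin, norm_mul, Real.norm_eq_abs, Real.norm_eq_abs]
      have h8 : |Q.eval (Real.cos θ ^ 2) * U θ + P.eval (Real.cos θ ^ 2) * V θ -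
          (q (Real.cos θ ^ 2) * U θ + q' (Real.cos θ ^ 2) * V θ)| ≤
          2 * ε * |U θ| + ε * |V θ| := by
        rw [show Q.eval (Real.cos θ ^ 2) * U θ + P.eval (Real.cos θ ^ 2) * V θ -
          (q (Real.cos θ ^ 2) * U θ + q' (Real.cos θ ^ 2) * V θ) =
          (Q.eval (Real.cos θ ^ 2) - q (Real.cos θ ^ 2)) * U θ +
          (P.eval (Real.cos θ ^ 2) - q' (Real.cos θ ^ 2)) * V θ by ring]
        refine (abs_add_le _ _).trans ?_
        rw [abs_mul, abs_mul]
        gcongr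
      calc |g θ| * _ ≤ |g θ| * (2 * ε * |U θ| + ε * |V θ|) := by gcongr
        _ = ε * (|g θ| * (2 * |U θ| + |V θ|)) := by ring
        _ ≤ ε * M := by gcongr
  have h9 := (abs_le.1 h3).2
  linarith

/-! ### Bump functions in the angle variable -/

/-- A smooth bump function of the angle which increases from `0` to `1` on `[a, a + δ]` and
decreases back to `0` on `[b, b + δ]`. -/
def angleBump (a b δ θ : ℝ) : ℝ :=
  Real.smoothTransition ((θ - a) / δ) - Real.smoothTransition ((θ - b) / δ)

lemma deriv_smoothTransition_eq_zero {x : ℝ} (hx : x ≤ 0 ∨ 1 ≤ x) :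
    deriv Real.smoothTransition x = 0 := by
  rcases hx with h | h
  · refine IsLocalMin.deriv_eq_zero (.of_forall fun y => ?_)
    rw [Real.smoothTransition.zero_of_nonpos h]
    exact Real.smoothTransition.nonneg y
  · refine IsLocalMax.deriv_eq_zero (.of_forall fun y => ?_)
    rw [Real.smoothTransition.one_of_one_le h]
    exact Real.smoothTransition.le_one y

section

variable {a b δ : ℝ}

lemma contDiff_angleBump : ContDiff ℝ 1 (angleBump a b δ) := by
  have h := Real.smoothTransition.contDiff (n := 1)
  unfold angleBump
  exact (h.comp (by fun_prop)).sub (h.comp (by fun_prop))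

lemma angleBump_nonneg (hδ : 0 < δ) (hab : a ≤ b) (θ : ℝ) : 0 ≤ angleBump a b δ θ :=
  sub_nonneg.2 (Real.smoothTransition.monotone (by gcongr))

lemma angleBump_eq_zero_of_le (hδ : 0 < δ) (hab : a ≤ b) {θ : ℝ} (h : θ ≤ a) :
    angleBump a b δ θ = 0 := by
  rw [angleBump, Real.smoothTransition.zero_of_nonpos (div_nonpos_of_nonpos_of_nonneg (by linarith) hδ.le),
    Real.smoothTransition.zero_of_nonpos (div_nonpos_of_nonpos_of_nonneg (by linarith) hδ.le), sub_zero]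

lemma angleBump_eq_zero_of_ge (hδ : 0 < δ) (hab : a ≤ b) {θ : ℝ} (h : b + δ ≤ θ) :
    angleBump a b δ θ = 0 := by
  rw [angleBump, Real.smoothTransition.one_of_one_le ((one_le_div hδ).2 (by linarith)),
    Real.smoothTransition.one_of_one_le ((one_le_div hδ).2 (by linarith)), sub_self]

lemma hasDerivAt_angleBump (θ : ℝ) :
    HasDerivAt (angleBump a b δ) ((deriv Real.smoothTransition ((θ - a) / δ) -
      deriv Real.smoothTransition ((θ - b) / δ)) / δ) θ := by
  have h : ∀ x, HasDerivAt Real.smoothTransition (deriv Real.smoothTransition x) x := fun x =>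
    ((Real.smoothTransition.contDiff (n := 1)).differentiable (by norm_num) x).hasDerivAt
  have h1 : ∀ c, HasDerivAt (fun θ => (θ - c) / δ) (1 / δ) θ := fun c =>
    ((hasDerivAt_id θ).sub_const c).div_const δ
  refine (((h ((θ - a) / δ)).comp θ (h1 a)).sub ((h ((θ - b) / δ)).comp θ (h1 b))).congr_deriv ?_
  ring

/-- If `ψ` is larger near `b` than near `a`, then integrating it against the derivative of the bump
function gives a negative result. -/
lemma integral_mul_deriv_angleBump_neg {ψ : ℝ → ℝ} (hψ : Continuous ψ) {c m : ℝ} (hδ : 0 < δ)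
    (ha : 0 < a) (hab : a + δ ≤ b) (hbc : b + δ < c) (h1 : ∀ θ ∈ Icc a (a + δ), ψ θ < m)
    (h2 : ∀ θ ∈ Icc b (b + δ), m < ψ θ) :
    ∫ θ in (0 : ℝ)..c, ψ θ * deriv (angleBump a b δ) θ < 0 := by
  have hcd := contDiff_angleBump (a := a) (b := b) (δ := δ)
  have hη' : Continuous (deriv (angleBump a b δ)) := hcd.continuous_deriv le_rfl
  have hc : 0 < c := by linarith
  have htotal : ∫ θ in (0 : ℝ)..c, m * deriv (angleBump a b δ) θ = 0 := by
    rw [intervalIntegral.integral_const_mul, intervalIntegral.integral_deriv_eq_sub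
      (fun θ _ => (hcd.differentiable one_ne_zero) θ) (hη'.intervalIntegrable _ _),
      angleBump_eq_zero_of_le hδ (by linarith) ha.le,
      angleBump_eq_zero_of_ge hδ (by linarith) hbc.le]
    simp
  refine lt_of_lt_of_eq ?_ htotal
  have hmono : ∀ x, 0 ≤ deriv Real.smoothTransition x := fun x =>
    Real.smoothTransition.monotone.deriv_nonneg
  refine intervalIntegral.integral_lt_integral_of_continuousOn_of_le_of_exists_lt
    (f := fun θ => ψ θ * deriv (angleBump a b δ) θ) (g := fun θ => m * deriv (angleBump a b δ) θ) hc
    (hψ.mul hη').continuousOn (continuous_const.mul hη').continuousOn (fun θ _ => ?_) ?_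
  · rw [(hasDerivAt_angleBump θ).deriv]
    by_cases hA : θ ∈ Icc a (a + δ)
    · have h3 : deriv Real.smoothTransition ((θ - b) / δ) = 0 :=
        deriv_smoothTransition_eq_zero (Or.inl
          (div_nonpos_of_nonpos_of_nonneg (by linarith [hA.2]) hδ.le))
      rw [h3, sub_zero]
      exact mul_le_mul_of_nonneg_right (h1 θ hA).le (div_nonneg (hmono _) hδ.le)
    · have h3 : deriv Real.smoothTransition ((θ - a) / δ) = 0 := by
        refine deriv_smoothTransition_eq_zero ?_
        rw [mem_Icc, not_and_or, not_le, not_le] at hA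
        rcases hA with h | h
        · exact Or.inl (div_nonpos_of_nonpos_of_nonneg (by linarith) hδ.le)
        · exact Or.inr ((one_le_div hδ).2 (by linarith))
      rw [h3, zero_sub]
      by_cases hB : θ ∈ Icc b (b + δ)
      · exact mul_le_mul_of_nonpos_right (h2 θ hB).le
          (div_nonpos_of_nonpos_of_nonneg (neg_nonpos.2 (hmono _)) hδ.le)
      · have h4 : deriv Real.smoothTransition ((θ - b) / δ) = 0 := by
          refine deriv_smoothTransition_eq_zero ?_
          rw [mem_Icc, not_and_or, not_le, not_le] at hB
          rcases hB with h | h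
          · exact Or.inl (div_nonpos_of_nonpos_of_nonneg (by linarith) hδ.le)
          · exact Or.inr ((one_le_div hδ).2 (by linarith))
        simp [h4]
  · obtain ⟨θ, hθ, hslope⟩ := exists_deriv_eq_slope (angleBump a b δ) (a := a) (b := a + δ)
      (by linarith) hcd.continuous.continuousOn (hcd.differentiable one_ne_zero).differentiableOn
    refine ⟨θ, ⟨by linarith [hθ.1], by linarith [hθ.2]⟩, ?_⟩
    have h5 : angleBump a b δ (a + δ) = 1 := by
      rw [angleBump, Real.smoothTransition.one_of_one_le ((one_le_div hδ).2 (by linarith)),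
        Real.smoothTransition.zero_of_nonpos
          (div_nonpos_of_nonpos_of_nonneg (by linarith) hδ.le), sub_zero]
    rw [h5, angleBump_eq_zero_of_le hδ (by linarith) le_rfl] at hslope
    refine mul_lt_mul_of_pos_right (h1 θ (Ioo_subset_Icc_self hθ)) ?_
    rw [hslope]
    have : a + δ - a = δ := by ring
    rw [this]
    positivity

end

/-- The function `q` with `cos θ · q(cos² θ) · sinᵏ⁺² θ = cosᵏ⁺² θ · η(θ)`. With this choice the
terms of `dualWeight` that contain `η` itself cancel. -/
def angleLift (k : ℕ) (η : ℝ → ℝ) (x : ℝ) : ℝ :=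
  √x ^ (k + 1) / √(1 - x) ^ (k + 2) * η (Real.arccos √x)

/-- Although `√x` and `√(1 - x)` are singular at the endpoints, the function is `C¹`, because it
vanishes near and beyond them. -/
lemma contDiff_angleLift (k : ℕ) {η : ℝ → ℝ} (hη : ContDiff ℝ 1 η) {α β : ℝ} (hα : 0 < α)
    (hαβ : α ≤ β) (hβ : β < Real.pi / 2) (h1 : ∀ θ ≤ α, η θ = 0) (h2 : ∀ θ, β ≤ θ → η θ = 0) :
    ContDiff ℝ 1 (angleLift k η) := by
  have hcosβ : 0 < Real.cos β := Real.cos_pos_of_mem_Ioo ⟨by linarith, hβ⟩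
  have hcosα : Real.cos α < 1 := by
    rw [← Real.cos_zero]
    exact Real.cos_lt_cos_of_nonneg_of_le_pi_div_two le_rfl (by linarith) hα
  have hcosα0 : 0 < Real.cos α := Real.cos_pos_of_mem_Ioo ⟨by linarith, by linarith⟩
  rw [contDiff_iff_contDiffAt]
  intro x
  by_cases hx0 : x < Real.cos β ^ 2
  · have : angleLift k η =ᶠ[𝓝 x] fun _ => 0 := by
      filter_upwards [Iio_mem_nhds hx0] with y hy
      have h3 : √y ≤ Real.cos β := Real.sqrt_le_iff.2 ⟨hcosβ.le, (le_of_lt hy)⟩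
      have h4 : β ≤ Real.arccos √y := by
        rw [← Real.arccos_cos (by linarith : 0 ≤ β) (by linarith [Real.pi_pos])]
        exact Real.arccos_le_arccos h3
      rw [angleLift, h2 _ h4, mul_zero]
    exact contDiffAt_const.congr_of_eventuallyEq this
  by_cases hx1 : Real.cos α ^ 2 < x
  · have : angleLift k η =ᶠ[𝓝 x] fun _ => 0 := by
      filter_upwards [Ioi_mem_nhds hx1] with y hy
      have h3 : Real.cos α ≤ √y := Real.le_sqrt_of_sq_le (le_of_lt hy)
      have h4 : Real.arccos √y ≤ α := by
        rw [← Real.arccos_cos hα.le (by linarith [Real.pi_pos])]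
        exact Real.arccos_le_arccos h3
      rw [angleLift, h1 _ h4, mul_zero]
    exact contDiffAt_const.congr_of_eventuallyEq this
  have hxpos : 0 < x := lt_of_lt_of_le (by positivity) (not_lt.1 hx0)
  have hxlt : x < 1 := lt_of_le_of_lt (not_lt.1 hx1) (by nlinarith)
  have hs : 0 < √x := Real.sqrt_pos.2 hxpos
  have hs1 : √x < 1 := by rw [Real.sqrt_lt' one_pos]; simpa using hxlt
  have hsqrt : ContDiffAt ℝ 1 (fun x => √x) x := Real.contDiffAt_sqrt hxpos.ne'
  have hsqrt1 : ContDiffAt ℝ 1 (fun x => √(1 - x)) x :=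
    (contDiffAt_const.sub contDiffAt_id).sqrt (by simp only [id]; linarith)
  have harc : ContDiffAt ℝ 1 (fun x => Real.arccos √x) x :=
    (Real.contDiffAt_arccos (by linarith) hs1.ne).comp x hsqrt
  exact ((hsqrt.pow _).div (hsqrt1.pow _) (pow_ne_zero _ (Real.sqrt_pos.2 (by linarith)).ne')).mul
    (hη.contDiffAt.comp x harc)

lemma dualWeight_angleLift (k : ℕ) {η : ℝ → ℝ} (hη : ContDiff ℝ 1 η)
    (hq : ContDiff ℝ 1 (angleLift k η)) {θ : ℝ} (hθ : θ ∈ Ioo 0 (Real.pi / 2)) :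
    dualWeight k (angleLift k η) (deriv (angleLift k η)) θ =
      Real.cos θ ^ (k + 2) * deriv η θ := by
  have hlift : ∀ t ∈ Ioo 0 (Real.pi / 2), 0 < Real.cos t ∧ 0 < Real.sin t ∧
      angleLift k η (Real.cos t ^ 2) =
        Real.cos t ^ (k + 1) / Real.sin t ^ (k + 2) * η t := by
    intro t ht
    have hc : 0 < Real.cos t :=
      Real.cos_pos_of_mem_Ioo ⟨by linarith [ht.1, Real.pi_pos], ht.2⟩
    have hs : 0 < Real.sin t := Real.sin_pos_of_pos_of_lt_pi ht.1 (by linarith [ht.2, Real.pi_pos])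
    refine ⟨hc, hs, ?_⟩
    have h1 : 1 - Real.cos t ^ 2 = Real.sin t ^ 2 := by rw [Real.sin_sq]
    rw [angleLift, h1, Real.sqrt_sq hc.le, Real.sqrt_sq hs.le,
      Real.arccos_cos ht.1.le (by linarith [ht.2, Real.pi_pos])]
  have hd1 := hasDerivAt_cos_mul_comp_cos_sq k (q := angleLift k η) (q' := deriv (angleLift k η))
    (fun x => ((hq.differentiable one_ne_zero) x).hasDerivAt) θ
  have hev : (fun θ => Real.cos θ * (angleLift k η (Real.cos θ ^ 2) * Real.sin θ ^ (k + 2))) =ᶠ[𝓝 θ]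
      fun θ => Real.cos θ ^ (k + 2) * η θ := by
    filter_upwards [Ioo_mem_nhds hθ.1 hθ.2] with t ht
    obtain ⟨hc, hs, h⟩ := hlift t ht
    rw [h]
    field_simp
    ring
  have hd2 : HasDerivAt (fun θ => Real.cos θ ^ (k + 2) * η θ)
      (((k : ℝ) + 2) * Real.cos θ ^ (k + 1) * -Real.sin θ * η θ +
        Real.cos θ ^ (k + 2) * deriv η θ) θ := by
    have h1 : HasDerivAt (fun θ => Real.cos θ ^ (k + 2))
        (((k : ℝ) + 2) * Real.cos θ ^ (k + 1) * -Real.sin θ) θ := by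
      simpa using (Real.hasDerivAt_cos θ).fun_pow (k + 2)
    exact h1.fun_mul ((hη.differentiable one_ne_zero) θ).hasDerivAt
  have huniq := (hd1.congr_of_eventuallyEq hev.symm).unique hd2
  obtain ⟨hc, hs, h⟩ := hlift θ hθ
  rw [dualWeight, huniq, h]
  field_simp
  ring

/-- If the body of revolution in dimension `k + 5` is an intersection body, then `t f(t)` is
nondecreasing, where `f` is the profile of `L`. -/
theorem IsIntersectionBodyOf.monotoneOn_of_isIntersectionBody {k : ℕ} {ρ : ℝ → ℝ}
    {L : Set (EuclideanSpace ℝ (Fin (k + 3)))}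
    (hρ : ∀ φ ∈ Icc (0 : ℝ) (Real.pi / 2), 0 ≤ ρ φ)
    (hKL : IsIntersectionBodyOf (bodyOfRevolution (k + 3) ρ) L)
    (hK : IsIntersectionBody (bodyOfRevolution (k + 3 + 2) ρ)) :
    MonotoneOn (fun t => t * axialProfile L t) (Icc 0 1) := by
  set f := axialProfile L with hf
  have hfc : Continuous f := continuous_axialProfile (by omega) hKL.isStarBody'
  have hf0 : ∀ t, 0 ≤ f t := axialProfile_nonneg (by omega) hKL.isStarBody'
  by_contra hnot
  rw [MonotoneOn] at hnot
  push Not at hnot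
  obtain ⟨s, hs, t, ht, hst, hlt⟩ := hnot
  -- in the angle variable, `g` is larger at `β` than at `α < β`; a bump that rises just after `α` and
  -- falls just after `β` gives a negative integral
  set g : ℝ → ℝ := fun θ => Real.cos θ * f (Real.cos θ) with hg
  have hgc : Continuous g := by fun_prop
  have hcost : Real.cos (Real.arccos t) = t := Real.cos_arccos (by linarith [ht.1]) ht.2
  have hcoss : Real.cos (Real.arccos s) = s := Real.cos_arccos (by linarith [hs.1]) hs.2
  have hspos : 0 < s := by
    rcases hs.1.eq_or_lt with h | h
    · rw [← h, zero_mul] at hlt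
      exact absurd hlt (not_lt.2 (mul_nonneg ht.1 (hf0 t)))
    · exact h
  have hst' : s < t := lt_of_le_of_ne hst (by rintro rfl; exact lt_irrefl _ hlt)
  set α := Real.arccos t with hα
  set β := Real.arccos s with hβ
  have hα0 : 0 ≤ α := Real.arccos_nonneg t
  have hβ2 : β < Real.pi / 2 := Real.arccos_lt_pi_div_two.2 hspos
  have hαβ : α < β := Real.arccos_lt_arccos (by linarith [hs.1]) hst' ht.2
  set m := (g α + g β) / 2 with hm
  have hgα : g α < m := by
    have : g α < g β := by simpa only [hg, hcost, hcoss] using hlt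
    linarith
  have hgβ : m < g β := by linarith
  obtain ⟨r₁, hr₁, hr₁'⟩ := Metric.eventually_nhds_iff.1 ((hgc.tendsto α).eventually_lt_const hgα)
  obtain ⟨r₂, hr₂, hr₂'⟩ := Metric.eventually_nhds_iff.1 ((hgc.tendsto β).eventually_const_lt hgβ)
  obtain ⟨δ, hδ, hδ1, hδ2, hδ3, hδ4⟩ : ∃ δ > 0, 2 * δ < r₁ ∧ δ < r₂ ∧ 2 * δ ≤ β - α ∧
      δ < Real.pi / 2 - β := by
    refine ⟨min (min (r₁ / 3) (r₂ / 2)) (min ((β - α) / 2) ((Real.pi / 2 - β) / 2)), ?_, ?_, ?_, ?_, ?_⟩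
    · have : 0 < Real.pi / 2 - β := by linarith
      have : 0 < β - α := by linarith
      positivity
    · have := (min_le_left (min (r₁ / 3) (r₂ / 2)) (min ((β - α) / 2) ((Real.pi / 2 - β) / 2))).trans
        (min_le_left _ _)
      linarith
    · have := (min_le_left (min (r₁ / 3) (r₂ / 2)) (min ((β - α) / 2) ((Real.pi / 2 - β) / 2))).trans
        (min_le_right _ _)
      linarith
    · have := (min_le_right (min (r₁ / 3) (r₂ / 2)) (min ((β - α) / 2) ((Real.pi / 2 - β) / 2))).trans
        (min_le_left _ _)
      linarith
    · have := (min_le_right (min (r₁ / 3) (r₂ / 2)) (min ((β - α) / 2) ((Real.pi / 2 - β) / 2))).trans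
        (min_le_right _ _)
      linarith
  set η := angleBump (α + δ) β δ with hη
  have hηc : ContDiff ℝ 1 η := contDiff_angleBump
  have hq : ContDiff ℝ 1 (angleLift k η) := contDiff_angleLift k hηc (α := α + δ) (β := β + δ)
    (by linarith) (by linarith) (by linarith)
    (fun θ h => angleBump_eq_zero_of_le hδ (by linarith) h)
    (fun θ h => angleBump_eq_zero_of_ge hδ (by linarith) h)
  have hnonneg := integral_dualWeight_nonneg (k := k) (g := fun θ => f (Real.cos θ) ^ (k + 2))
    (by fun_prop) (hKL.integral_dualWeight_polynomial_nonneg hρ hK)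
    (fun x => ((hq.differentiable one_ne_zero) x).hasDerivAt) (hq.continuous_deriv le_rfl)
    (fun x _ => mul_nonneg (by positivity) (angleBump_nonneg hδ (by linarith) _))
  have hg0 : ∀ θ ∈ Icc 0 (Real.pi / 2), 0 ≤ g θ := fun θ hθ =>
    mul_nonneg (Real.cos_nonneg_of_mem_Icc ⟨by linarith [hθ.1, Real.pi_pos], hθ.2⟩) (hf0 _)
  have hm0 : 0 < m := lt_of_le_of_lt (hg0 α ⟨hα0, by linarith⟩) hgα
  have hneg : ∫ θ in (0 : ℝ)..(Real.pi / 2), g θ ^ (k + 2) * deriv η θ < 0 := by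
    refine integral_mul_deriv_angleBump_neg (m := m ^ (k + 2)) (by fun_prop) hδ (by linarith)
      (by linarith) (by linarith) (fun θ hθ => ?_) (fun θ hθ => ?_)
    · refine pow_lt_pow_left₀ (hr₁' ?_) (hg0 θ ⟨by linarith [hθ.1], by linarith [hθ.2]⟩) (by omega)
      rw [Real.dist_eq, abs_of_nonneg (by linarith [hθ.1])]
      linarith [hθ.2]
    · refine pow_lt_pow_left₀ (hr₂' ?_) hm0.le (by omega)
      rw [Real.dist_eq, abs_of_nonneg (by linarith [hθ.1])]
      linarith [hθ.2]
  refine absurd hnonneg (not_le.2 ?_)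
  rw [intervalIntegral.integral_of_le (by positivity), integral_Ioc_eq_integral_Ioo] at hneg ⊢
  refine (setIntegral_congr_fun measurableSet_Ioo fun θ hθ => ?_).trans_lt hneg
  simp only [dualWeight_angleLift k hηc hq hθ, hg, mul_pow]
  ring

end StarBodies

end

theorem mainTheorem5 (n : ℕ) (hn : 4 ≤ n) (hev : Even n)
    (ρ : ℝ → ℝ) (hρ : ∀ φ ∈ Set.Icc (0 : ℝ) (Real.pi / 2), 0 ≤ ρ φ)
    (L : Set (EuclideanSpace ℝ (Fin n)))
    (hKL : StarBodies.IsIntersectionBodyOf (StarBodies.bodyOfRevolution n ρ) L) :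
    (ContDiffOn ℝ 1 (StarBodies.axialProfile L) (Set.Icc 0 1) →
      StarBodies.IsInverseRadonTransform
        (fun ξ : Metric.sphere (0 : EuclideanSpace ℝ (Fin (n + 2))) 1 =>
          StarBodies.radial (StarBodies.bodyOfRevolution (n + 2) ρ)
            (ξ : EuclideanSpace ℝ (Fin (n + 2))))
        (fun θ => StarBodies.inverseProfile n (StarBodies.axialProfile L)
          |StarBodies.height (θ : EuclideanSpace ℝ (Fin (n + 2)))|)) ∧
    (StarBodies.EquatorConvex L →
      ContDiffOn ℝ 1 (StarBodies.axialProfile L) (Set.Icc 0 1) →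
      ∃ M : Set (EuclideanSpace ℝ (Fin (n + 2))),
        StarBodies.IsIntersectionBodyOf (StarBodies.bodyOfRevolution (n + 2) ρ) M) ∧
    (¬ StarBodies.EquatorConvex L →
      ¬ StarBodies.IsIntersectionBody (StarBodies.bodyOfRevolution (n + 2) ρ)) := by
  refine ⟨fun hf => hKL.isInverseRadonTransform (by omega) hρ hf,
    fun hconv hf => hKL.exists_isIntersectionBodyOf (by omega) hρ hconv hf, fun hnot hK => hnot ?_⟩
  obtain ⟨k, rfl⟩ : ∃ k, n = k + 3 := ⟨n - 3, by omega⟩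
  exact StarBodies.equatorConvex_of_monotoneOn (by omega) hKL.isStarBody'
    (hKL.radial_eq_axialProfile (by omega) hρ) (hKL.monotoneOn_of_isIntersectionBody hρ hK)
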